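/- Let $n\ge 1$. For a set $A$ in a Euclidean space write $\mathcal{C}A=\{rx : r\ge 0,\ x\in A\}$, and let $|\cdot|_d$ denote $d$-dimensional area (Hausdorff measure). A convex hypersurface of $\mathbb{R}^{n+2}$ is the boundary of a closed convex set with nonempty interior, different from $\mathbb{R}^{n+2}$; a compact (Lipschitz) hypersurface $\Gamma\subset\mathbb{S}^{n+1}$ is called convex if $\mathcal{C}\Gamma$ is a convex hypersurface of $\mathbb{R}^{n+2}$. Let $\Gamma_0\subset\mathbb{S}^{n+1}$ be a compact convex hypersurface and $p\in\Gamma_0$. Let $T_p\mathcal{C}\Gamma_0$ be the tangent cone (blow-up) of $\mathcal{C}\Gamma_0$ at $p$, with apex at $p$, and put $$T_p\Gamma_0=T_p\mathcal{C}\Gamma_0\cap\{x : \langle x-p,p\rangle=0\},\qquad \Theta_0=T_p\Gamma_0\cap\mathbb{S}^n_p,\qquad \mathbb{S}^n_p=\{x : \langle x-p,p\rangle=0,\ \|x-p\|=1\}.$$ Identify the hyperplane $\{x:\langle x-p,p\rangle=0\}$ with $p^\perp\cong\mathbb{R}^{n+1}$ by $x\mapsto x-p$, so that $\mathcal{C}\Theta_0\subset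 p^\perp$ is a cone with apex $0$ and $\mathbb{R}\times\mathcal{C}\Theta_0=\{tp+v : t\in\mathbb{R},\ v\in\mathcal{C}\Theta_0\}\subset\mathbb{R}p\oplus p^\perp=\mathbb{R}^{n+2}$. Then $$\frac{|\Gamma_0|_n}{|\mathbb{S}^n|_n}\le\frac{|\Theta_0|_{n-1}}{|\mathbb{S}^{n-1}|_{n-1}}.$$ Moreover, if $\mathcal{C}\Theta_0\ne\mathbb{R}^n$, that is, if $\mathcal{C}\Theta_0$ is not an $n$-dimensional linear subspace of $p^\perp$, then equality holds if and only if $\mathcal{C}\Gamma_0\cong\mathbb{R}\times\mathcal{C}\Theta_0$, meaning that some isometry of $\mathbb{R}^{n+2}$ maps one onto the other; and equality also holds if and only if $\mathcal{C}\Gamma_0=\mathbb{R}\times\mathcal{C}\Theta_0$ as subsets of $\mathbb{R}^{n+2}$. -/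

import Mathlib

open MeasureTheory
open scoped RealInnerProductSpace

/-- `IsConvexHypersurface S`: `S` is a complete convex hypersurface of the Euclidean space `E`, that
is, `S` is the boundary of a closed convex region `K` (the region `S` bounds) which has nonempty
interior and is not the whole space. -/
def IsConvexHypersurface {E : Type*} [NormedAddCommGroup E] [NormedSpace ℝ E] (S : Set E) : Prop :=
  ∃ K : Set E, IsClosed K ∧ Convex ℝ K ∧ (interior K).Nonempty ∧ K ≠ Set.univ ∧ S = frontier K

/-- The cone `𝒞A = {r x : r ∈ [0, ∞), x ∈ A}` over a set `A`. -/
def coneOver {E : Type*} [NormedAddCommGroup E] [NormedSpace ℝ E] (A : Set E) : Set E :=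
  {y | ∃ r : ℝ, 0 ≤ r ∧ ∃ x ∈ A, y = r • x}

/-- `Γ` is a compact convex hypersurface of the unit sphere of `E`: the cone over `Γ` is a convex
hypersurface of `E`. (Then `Γ` is automatically a Lipschitz hypersurface of the sphere, as the
boundary of a convex cone with nonempty interior is locally a Lipschitz graph.) -/
structure IsSphericalConvexHypersurface {E : Type*} [NormedAddCommGroup E] [NormedSpace ℝ E]
    (Γ : Set E) : Prop where
  subset_sphere : Γ ⊆ Metric.sphere (0 : E) 1
  isCompact : IsCompact Γ
  convex_cone : IsConvexHypersurface (coneOver Γ)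

/-- The tangent cone `T_p S` of `S` at `p`, with apex at `p`: the points `p + v`, where `v` is a
limit of `c • (x - p)` with `c ≥ 0` and `x ∈ S`, `x → p`. -/
def tangentConeAtPoint {E : Type*} [NormedAddCommGroup E] [NormedSpace ℝ E] (S : Set E) (p : E) :
    Set E :=
  {x | x - p ∈ posTangentConeAt S p}

/-- The tangent cone `T_p Γ = T_p(𝒞Γ) ∩ {x : ⟪x - p, p⟫ = 0}` of a convex hypersurface `Γ` of the
unit sphere at `p ∈ Γ`. -/
def sphericalTangentCone {E : Type*} [NormedAddCommGroup E] [InnerProductSpace ℝ E]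
    (Γ : Set E) (p : E) : Set E :=
  tangentConeAtPoint (coneOver Γ) p ∩ {x | ⟪x - p, p⟫ = 0}

/-- The unit sphere `{x : ⟪x - p, p⟫ = 0, ‖x - p‖ = 1}`, centred at `p`, of the affine hyperplane
tangent to the unit sphere at `p`. -/
def tangentSphere {E : Type*} [NormedAddCommGroup E] [InnerProductSpace ℝ E] (p : E) : Set E :=
  {x | ⟪x - p, p⟫ = 0 ∧ ‖x - p‖ = 1}

/-- The link `Θ = T_p Γ ∩ (tangent unit sphere at p)` of the tangent cone of `Γ` at `p`. -/
def tangentLink {E : Type*} [NormedAddCommGroup E] [InnerProductSpace ℝ E]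
    (Γ : Set E) (p : E) : Set E :=
  sphericalTangentCone Γ p ∩ tangentSphere p

/-- The cone over a subset `Θ` of the tangent unit sphere at `p`. The tangent hyperplane at `p` is
identified with the linear space `pᗮ` by `x ↦ x - p`, which makes this a cone in `pᗮ` with
apex `0`. -/
def tangentLinkCone {E : Type*} [NormedAddCommGroup E] [NormedSpace ℝ E]
    (p : E) (Θ : Set E) : Set E :=
  coneOver ((fun x => x - p) '' Θ)

/-- The product `ℝ × C` of a line and a set `C ⊆ pᗮ`, for a unit vector `p`, realized in
`E = ℝ p ⊕ pᗮ`. -/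
def lineProd {E : Type*} [NormedAddCommGroup E] [NormedSpace ℝ E] (p : E) (C : Set E) : Set E :=
  {x | ∃ t : ℝ, ∃ v ∈ C, x = t • p + v}

/-- `A` and `B` are congruent: an isometry of the ambient space maps `A` onto `B`. -/
def AreCongruent {E : Type*} [NormedAddCommGroup E] (A B : Set E) : Prop :=
  ∃ φ : E ≃ᵢ E, φ '' A = B

/-- The `d`-dimensional area (normalized Hausdorff measure) of `A`, divided by the `d`-dimensional
area of the unit sphere of `ℝ^(d+1)`. -/
noncomputable def areaRatio {E : Type*} [NormedAddCommGroup E] [MeasurableSpace E]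
    [BorelSpace E] (d : ℕ) (A : Set E) : ENNReal :=
  μHE[d] A / μHE[d] (Metric.sphere (0 : EuclideanSpace ℝ (Fin (d + 1))) 1)

set_option linter.unusedSectionVars false

section Gaussian

open scoped ENNReal NNReal

/-- The normalized Gaussian density `exp (-π ‖x‖ ^ 2)`. -/
noncomputable def gaussDensity {V : Type*} [NormedAddCommGroup V] (x : V) : ℝ≥0∞ :=
  ENNReal.ofReal (Real.exp (-Real.pi * ‖x‖ ^ 2))

theorem gaussDensity_pos {V : Type*} [NormedAddCommGroup V] (x : V) : gaussDensity x ≠ 0 := by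
  simp [gaussDensity, Real.exp_pos]

@[fun_prop]
theorem continuous_gaussDensity {V : Type*} [NormedAddCommGroup V] :
    Continuous (gaussDensity : V → ℝ≥0∞) := by
  unfold gaussDensity
  exact ENNReal.continuous_ofReal.comp (by fun_prop)

theorem measurable_gaussDensity {V : Type*} [NormedAddCommGroup V] [MeasurableSpace V]
    [BorelSpace V] : Measurable (gaussDensity : V → ℝ≥0∞) :=
  continuous_gaussDensity.measurable

/-- The Gaussian probability measure with density `exp (-π ‖x‖ ^ 2)`. -/
noncomputable def gauss (V : Type*) [NormedAddCommGroup V] [InnerProductSpace ℝ V]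
    [FiniteDimensional ℝ V] [MeasurableSpace V] [BorelSpace V] : Measure V :=
  volume.withDensity gaussDensity

variable {V : Type*} [NormedAddCommGroup V] [InnerProductSpace ℝ V]
    [FiniteDimensional ℝ V] [MeasurableSpace V] [BorelSpace V]
  {U : Type*} [NormedAddCommGroup U] [InnerProductSpace ℝ U]
    [FiniteDimensional ℝ U] [MeasurableSpace U] [BorelSpace U]

instance gauss_isProbabilityMeasure : IsProbabilityMeasure (gauss V) := by
  constructor
  rw [gauss, withDensity_apply _ MeasurableSet.univ, Measure.restrict_univ]
  have h := GaussianFourier.integral_rexp_neg_mul_sq_norm (V := V) Real.pi_pos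
  have hi : Integrable (fun v : V => Real.exp (-Real.pi * ‖v‖ ^ 2)) := by
    by_contra hcon
    rw [integral_undef hcon, div_self Real.pi_ne_zero, Real.one_rpow] at h
    exact zero_ne_one h
  unfold gaussDensity
  rw [← ofReal_integral_eq_lintegral_ofReal hi (ae_of_all _ fun x => (Real.exp_pos _).le), h,
    div_self Real.pi_ne_zero, Real.one_rpow, ENNReal.ofReal_one]

theorem gauss_absolutelyContinuous : gauss V ≪ volume :=
  withDensity_absolutelyContinuous _ _

theorem volume_absolutelyContinuous_gauss : (volume : Measure V) ≪ gauss V :=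
  withDensity_absolutelyContinuous' measurable_gaussDensity.aemeasurable
    (ae_of_all _ gaussDensity_pos)

instance gauss_isOpenPosMeasure : (gauss V).IsOpenPosMeasure :=
  volume_absolutelyContinuous_gauss.isOpenPosMeasure

theorem lintegral_gauss (f : V → ℝ≥0∞) (hf : Measurable f) :
    ∫⁻ x, f x ∂gauss V = ∫⁻ x, gaussDensity x * f x := by
  rw [gauss, lintegral_withDensity_eq_lintegral_mul _ measurable_gaussDensity hf]
  rfl

theorem measurePreserving_of_norm_sq_add {F : Type*} [NormedAddCommGroup F]
    [InnerProductSpace ℝ F] [FiniteDimensional ℝ F] [MeasurableSpace F] [BorelSpace F]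
    (L : (U × F) ≃ₗ[ℝ] V) (hL : ∀ u t, ‖L (u, t)‖ ^ 2 = ‖u‖ ^ 2 + ‖t‖ ^ 2) :
    MeasurePreserving L := by
  let e : WithLp 2 (U × F) ≃ₗᵢ[ℝ] V :=
    { toLinearEquiv := (WithLp.linearEquiv 2 ℝ (U × F)).trans L
      norm_map' := fun x => by
        have h1 : ‖x‖ ^ 2 = ‖x.fst‖ ^ 2 + ‖x.snd‖ ^ 2 := WithLp.prod_norm_sq_eq_of_L2 x
        have h2 := hL x.fst x.snd
        rw [← h1] at h2
        exact (sq_eq_sq₀ (norm_nonneg _) (norm_nonneg _)).1 h2 }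
  exact (e.measurePreserving).comp
    (WithLp.volume_preserving_symm_measurableEquiv_toLp_prod U F).symm

theorem LinearIsometryEquiv.measurePreserving_gauss (e : U ≃ₗᵢ[ℝ] V) :
    MeasurePreserving e (gauss U) (gauss V) := by
  refine ⟨e.continuous.measurable, ?_⟩
  ext s hs
  rw [Measure.map_apply e.continuous.measurable hs, gauss, gauss,
    withDensity_apply _ (e.continuous.measurable hs), withDensity_apply _ hs,
    ← e.measurePreserving.setLIntegral_comp_preimage hs measurable_gaussDensity]
  simp [gaussDensity]

theorem measurePreserving_gauss_of_norm_sq_add {F : Type*} [NormedAddCommGroup F]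
    [InnerProductSpace ℝ F] [FiniteDimensional ℝ F] [MeasurableSpace F] [BorelSpace F]
    (L : (U × F) ≃ₗ[ℝ] V) (hL : ∀ u t, ‖L (u, t)‖ ^ 2 = ‖u‖ ^ 2 + ‖t‖ ^ 2) :
    MeasurePreserving L ((gauss U).prod (gauss F)) (gauss V) := by
  have hm := measurePreserving_of_norm_sq_add L hL
  refine ⟨hm.measurable, ?_⟩
  ext s hs
  rw [Measure.map_apply hm.measurable hs, gauss, gauss, gauss, prod_withDensity
    measurable_gaussDensity measurable_gaussDensity,
    withDensity_apply _ (hm.measurable hs), withDensity_apply _ hs,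
    ← hm.setLIntegral_comp_preimage hs measurable_gaussDensity]
  congr 1
  ext x
  rw [gaussDensity, gaussDensity, gaussDensity, ← ENNReal.ofReal_mul (Real.exp_pos _).le,
    ← Real.exp_add, hL x.1 x.2]
  ring_nf

theorem measurePreserving_fst_symm_gauss {F : Type*} [NormedAddCommGroup F]
    [InnerProductSpace ℝ F] [FiniteDimensional ℝ F] [MeasurableSpace F] [BorelSpace F]
    (L : (U × F) ≃ₗ[ℝ] V) (hL : ∀ u t, ‖L (u, t)‖ ^ 2 = ‖u‖ ^ 2 + ‖t‖ ^ 2) :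
    MeasurePreserving (fun x => (L.symm x).1) (gauss V) (gauss U) := by
  have h := measurePreserving_gauss_of_norm_sq_add L hL
  let Lc := L.toContinuousLinearEquiv.toHomeomorph.toMeasurableEquiv
  have h' : MeasurePreserving Lc.symm (gauss V) ((gauss U).prod (gauss F)) :=
    MeasurePreserving.symm Lc h
  exact measurePreserving_fst.comp h'

end Gaussian

section AreaFormula

open scoped ENNReal NNReal Topology Pointwise MeasureTheory
open Set Filter Metric Module

theorem ApproximatesLinearOn.ae_norm_fderiv_sub_le {E F : Type*} [NormedAddCommGroup E]
    [NormedSpace ℝ E] [FiniteDimensional ℝ E] [MeasurableSpace E] [BorelSpace E]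
    (μ : Measure E) [μ.IsAddHaarMeasure] [NormedAddCommGroup F] [NormedSpace ℝ F]
    {f : E → F} {s : Set E} {A : E →L[ℝ] F} {δ : ℝ≥0}
    (hf : ApproximatesLinearOn f A s δ) (hs : MeasurableSet s) (f' : E → E →L[ℝ] F)
    (hf' : ∀ x ∈ s, HasFDerivWithinAt f (f' x) s x) : ∀ᵐ x ∂μ.restrict s, ‖f' x - A‖₊ ≤ δ := by
  filter_upwards [Besicovitch.ae_tendsto_measure_inter_div μ s, ae_restrict_mem hs]
  intro x hx xs
  apply ContinuousLinearMap.opNorm_le_bound _ δ.2 fun z => ?_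
  suffices H : ∀ ε, 0 < ε → ‖(f' x - A) z‖ ≤ (δ + ε) * (‖z‖ + ε) + ‖f' x - A‖ * ε by
    have :
      Tendsto (fun ε : ℝ => ((δ : ℝ) + ε) * (‖z‖ + ε) + ‖f' x - A‖ * ε) (𝓝[>] 0)
        (𝓝 ((δ + 0) * (‖z‖ + 0) + ‖f' x - A‖ * 0)) :=
      Tendsto.mono_left (Continuous.tendsto (by fun_prop) 0) nhdsWithin_le_nhds
    simp only [add_zero, mul_zero] at this
    apply le_of_tendsto_of_tendsto tendsto_const_nhds this
    filter_upwards [self_mem_nhdsWithin]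
    exact H
  intro ε εpos
  have B₁ : ∀ᶠ r in 𝓝[>] (0 : ℝ), (s ∩ ({x} + r • closedBall z ε)).Nonempty :=
    Measure.eventually_nonempty_inter_smul_of_density_one μ s x hx _ measurableSet_closedBall
      (measure_closedBall_pos μ z εpos).ne'
  obtain ⟨ρ, ρpos, hρ⟩ :
    ∃ ρ > 0, ball x ρ ∩ s ⊆ {y : E | ‖f y - f x - (f' x) (y - x)‖ ≤ ε * ‖y - x‖} :=
    mem_nhdsWithin_iff.1 ((hf' x xs).isLittleO.def εpos)
  have B₂ : ∀ᶠ r in 𝓝[>] (0 : ℝ), {x} + r • closedBall z ε ⊆ ball x ρ := by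
    apply nhdsWithin_le_nhds
    exact eventually_singleton_add_smul_subset isBounded_closedBall (ball_mem_nhds x ρpos)
  obtain ⟨r, ⟨y, ⟨ys, hy⟩⟩, rρ, rpos⟩ :
    ∃ r : ℝ,
      (s ∩ ({x} + r • closedBall z ε)).Nonempty ∧ {x} + r • closedBall z ε ⊆ ball x ρ ∧ 0 < r :=
    (B₁.and (B₂.and self_mem_nhdsWithin)).exists
  obtain ⟨a, az, ya⟩ : ∃ a, a ∈ closedBall z ε ∧ y = x + r • a := by
    simp only [mem_smul_set, image_add_left, mem_preimage, singleton_add] at hy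
    rcases hy with ⟨a, az, ha⟩
    exact ⟨a, az, by simp only [ha, add_neg_cancel_left]⟩
  have norm_a : ‖a‖ ≤ ‖z‖ + ε :=
    calc
      ‖a‖ = ‖z + (a - z)‖ := by simp only [add_sub_cancel]
      _ ≤ ‖z‖ + ‖a - z‖ := norm_add_le _ _
      _ ≤ ‖z‖ + ε := by grw [mem_closedBall_iff_norm.1 az]
  have I : r * ‖(f' x - A) a‖ ≤ r * (δ + ε) * (‖z‖ + ε) :=
    calc
      r * ‖(f' x - A) a‖ = ‖(f' x - A) (r • a)‖ := by
        simp only [map_smul, norm_smul, Real.norm_eq_abs, abs_of_nonneg rpos.le]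
      _ = ‖f y - f x - A (y - x) - (f y - f x - (f' x) (y - x))‖ := by
        simp only [ya, add_sub_cancel_left, sub_sub_sub_cancel_left, FunLike.coe_sub,
          Pi.sub_apply, map_smul, smul_sub]
      _ ≤ ‖f y - f x - A (y - x)‖ + ‖f y - f x - (f' x) (y - x)‖ := norm_sub_le _ _
      _ ≤ δ * ‖y - x‖ + ε * ‖y - x‖ := (add_le_add (hf _ ys _ xs) (hρ ⟨rρ hy, ys⟩))
      _ = r * (δ + ε) * ‖a‖ := by
        simp only [ya, add_sub_cancel_left, norm_smul, Real.norm_eq_abs, abs_of_nonneg rpos.le]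
        ring
      _ ≤ r * (δ + ε) * (‖z‖ + ε) := by gcongr
  calc
    ‖(f' x - A) z‖ = ‖(f' x - A) a + (f' x - A) (z - a)‖ := by
      congr 1
      simp only [FunLike.coe_sub, map_sub, Pi.sub_apply]
      abel
    _ ≤ ‖(f' x - A) a‖ + ‖(f' x - A) (z - a)‖ := norm_add_le _ _
    _ ≤ (δ + ε) * (‖z‖ + ε) + ‖f' x - A‖ * ‖z - a‖ := by
      apply add_le_add
      · rw [mul_assoc] at I; exact (mul_le_mul_iff_right₀ rpos).1 I
      · apply ContinuousLinearMap.le_opNorm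
    _ ≤ (δ + ε) * (‖z‖ + ε) + ‖f' x - A‖ * ε := by
      rw [mem_closedBall_iff_norm'] at az
      gcongr

theorem hausdorffMeasure_image_le_of_edist_le {X Y Z : Type*} [EMetricSpace Y] [MeasurableSpace Y]
    [BorelSpace Y] [EMetricSpace Z] [MeasurableSpace Z] [BorelSpace Z] [Nonempty X]
    {f : X → Y} {g : X → Z} {t : Set X} {c : ℝ≥0} (d : ℕ)
    (h : ∀ x ∈ t, ∀ y ∈ t, edist (f x) (f y) ≤ c * edist (g x) (g y)) :
    μHE[d] (f '' t) ≤ (c : ℝ≥0∞) ^ d * μHE[d] (g '' t) := by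
  have hinv : ∀ y ∈ g '' t, Function.invFunOn g t y ∈ t ∧ g (Function.invFunOn g t y) = y :=
    fun y hy => Function.invFunOn_pos hy
  have hL : LipschitzOnWith c (fun y => f (Function.invFunOn g t y)) (g '' t) := by
    intro y hy z hz
    have := h _ (hinv y hy).1 _ (hinv z hz).1
    rwa [(hinv y hy).2, (hinv z hz).2] at this
  have himg : f '' t = (fun y => f (Function.invFunOn g t y)) '' (g '' t) := by
    rw [image_image]
    refine image_congr fun x hx => ?_
    have hy := hinv (g x) (mem_image_of_mem g hx)
    have := h x hx _ hy.1
    rw [hy.2, edist_self, mul_zero, nonpos_iff_eq_zero, edist_eq_zero] at this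
    exact this
  rw [himg]
  have := hL.hausdorffMeasure_image_le (d := d) (Nat.cast_nonneg d)
  simp only [Measure.euclideanHausdorffMeasure_def, Measure.smul_apply]
  rw [ENNReal.rpow_natCast] at this
  calc _ ≤ _ := smul_le_smul_of_nonneg_left this bot_le
    _ = _ := by
      simp only [ENNReal.smul_def, smul_eq_mul]
      ring

variable {U V : Type*} [NormedAddCommGroup U] [InnerProductSpace ℝ U] [FiniteDimensional ℝ U]
  [NormedAddCommGroup V] [InnerProductSpace ℝ V] [FiniteDimensional ℝ V]

theorem continuous_normDet : Continuous fun A : U →L[ℝ] V => (A : U →ₗ[ℝ] V).normDet := by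
  have h : (fun A : U →L[ℝ] V => (A : U →ₗ[ℝ] V).normDet) =
      fun A => √ ((A.adjoint ∘L A).det) := by
    ext A
    have := A.normDet_sq
    rw [← this]
    exact (Real.sqrt_sq (LinearMap.normDet_nonneg _)).symm
  rw [h]
  refine Real.continuous_sqrt.comp (ContinuousLinearMap.continuous_det.comp ?_)
  exact ContinuousLinearMap.adjoint.continuous.clm_comp continuous_id

variable [MeasurableSpace U] [BorelSpace U] [MeasurableSpace V] [BorelSpace V]

theorem exists_approximation_radius (A : U →L[ℝ] V) (hA : Function.Injective A) {c : ℝ≥0}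
    (hc : 1 < c) : ∃ r : ℝ≥0, r ≠ 0 ∧
      (∀ (f : U → V) (t : Set U), ApproximatesLinearOn f A t r →
        μHE[finrank ℝ U] (f '' t) ≤ (c : ℝ≥0∞) ^ finrank ℝ U * μHE[finrank ℝ U] (A '' t) ∧
        μHE[finrank ℝ U] (A '' t) ≤ (c : ℝ≥0∞) ^ finrank ℝ U * μHE[finrank ℝ U] (f '' t)) ∧
      ∀ B : U →L[ℝ] V, ‖B - A‖₊ ≤ r →
        ENNReal.ofReal (B : U →ₗ[ℝ] V).normDet ≤ c * ENNReal.ofReal (A : U →ₗ[ℝ] V).normDet ∧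
        ENNReal.ofReal (A : U →ₗ[ℝ] V).normDet ≤ c * ENNReal.ofReal (B : U →ₗ[ℝ] V).normDet := by
  obtain ⟨K, hK0, hK⟩ := (A : U →ₗ[ℝ] V).exists_antilipschitzWith
    (LinearMap.ker_eq_bot.2 hA)
  have hc' : (1 : ℝ) < c := by exact_mod_cast hc
  set J := (A : U →ₗ[ℝ] V).normDet with hJ
  have hJ0 : 0 < J := (LinearMap.normDet_nonneg _).lt_of_ne fun h =>
    LinearMap.normDet_eq_zero_iff_ker_ne_bot.1 h.symm (LinearMap.ker_eq_bot.2 hA)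
  have hev : ∀ᶠ B : U →L[ℝ] V in 𝓝 A, (B : U →ₗ[ℝ] V).normDet < c * J ∧
      J < c * (B : U →ₗ[ℝ] V).normDet := by
    refine (continuous_normDet.continuousAt.eventually_lt continuousAt_const ?_).and
      (continuousAt_const.eventually_lt (continuousAt_const.mul
        continuous_normDet.continuousAt) ?_)
    · change J < c * J
      nlinarith
    · change J < c * J
      nlinarith
  obtain ⟨ρ, hρ, hB⟩ := Metric.eventually_nhds_iff.1 hev
  set δ : ℝ := (c - 1) / c with hδ
  have hδ0 : 0 < δ := div_pos (by linarith) (by linarith)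
  have hδc : c * (1 - δ) = 1 := by rw [hδ]; field_simp; ring
  have hδ1 : 1 + δ ≤ c := by
    have : δ * c = c - 1 := by rw [hδ]; field_simp
    nlinarith
  have hK0' : (0 : ℝ) < K := by exact_mod_cast hK0
  have hr0 : 0 < min (ρ / 2) (δ / K) := lt_min (by linarith) (by positivity)
  refine ⟨⟨min (ρ / 2) (δ / K), hr0.le⟩, fun h => hr0.ne' (congrArg NNReal.toReal h), ?_, ?_⟩
  · intro f t hf
    have key : ∀ x ∈ t, ∀ y ∈ t, ‖f x - f y - A (x - y)‖ ≤ δ * ‖A x - A y‖ := by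
      intro x hx y hy
      have h1 := hf x hx y hy
      have h2 : ‖x - y‖ ≤ K * ‖A x - A y‖ := by
        have := hK.le_mul_dist x y
        rwa [dist_eq_norm, dist_eq_norm] at this
      calc _ ≤ _ := h1
        _ ≤ (δ / K) * (K * ‖A x - A y‖) := by
          refine mul_le_mul (min_le_right _ _) h2 (norm_nonneg _) (by positivity)
        _ = _ := by field_simp
    have conv : ∀ {a b : V} {a' b' : V}, ‖a - b‖ ≤ c * ‖a' - b'‖ →
        edist a b ≤ c * edist a' b' := by
      intro a b a' b' h
      rw [edist_nndist, edist_nndist, ← ENNReal.coe_mul, ENNReal.coe_le_coe]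
      rw [← NNReal.coe_le_coe]
      simpa [dist_eq_norm] using h
    constructor
    · refine hausdorffMeasure_image_le_of_edist_le _ fun x hx y hy => conv ?_
      have := key x hx y hy
      rw [map_sub] at this
      have h3 := norm_sub_norm_le (f x - f y) (A x - A y)
      nlinarith [norm_nonneg (A x - A y)]
    · refine hausdorffMeasure_image_le_of_edist_le _ fun x hx y hy => conv ?_
      have := key x hx y hy
      rw [map_sub, norm_sub_rev] at this
      have h3 := norm_sub_norm_le (A x - A y) (f x - f y)
      have h4 : (1 - δ) * ‖A x - A y‖ ≤ ‖f x - f y‖ := by linarith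
      calc ‖A x - A y‖ = c * ((1 - δ) * ‖A x - A y‖) := by rw [← mul_assoc, hδc, one_mul]
        _ ≤ _ := by gcongr
  · intro B hBA
    have h := @hB B (by
      rw [dist_eq_norm]
      have : ‖B - A‖ ≤ min (ρ / 2) (δ / K) := hBA
      have := this.trans (min_le_left _ _)
      linarith)
    rw [← ENNReal.ofReal_coe_nnreal, ← ENNReal.ofReal_mul (by positivity),
      ← ENNReal.ofReal_mul (by positivity)]
    exact ⟨ENNReal.ofReal_le_ofReal h.1.le, ENNReal.ofReal_le_ofReal h.2.le⟩

theorem ENNReal.le_of_forall_le_pow_mul {a b : ℝ≥0∞} (m : ℕ)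
    (h : ∀ c : ℝ≥0, 1 < c → a ≤ (c : ℝ≥0∞) ^ m * b) : a ≤ b := by
  have ht : Tendsto (fun c : ℝ≥0 => (c : ℝ≥0∞) ^ m * b) (𝓝[>] 1) (𝓝 b) := by
    have h1 : Tendsto (fun c : ℝ≥0 => (c : ℝ≥0∞) ^ m) (𝓝[>] 1) (𝓝 1) := by
      have : Continuous fun c : ℝ≥0 => ((c ^ m : ℝ≥0) : ℝ≥0∞) :=
        ENNReal.continuous_coe.comp (continuous_pow m)
      have h2 := (this.tendsto 1).mono_left (nhdsWithin_le_nhds (s := Ioi 1))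
      simpa using h2
    simpa using ENNReal.Tendsto.mul_const h1 (Or.inl one_ne_zero)
  exact ge_of_tendsto ht (eventually_nhdsWithin_of_forall fun c hc => h c hc)

/-- The area formula for injective differentiable maps with injective differential. -/
theorem setLIntegral_normDet_fderiv {f : U → V} {s : Set U} (hs : MeasurableSet s)
    {f' : U → U →L[ℝ] V} (hf' : ∀ x ∈ s, HasFDerivWithinAt f (f' x) s x) (hinj : InjOn f s)
    (hf'inj : ∀ x ∈ s, Function.Injective (f' x)) :
    ∫⁻ x in s, ENNReal.ofReal (f' x : U →ₗ[ℝ] V).normDet = μHE[finrank ℝ U] (f '' s) := by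
  classical
  rcases s.eq_empty_or_nonempty with rfl | hne
  · simp
  set d := finrank ℝ U with hd
  have main : ∀ c : ℝ≥0, 1 < c →
      ∫⁻ x in s, ENNReal.ofReal (f' x : U →ₗ[ℝ] V).normDet
        ≤ (c : ℝ≥0∞) ^ (d + 1) * μHE[d] (f '' s) ∧
      μHE[d] (f '' s) ≤
        (c : ℝ≥0∞) ^ (d + 1) * ∫⁻ x in s, ENNReal.ofReal (f' x : U →ₗ[ℝ] V).normDet := by
    intro c hc
    have hr : ∀ A : U →L[ℝ] V, ∃ r : ℝ≥0, r ≠ 0 ∧ (Function.Injective A →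
      (∀ (f : U → V) (t : Set U), ApproximatesLinearOn f A t r →
        μHE[d] (f '' t) ≤ (c : ℝ≥0∞) ^ d * μHE[d] (A '' t) ∧
        μHE[d] (A '' t) ≤ (c : ℝ≥0∞) ^ d * μHE[d] (f '' t)) ∧
      ∀ B : U →L[ℝ] V, ‖B - A‖₊ ≤ r →
        ENNReal.ofReal (B : U →ₗ[ℝ] V).normDet ≤ c * ENNReal.ofReal (A : U →ₗ[ℝ] V).normDet ∧
        ENNReal.ofReal (A : U →ₗ[ℝ] V).normDet ≤
          c * ENNReal.ofReal (B : U →ₗ[ℝ] V).normDet) := by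
      intro A
      by_cases hA : Function.Injective A
      · obtain ⟨r, h0, h1, h2⟩ := exists_approximation_radius A hA hc
        exact ⟨r, h0, fun _ => ⟨h1, h2⟩⟩
      · exact ⟨1, one_ne_zero, fun h => absurd h hA⟩
    choose r hr0 hr1 using hr
    obtain ⟨t, A, htd, htm, hst, happ, hA⟩ :=
      exists_partition_approximatesLinearOn_of_hasFDerivWithinAt f s f' hf' r hr0
    have hAinj : ∀ n, Function.Injective (A n) := fun n => by
      obtain ⟨y, hy, hAy⟩ := hA hne n
      rw [hAy]
      exact hf'inj y hy
    have hsu : s = ⋃ n, s ∩ t n := by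
      rw [← inter_iUnion]
      exact (inter_eq_left.2 hst).symm
    have hmeas : ∀ n, MeasurableSet (s ∩ t n) := fun n => hs.inter (htm n)
    have hdisj : Pairwise (Function.onFun Disjoint fun n => s ∩ t n) := fun i j hij =>
      (htd hij).mono inter_subset_right inter_subset_right
    have hint : ∫⁻ x in s, ENNReal.ofReal (f' x : U →ₗ[ℝ] V).normDet =
        ∑' n, ∫⁻ x in s ∩ t n, ENNReal.ofReal (f' x : U →ₗ[ℝ] V).normDet := by
      conv_lhs => rw [hsu]
      exact lintegral_iUnion hmeas hdisj _
    have himg : μHE[d] (f '' s) = ∑' n, μHE[d] (f '' (s ∩ t n)) := by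
      conv_lhs => rw [hsu, image_iUnion]
      refine measure_iUnion ?_ fun n => ?_
      · intro i j hij
        exact Set.disjoint_image_image fun x hx y hy hxy => (hdisj hij).ne_of_mem hx hy
          (hinj hx.1 hy.1 hxy)
      · exact (hmeas n).image_of_continuousOn_injOn
          (fun x hx => ((hf' x hx.1).continuousWithinAt).mono inter_subset_left)
          (hinj.mono inter_subset_left)
    have hpiece : ∀ n, ∫⁻ x in s ∩ t n, ENNReal.ofReal (f' x : U →ₗ[ℝ] V).normDet
        ≤ (c : ℝ≥0∞) ^ (d + 1) * μHE[d] (f '' (s ∩ t n)) ∧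
      μHE[d] (f '' (s ∩ t n)) ≤ (c : ℝ≥0∞) ^ (d + 1) *
        ∫⁻ x in s ∩ t n, ENNReal.ofReal (f' x : U →ₗ[ℝ] V).normDet := by
      intro n
      have hae := (happ n).ae_norm_fderiv_sub_le volume (hmeas n) f'
        (fun x hx => (hf' x hx.1).mono inter_subset_left)
      obtain ⟨hr2, hr3⟩ := hr1 (A n) (hAinj n)
      obtain ⟨h1, h2⟩ := hr2 f _ (happ n)
      have hlin : μHE[d] (A n '' (s ∩ t n)) =
          ∫⁻ x in s ∩ t n, ENNReal.ofReal (A n : U →ₗ[ℝ] V).normDet := by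
        rw [setLIntegral_const]
        exact LinearMap.euclideanHausdorffMeasure_image_eq_normDet_mul_volume (A n : U →ₗ[ℝ] V) _
      constructor
      · calc ∫⁻ x in s ∩ t n, ENNReal.ofReal (f' x : U →ₗ[ℝ] V).normDet
            ≤ ∫⁻ x in s ∩ t n, c * ENNReal.ofReal (A n : U →ₗ[ℝ] V).normDet :=
              lintegral_mono_ae (hae.mono fun x hx => (hr3 _ hx).1)
          _ = c * μHE[d] (A n '' (s ∩ t n)) := by
              rw [hlin, lintegral_const_mul' _ _ ENNReal.coe_ne_top]
          _ ≤ c * (c ^ d * μHE[d] (f '' (s ∩ t n))) := by gcongr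
          _ = _ := by ring
      · calc μHE[d] (f '' (s ∩ t n)) ≤ c ^ d * μHE[d] (A n '' (s ∩ t n)) := h1
          _ ≤ c ^ d * ∫⁻ x in s ∩ t n, c * ENNReal.ofReal (f' x : U →ₗ[ℝ] V).normDet := by
              rw [hlin]
              gcongr 1
              exact lintegral_mono_ae (hae.mono fun x hx => (hr3 _ hx).2)
          _ = _ := by
              rw [lintegral_const_mul' _ _ ENNReal.coe_ne_top]
              ring
    rw [hint, himg, ← ENNReal.tsum_mul_left, ← ENNReal.tsum_mul_left]
    exact ⟨ENNReal.tsum_le_tsum fun n => (hpiece n).1, ENNReal.tsum_le_tsum fun n => (hpiece n).2⟩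
  exact le_antisymm (ENNReal.le_of_forall_le_pow_mul _ fun c hc => (main c hc).1)
    (ENNReal.le_of_forall_le_pow_mul _ fun c hc => (main c hc).2)

end AreaFormula

section Frames

open scoped ENNReal NNReal
open Set Module

theorem LinearMap.det_eq_mul_of_upperTriangular {R M N : Type*} [CommRing R] [AddCommGroup M]
    [Module R M] [AddCommGroup N] [Module R N] [Module.Free R M] [Module.Finite R M]
    [Module.Free R N] [Module.Finite R N] (f : (M × N) →ₗ[R] (M × N)) (A : M →ₗ[R] M)
    (D : N →ₗ[R] N) (hA : ∀ x, f (x, 0) = (A x, 0)) (hD : ∀ y, (f (0, y)).2 = D y) :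
    f.det = A.det * D.det := by
  classical
  let b := Module.Free.chooseBasis R M
  let b' := Module.Free.chooseBasis R N
  rw [← LinearMap.det_toMatrix (b.prod b') f, ← LinearMap.det_toMatrix b A,
    ← LinearMap.det_toMatrix b' D]
  have : LinearMap.toMatrix (b.prod b') (b.prod b') f =
      Matrix.fromBlocks (LinearMap.toMatrix b b A)
        (Matrix.of fun i j => b.repr (f (0, b' j)).1 i) 0 (LinearMap.toMatrix b' b' D) := by
    ext (i | i) (j | j)
    · simp [LinearMap.toMatrix_apply, hA]
    · simp [LinearMap.toMatrix_apply]
    · simp [LinearMap.toMatrix_apply, hA]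
    · simp [LinearMap.toMatrix_apply, hD]
  rw [this, Matrix.det_fromBlocks_zero₂₁]

variable {W E : Type*} [NormedAddCommGroup W] [InnerProductSpace ℝ W] [FiniteDimensional ℝ W]
  [NormedAddCommGroup E] [InnerProductSpace ℝ E] [FiniteDimensional ℝ E]

/-- `L` is isometric when `W × ℝ × ℝ` carries the Euclidean norm. -/
def IsFrame (L : (W × ℝ × ℝ) ≃ₗ[ℝ] E) : Prop :=
  ∀ w s r, ‖L (w, s, r)‖ ^ 2 = ‖w‖ ^ 2 + s ^ 2 + r ^ 2

theorem IsFrame.inner {L : (W × ℝ × ℝ) ≃ₗ[ℝ] E} (hL : IsFrame L) (w w' : W) (s s' r r' : ℝ) :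
    ⟪L (w, s, r), L (w', s', r')⟫ = ⟪w, w'⟫ + s * s' + r * r' := by
  rw [real_inner_eq_norm_add_mul_self_sub_norm_mul_self_sub_norm_mul_self_div_two,
    real_inner_eq_norm_add_mul_self_sub_norm_mul_self_sub_norm_mul_self_div_two w w',
    ← map_add, Prod.mk_add_mk, Prod.mk_add_mk]
  simp only [← pow_two, hL _ _ _]
  ring

theorem exists_isFrame (hd : finrank ℝ E = finrank ℝ W + 2) {z ν : E} (hz : ‖z‖ = 1)
    (hν : ‖ν‖ = 1) (hzν : ⟪z, ν⟫ = 0) :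
    ∃ L : (W × ℝ × ℝ) ≃ₗ[ℝ] E, IsFrame L ∧ L (0, 1, 0) = z ∧ L (0, 0, 1) = ν := by
  have hlin : LinearIndependent ℝ ![z, ν] := by
    have : Orthonormal ℝ ![z, ν] := by
      refine ⟨?_, ?_⟩
      · intro i; fin_cases i <;> simp [hz, hν]
      · intro i j hij
        fin_cases i <;> fin_cases j <;> simp_all [real_inner_comm]
    exact this.linearIndependent
  set S : Submodule ℝ E := Submodule.span ℝ {z, ν} with hS
  have hS2 : finrank ℝ S = 2 := by
    have := finrank_span_eq_card hlin
    rw [Matrix.range_cons, Matrix.range_cons, Matrix.range_empty, union_empty,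
      singleton_union] at this
    simpa using this
  have hSo : finrank ℝ W = finrank ℝ Sᗮ := by
    have := S.finrank_add_finrank_orthogonal
    omega
  let ι : W ≃ₗᵢ[ℝ] Sᗮ := (stdOrthonormalBasis ℝ W).equiv (stdOrthonormalBasis ℝ Sᗮ) (finCongr hSo)
  let L₀ : (W × ℝ × ℝ) →ₗ[ℝ] E :=
    (Sᗮ.subtype ∘ₗ ι.toLinearEquiv.toLinearMap).coprod
      ((LinearMap.toSpanSingleton ℝ E z).coprod (LinearMap.toSpanSingleton ℝ E ν))
  have hL₀ : ∀ w s r, L₀ (w, s, r) = (ι w : E) + (s • z + r • ν) := fun w s r => by simp [L₀]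
  have hort : ∀ w : W, ⟪(ι w : E), z⟫ = 0 ∧ ⟪(ι w : E), ν⟫ = 0 := fun w => by
    have h := (ι w).2
    rw [Submodule.mem_orthogonal'] at h
    exact ⟨h z (Submodule.subset_span (by simp)), h ν (Submodule.subset_span (by simp))⟩
  have hnorm : ∀ w s r, ‖L₀ (w, s, r)‖ ^ 2 = ‖w‖ ^ 2 + s ^ 2 + r ^ 2 := by
    intro w s r
    rw [hL₀, norm_add_sq_real, norm_add_sq_real, inner_add_right, inner_smul_right,
      inner_smul_right, (hort w).1, (hort w).2, inner_smul_left, inner_smul_right, hzν,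
      norm_smul, norm_smul, hz, hν]
    have : ‖(ι w : E)‖ = ‖w‖ := ι.norm_map w
    rw [this]
    simp only [Real.norm_eq_abs, mul_one, sq_abs, mul_zero]
    ring
  have hinj : Function.Injective L₀ := by
    rw [injective_iff_map_eq_zero]
    rintro ⟨w, s, r⟩ h
    have := hnorm w s r
    rw [h] at this
    have h1 : ‖w‖ ^ 2 = 0 := by nlinarith [sq_nonneg ‖w‖, sq_nonneg s, sq_nonneg r, norm_zero (E := E)]
    have h2 : s ^ 2 = 0 := by nlinarith [sq_nonneg ‖w‖, sq_nonneg s, sq_nonneg r, norm_zero (E := E)]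
    have h3 : r ^ 2 = 0 := by nlinarith [sq_nonneg ‖w‖, sq_nonneg s, sq_nonneg r, norm_zero (E := E)]
    simp at h1 h2 h3
    simp [h1, h2, h3]
  have hfr : finrank ℝ (W × ℝ × ℝ) = finrank ℝ E := by simp [hd]
  refine ⟨LinearEquiv.ofInjectiveOfFinrankEq L₀ hinj hfr, fun w s r => hnorm w s r, ?_, ?_⟩
  · change L₀ _ = _
    simp [hL₀]
  · change L₀ _ = _
    simp [hL₀]

/-- The isometry taking one frame to another. -/
noncomputable def IsFrame.rotation {L L' : (W × ℝ × ℝ) ≃ₗ[ℝ] E} (hL : IsFrame L)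
    (hL' : IsFrame L') : E ≃ₗᵢ[ℝ] E where
  toLinearEquiv := L.symm.trans L'
  norm_map' x := by
    obtain ⟨⟨w, s, r⟩, rfl⟩ := L.surjective x
    have h : ‖L' (w, s, r)‖ ^ 2 = ‖L (w, s, r)‖ ^ 2 := by rw [hL, hL']
    simpa using (sq_eq_sq₀ (norm_nonneg _) (norm_nonneg _)).1 h

theorem IsFrame.rotation_apply {L L' : (W × ℝ × ℝ) ≃ₗ[ℝ] E} (hL : IsFrame L)
    (hL' : IsFrame L') (x : W × ℝ × ℝ) : hL.rotation hL' (L x) = L' x := by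
  change L' (L.symm (L x)) = L' x
  simp

theorem IsFrame.measurePreserving [MeasurableSpace W] [BorelSpace W] [MeasurableSpace E]
    [BorelSpace E] {L : (W × ℝ × ℝ) ≃ₗ[ℝ] E} (hL : IsFrame L) : MeasurePreserving L := by
  let e : (W × WithLp 2 (ℝ × ℝ)) ≃ₗ[ℝ] E :=
    ((LinearEquiv.refl ℝ W).prodCongr (WithLp.linearEquiv 2 ℝ (ℝ × ℝ))).trans L
  have he : MeasurePreserving e := by
    refine measurePreserving_of_norm_sq_add e fun u t => ?_
    have h1 : ‖t‖ ^ 2 = ‖t.fst‖ ^ 2 + ‖t.snd‖ ^ 2 := WithLp.prod_norm_sq_eq_of_L2 t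
    rw [h1]
    have := hL u t.fst t.snd
    rw [Real.norm_eq_abs, Real.norm_eq_abs, sq_abs, sq_abs, ← add_assoc]
    exact this
  have hp : MeasurePreserving (Prod.map (id : W → W) (MeasurableEquiv.toLp 2 (ℝ × ℝ)))
      (volume.prod volume) (volume.prod volume) :=
    (MeasurePreserving.id _).prod
      (WithLp.volume_preserving_symm_measurableEquiv_toLp_prod ℝ ℝ).symm
  exact he.comp hp

/-- The differential at `(w, s, r)` of `(w, s, r) ↦ s • Φ w + r • Y`, where `Φ w = z` and
`A` is the differential of `Φ` at `w`. -/
noncomputable def coneDeriv (A : W →L[ℝ] E) (z Y : E) (s : ℝ) : (W × ℝ × ℝ) →L[ℝ] E :=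
  (s • A).coprod ((ContinuousLinearMap.toSpanSingleton ℝ z).coprod
    (ContinuousLinearMap.toSpanSingleton ℝ Y))

theorem coneDeriv_apply (A : W →L[ℝ] E) (z Y : E) (s : ℝ) (x : W × ℝ × ℝ) :
    coneDeriv A z Y s x = s • A x.1 + (x.2.1 • z + x.2.2 • Y) := by
  simp [coneDeriv]

/-- The Jacobian of `(w, s, r) ↦ s • Φ w + r • Y`, read through a frame. -/
noncomputable def coneJacobian (L : (W × ℝ × ℝ) ≃ₗ[ℝ] E) (A : W →L[ℝ] E) (z Y : E) (s : ℝ) : ℝ :=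
  |LinearMap.det ((coneDeriv A z Y s : (W × ℝ × ℝ) →ₗ[ℝ] E) ∘ₗ (L.symm : E →ₗ[ℝ] (W × ℝ × ℝ)))|

theorem coneJacobian_eq_zero (L : (W × ℝ × ℝ) ≃ₗ[ℝ] E) (A : W →L[ℝ] E) (z Y : E) (s : ℝ)
    {ν : E} (hν : ν ≠ 0) (hA : ∀ w, ⟪A w, ν⟫ = 0) (hz : ⟪z, ν⟫ = 0) (hY : ⟪Y, ν⟫ = 0) :
    coneJacobian L A z Y s = 0 := by
  rw [coneJacobian, abs_eq_zero]
  by_contra h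
  have hs := (LinearMap.equivOfDetNeZero _ h).surjective
  obtain ⟨x, hx⟩ := hs ν
  have : ⟪ν, ν⟫ = 0 := by
    nth_rw 1 [← hx]
    simp [coneDeriv_apply, inner_add_left, inner_smul_left, hA, hz, hY]
  exact hν (inner_self_eq_zero.1 this)

theorem IsFrame.coneJacobian_eq {L L' : (W × ℝ × ℝ) ≃ₗ[ℝ] E} (hL : IsFrame L) (hL' : IsFrame L')
    (A : W →L[ℝ] E) (hAz : ∀ w, ⟪A w, L' (0, 1, 0)⟫ = 0) (hAν : ∀ w, ⟪A w, L' (0, 0, 1)⟫ = 0)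
    (Y : E) {s : ℝ} (hs : 0 ≤ s) :
    coneJacobian L A (L' (0, 1, 0)) Y s =
      (A : W →ₗ[ℝ] E).normDet * (s ^ finrank ℝ W * |⟪Y, L' (0, 0, 1)⟫|) := by
  set R : E ≃ₗᵢ[ℝ] E := hL.rotation hL' with hR
  set F : (W × ℝ × ℝ) →ₗ[ℝ] E := (coneDeriv A (L' (0, 1, 0)) Y s : (W × ℝ × ℝ) →ₗ[ℝ] E) with hF
  set M : (W × ℝ × ℝ) →ₗ[ℝ] (W × ℝ × ℝ) := (L'.symm : E →ₗ[ℝ] (W × ℝ × ℝ)) ∘ₗ F with hM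
  set B : W →ₗ[ℝ] W := LinearMap.fst ℝ W (ℝ × ℝ) ∘ₗ (L'.symm : E →ₗ[ℝ] (W × ℝ × ℝ)) ∘ₗ
    (A : W →ₗ[ℝ] E) with hB
  have hAB : ∀ w, A w = L' (B w, 0, 0) := by
    intro w
    obtain ⟨⟨w', s', r'⟩, h⟩ := L'.surjective (A w)
    have h1 := hAz w
    have h2 := hAν w
    rw [← h, hL'.inner] at h1 h2
    have h3 : s' = 0 := by simpa using h1
    have h4 : r' = 0 := by simpa using h2
    subst h3 h4
    have : B w = w' := by simp [hB, ← h]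
    rw [this, h]
  have hdetB : (A : W →ₗ[ℝ] E).normDet = |B.det| := by
    let ι : W →ₗᵢ[ℝ] E :=
      { toLinearMap := (L' : (W × ℝ × ℝ) →ₗ[ℝ] E) ∘ₗ LinearMap.inl ℝ W (ℝ × ℝ)
        norm_map' := fun w => by
          have h := hL' w 0 0
          have h' : ‖L' (w, 0, 0)‖ ^ 2 = ‖w‖ ^ 2 := by rw [h]; ring
          exact (sq_eq_sq₀ (norm_nonneg _) (norm_nonneg _)).1 h' }
    have : (A : W →ₗ[ℝ] E) = ι.toLinearMap ∘ₗ B := by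
      ext w
      exact hAB w
    rw [this, LinearMap.normDet_comp_of_finrank_eq _ _ rfl, ι.normDet_eq_one, one_mul,
      LinearMap.normDet_eq_abs_det]
  obtain ⟨⟨a, b, c⟩, hY⟩ := L'.surjective Y
  have hc : ⟪Y, L' (0, 0, 1)⟫ = c := by
    rw [← hY, hL'.inner]
    simp
  have hMapp : ∀ x, M x = (s • B x.1 + x.2.2 • a, x.2.1 + x.2.2 * b, x.2.2 * c) := by
    intro x
    apply L'.injective
    simp only [hM, hF, LinearMap.comp_apply, LinearEquiv.coe_coe, LinearEquiv.apply_symm_apply,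
      ContinuousLinearMap.coe_coe]
    rw [coneDeriv_apply, hAB, ← hY, ← map_smul, ← map_smul, ← map_smul, ← map_add, ← map_add]
    congr 1
    simp
  have hMdet : M.det = s ^ finrank ℝ W * B.det * c := by
    rw [LinearMap.det_eq_mul_of_upperTriangular M (s • B)
      ((LinearMap.fst ℝ ℝ ℝ + b • LinearMap.snd ℝ ℝ ℝ).prod (c • LinearMap.snd ℝ ℝ ℝ)),
      LinearMap.det_eq_mul_of_upperTriangular _ LinearMap.id (c • LinearMap.id),
      LinearMap.det_smul, LinearMap.det_smul]
    · simp
    · intro x; simp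
    · intro x; simp
    · intro x; simp [hMapp]
    · intro x; simp [hMapp, mul_comm]
  have hdet : LinearMap.det (F ∘ₗ (L.symm : E →ₗ[ℝ] (W × ℝ × ℝ))) =
      M.det * LinearMap.det (R.toLinearEquiv : E →ₗ[ℝ] E) := by
    have h1 : F ∘ₗ (L.symm : E →ₗ[ℝ] (W × ℝ × ℝ)) =
        ((L' : (W × ℝ × ℝ) →ₗ[ℝ] E) ∘ₗ M ∘ₗ (L'.symm : E →ₗ[ℝ] (W × ℝ × ℝ))) ∘ₗ
          (R.toLinearEquiv : E →ₗ[ℝ] E) := by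
      ext x
      obtain ⟨y, rfl⟩ := L.surjective x
      have hRy : R (L y) = L' y := hL.rotation_apply hL' y
      simp [hM, hRy]
    rw [h1, LinearMap.det_comp, LinearMap.det_conj]
  have hRdet : |LinearMap.det (R.toLinearEquiv : E →ₗ[ℝ] E)| = 1 := by
    rw [← LinearMap.normDet_eq_abs_det]
    exact R.toLinearIsometry.normDet_eq_one
  rw [coneJacobian, hdet, abs_mul, hRdet, mul_one, hMdet, hdetB, hc, abs_mul, abs_mul, abs_pow,
    abs_of_nonneg hs]
  ring

variable [MeasurableSpace W] [BorelSpace W] [MeasurableSpace E] [BorelSpace E]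

/-- The constant in the Crofton formula, computed in the orthonormal pair `(z, ν)`. -/
noncomputable def croftonConst (d : ℕ) (z ν : E) : ℝ≥0∞ :=
  ∫⁻ Y, gaussDensity Y * ∫⁻ s in Ioi (0 : ℝ), ∫⁻ r : ℝ,
    gaussDensity (s • z + r • Y) * ENNReal.ofReal (s ^ d * |⟪Y, ν⟫|)

theorem croftonConst_map (d : ℕ) (R : E ≃ₗᵢ[ℝ] E) (z ν : E) :
    croftonConst d (R z) (R ν) = croftonConst d z ν := by
  unfold croftonConst
  rw [← R.measurePreserving.lintegral_comp_emb R.toMeasurableEquiv.measurableEmbedding]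
  refine lintegral_congr fun Y => ?_
  simp only [LinearIsometryEquiv.inner_map_map, ← map_smul, ← map_add, gaussDensity,
    LinearIsometryEquiv.norm_map]

theorem IsFrame.lintegral_coneJacobian {L : (W × ℝ × ℝ) ≃ₗ[ℝ] E} (hL : IsFrame L)
    (A : W →L[ℝ] E) {z : E} (hz : ‖z‖ = 1) (hA : ∀ w, ⟪A w, z⟫ = 0) :
    ∫⁻ Y, gaussDensity Y * ∫⁻ s in Ioi (0 : ℝ), ∫⁻ r : ℝ,
      gaussDensity (s • z + r • Y) * ENNReal.ofReal (coneJacobian L A z Y s) =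
    croftonConst (finrank ℝ W) (L (0, 1, 0)) (L (0, 0, 1)) *
      ENNReal.ofReal (A : W →ₗ[ℝ] E).normDet := by
  have hd : finrank ℝ E = finrank ℝ W + 2 := by
    rw [← L.finrank_eq]
    simp
  obtain ⟨ν, hν, hAν, hzν⟩ : ∃ ν : E, ‖ν‖ = 1 ∧ (∀ w, ⟪A w, ν⟫ = 0) ∧ ⟪z, ν⟫ = 0 := by
    set S : Submodule ℝ E := (A : W →ₗ[ℝ] E).range ⊔ Submodule.span ℝ {z} with hS
    have h1 : finrank ℝ S ≤ finrank ℝ W + 1 := by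
      calc finrank ℝ S ≤ finrank ℝ (A : W →ₗ[ℝ] E).range + finrank ℝ (Submodule.span ℝ {z}) :=
            Submodule.finrank_add_le_finrank_add_finrank _ _
        _ ≤ _ := add_le_add (LinearMap.finrank_range_le _) (by
          simpa using finrank_span_le_card (R := ℝ) ({z} : Set E))
    have h2 : Sᗮ ≠ ⊥ := by
      intro h
      have := S.finrank_add_finrank_orthogonal
      rw [h, finrank_bot] at this
      omega
    obtain ⟨v, hv, hv0⟩ := Submodule.exists_mem_ne_zero_of_ne_bot h2
    rw [Submodule.mem_orthogonal] at hv
    refine ⟨‖v‖⁻¹ • v, norm_smul_inv_norm hv0, fun w => ?_, ?_⟩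
    · rw [inner_smul_right, hv (A w) (Submodule.mem_sup_left ⟨w, rfl⟩), mul_zero]
    · rw [inner_smul_right, hv _ (Submodule.mem_sup_right (Submodule.mem_span_singleton_self z)),
        mul_zero]
  obtain ⟨L', hL', hz', hν'⟩ := exists_isFrame (W := W) hd hz hν hzν
  have hc : croftonConst (finrank ℝ W) (L (0, 1, 0)) (L (0, 0, 1)) =
      croftonConst (finrank ℝ W) z ν := by
    rw [← croftonConst_map _ (hL.rotation hL'), hL.rotation_apply, hL.rotation_apply, hz', hν']
  rw [hc, mul_comm, croftonConst, ← lintegral_const_mul' _ _ ENNReal.ofReal_ne_top]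
  refine lintegral_congr fun Y => ?_
  rw [mul_left_comm, ← lintegral_const_mul' _ _ ENNReal.ofReal_ne_top]
  congr 1
  refine setLIntegral_congr_fun measurableSet_Ioi fun s hs => ?_
  rw [← lintegral_const_mul' _ _ ENNReal.ofReal_ne_top]
  refine lintegral_congr fun r => ?_
  rw [← hz', hL.coneJacobian_eq hL' A (by simpa [hz'] using hA) (by simpa [hν'] using hAν) Y
    (le_of_lt hs), ENNReal.ofReal_mul (LinearMap.normDet_nonneg _), hν']
  ring

theorem IsFrame.lintegral_image {L : (W × ℝ × ℝ) ≃ₗ[ℝ] E} (hL : IsFrame L)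
    {F : W × ℝ × ℝ → E} {F' : W × ℝ × ℝ → (W × ℝ × ℝ) →L[ℝ] E} {s : Set (W × ℝ × ℝ)}
    (hs : MeasurableSet s) (hF : ∀ x ∈ s, HasFDerivAt F (F' x) x) (hinj : InjOn F s)
    (g : E → ℝ≥0∞) :
    ∫⁻ x in F '' s, g x =
      ∫⁻ x in s, ENNReal.ofReal |LinearMap.det ((F' x : (W × ℝ × ℝ) →ₗ[ℝ] E) ∘ₗ
        (L.symm : E →ₗ[ℝ] (W × ℝ × ℝ)))| * g (F x) := by
  let Lc : (W × ℝ × ℝ) ≃L[ℝ] E := L.toContinuousLinearEquiv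
  have hmeas : MeasurableSet (Lc.symm ⁻¹' s) := Lc.symm.continuous.measurable hs
  have h := lintegral_image_eq_lintegral_abs_det_fderiv_mul volume (f := F ∘ Lc.symm)
    (f' := fun x => (F' (Lc.symm x)).comp (Lc.symm : E →L[ℝ] (W × ℝ × ℝ))) hmeas
    (fun x hx => ((hF _ hx).comp x Lc.symm.hasFDerivAt).hasFDerivWithinAt)
    (hinj.comp Lc.symm.injective.injOn (fun x hx => hx)) g
  have himg : (F ∘ Lc.symm) '' (Lc.symm ⁻¹' s) = F '' s := by
    rw [image_comp, image_preimage_eq _ Lc.symm.surjective]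
  rw [himg] at h
  rw [h, ← hL.measurePreserving.setLIntegral_comp_preimage_emb
    Lc.toHomeomorph.toMeasurableEquiv.measurableEmbedding]
  have hpre : L ⁻¹' (Lc.symm ⁻¹' s) = s := by
    ext x
    change Lc.symm (Lc x) ∈ s ↔ _
    rw [Lc.symm_apply_apply]
  rw [hpre]
  refine lintegral_congr fun x => ?_
  have hx : Lc.symm (L x) = x := Lc.symm_apply_apply x
  simp only [hx, Function.comp_apply]
  rfl

end Frames

section ConvexCones

open scoped ENNReal NNReal Topology Pointwise
open Set Filter Module

/-- Closed convex cones with nonempty interior, different from the whole space. -/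
structure IsSolidCone {E : Type*} [NormedAddCommGroup E] [NormedSpace ℝ E] (K : Set E) :
    Prop where
  isClosed : IsClosed K
  convex : Convex ℝ K
  smul_mem : ∀ c : ℝ, 0 < c → ∀ x ∈ K, c • x ∈ K
  nonempty_interior : (interior K).Nonempty
  ne_univ : K ≠ univ

namespace IsSolidCone

variable {E : Type*} [NormedAddCommGroup E] [NormedSpace ℝ E] {K : Set E}

theorem zero_mem (hK : IsSolidCone K) : (0 : E) ∈ K := by
  obtain ⟨x, hx⟩ := hK.nonempty_interior
  have h1 : Tendsto (fun c : ℝ => c • x) (𝓝[>] 0) (𝓝 0) := by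
    have : Tendsto (fun c : ℝ => c • x) (𝓝 0) (𝓝 ((0 : ℝ) • x)) :=
      (continuous_id.smul continuous_const).tendsto 0
    rw [zero_smul] at this
    exact this.mono_left nhdsWithin_le_nhds
  exact hK.isClosed.mem_of_tendsto h1
    (eventually_nhdsWithin_of_forall fun c hc => hK.smul_mem c hc x (interior_subset hx))

theorem smul_mem' (hK : IsSolidCone K) {c : ℝ} (hc : 0 ≤ c) {x : E} (hx : x ∈ K) : c • x ∈ K := by
  rcases hc.eq_or_lt with rfl | hc
  · simpa using hK.zero_mem
  · exact hK.smul_mem c hc x hx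

theorem add_mem (hK : IsSolidCone K) {x y : E} (hx : x ∈ K) (hy : y ∈ K) : x + y ∈ K := by
  have h := hK.smul_mem 2 two_pos _
    (hK.convex hx hy (a := 1 / 2) (b := 1 / 2) (by norm_num) (by norm_num) (by norm_num))
  rw [smul_add, smul_smul, smul_smul] at h
  norm_num at h
  exact h

theorem smul_mem_iff (hK : IsSolidCone K) {c : ℝ} (hc : 0 < c) {x : E} : c • x ∈ K ↔ x ∈ K := by
  refine ⟨fun h => ?_, hK.smul_mem c hc x⟩
  have := hK.smul_mem c⁻¹ (inv_pos.2 hc) _ h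
  rwa [smul_smul, inv_mul_cancel₀ hc.ne', one_smul] at this

theorem smul_set (hK : IsSolidCone K) {c : ℝ} (hc : 0 < c) : c • K = K := by
  ext x
  rw [mem_smul_set_iff_inv_smul_mem₀ hc.ne', hK.smul_mem_iff (inv_pos.2 hc)]

theorem smul_mem_interior_iff (hK : IsSolidCone K) {c : ℝ} (hc : 0 < c) {x : E} :
    c • x ∈ interior K ↔ x ∈ interior K := by
  conv_lhs => rw [← hK.smul_set hc, interior_smul₀ hc.ne']
  exact smul_mem_smul_set_iff₀ hc.ne' _ _

theorem interior_add_mem (hK : IsSolidCone K) {x y : E} (hx : x ∈ interior K) (hy : y ∈ K) :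
    x + y ∈ interior K := by
  have h : (fun z => z - y) ⁻¹' interior K ⊆ K := fun z hz => by
    have := hK.add_mem (interior_subset hz) hy
    simpa using this
  have ho : IsOpen ((fun z => z - y) ⁻¹' interior K) :=
    isOpen_interior.preimage (continuous_id.sub continuous_const)
  exact interior_maximal h ho (by simpa using hx)

theorem zero_notMem_interior (hK : IsSolidCone K) : (0 : E) ∉ interior K := by
  intro h
  refine hK.ne_univ (eq_univ_of_forall fun x => ?_)
  have h1 : Tendsto (fun c : ℝ => c • x) (𝓝[>] 0) (𝓝 0) := by
    have : Tendsto (fun c : ℝ => c • x) (𝓝 0) (𝓝 ((0 : ℝ) • x)) :=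
      (continuous_id.smul continuous_const).tendsto 0
    rw [zero_smul] at this
    exact this.mono_left nhdsWithin_le_nhds
  obtain ⟨c, hc, hc0⟩ := ((h1.eventually (isOpen_interior.mem_nhds h)).and
    self_mem_nhdsWithin).exists
  exact (hK.smul_mem_iff hc0).1 (interior_subset hc)

theorem neg_notMem (hK : IsSolidCone K) {x : E} (hx : x ∈ interior K) : -x ∉ K := fun h =>
  hK.zero_notMem_interior (by simpa using hK.interior_add_mem hx h)

theorem zero_mem_frontier (hK : IsSolidCone K) : (0 : E) ∈ frontier K := by
  rw [hK.isClosed.frontier_eq]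
  exact ⟨hK.zero_mem, hK.zero_notMem_interior⟩

theorem mem_frontier_iff (hK : IsSolidCone K) {x : E} :
    x ∈ frontier K ↔ x ∈ K ∧ x ∉ interior K := by
  rw [hK.isClosed.frontier_eq]
  rfl

theorem smul_mem_frontier_iff (hK : IsSolidCone K) {c : ℝ} (hc : 0 < c) {x : E} :
    c • x ∈ frontier K ↔ x ∈ frontier K := by
  rw [hK.mem_frontier_iff, hK.mem_frontier_iff, hK.smul_mem_iff hc, hK.smul_mem_interior_iff hc]

/-- The height of the boundary of `K` over `v` in the direction `e`. -/
noncomputable def height (K : Set E) (e v : E) : ℝ := sInf {t : ℝ | v + t • e ∈ K}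

variable {e : E}

theorem exists_add_smul_mem (he : e ∈ interior K) (hK : IsSolidCone K) :
    ∃ C : ℝ, 0 < C ∧ ∀ v, v + (C * ‖v‖) • e ∈ K := by
  obtain ⟨ρ, hρ, hb⟩ := Metric.mem_nhds_iff.1 (mem_interior_iff_mem_nhds.1 he)
  refine ⟨2 / ρ, by positivity, fun v => ?_⟩
  rcases eq_or_ne v 0 with rfl | hv
  · simpa using hK.zero_mem
  have hv' : 0 < ‖v‖ := norm_pos_iff.2 hv
  have hmem : e + (ρ / (2 * ‖v‖)) • v ∈ K := by
    apply hb
    rw [Metric.mem_ball, dist_eq_norm, add_sub_cancel_left, norm_smul, Real.norm_eq_abs,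
      abs_of_pos (by positivity)]
    field_simp
    linarith
  have := hK.smul_mem (2 / ρ * ‖v‖) (by positivity) _ hmem
  rw [smul_add, smul_smul, add_comm] at this
  have h1 : 2 / ρ * ‖v‖ * (ρ / (2 * ‖v‖)) = 1 := by field_simp
  rwa [h1, one_smul] at this

theorem neg_le_of_add_smul_mem (hK : IsSolidCone K) (he : e ∈ interior K) {C : ℝ}
    (hC : ∀ v, v + (C * ‖v‖) • e ∈ K) {v : E} {t : ℝ} (h : v + t • e ∈ K) : -(C * ‖v‖) ≤ t := by
  by_contra! hlt
  have h1 := hK.add_mem h (hC (-v))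
  rw [norm_neg] at h1
  have h2 : v + t • e + (-v + (C * ‖v‖) • e) = (-(t + C * ‖v‖)) • (-e) := by
    module
  rw [h2, hK.smul_mem_iff (by linarith)] at h1
  exact hK.neg_notMem he h1

theorem add_smul_mem_iff (hK : IsSolidCone K) (he : e ∈ interior K) {v : E} {t : ℝ} :
    v + t • e ∈ K ↔ height K e v ≤ t := by
  obtain ⟨C, hC0, hC⟩ := exists_add_smul_mem he hK
  have hne : {t : ℝ | v + t • e ∈ K}.Nonempty := ⟨_, hC v⟩
  have hbdd : BddBelow {t : ℝ | v + t • e ∈ K} :=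
    ⟨_, fun t ht => hK.neg_le_of_add_smul_mem he hC ht⟩
  have hcl : IsClosed {t : ℝ | v + t • e ∈ K} :=
    hK.isClosed.preimage (by fun_prop : Continuous fun t : ℝ => v + t • e)
  have hmem : v + height K e v • e ∈ K := hcl.csInf_mem hne hbdd
  refine ⟨fun h => csInf_le hbdd h, fun h => ?_⟩
  have := hK.add_mem hmem (hK.smul_mem' (sub_nonneg.2 h) (interior_subset he))
  rw [sub_smul] at this
  convert this using 1
  abel

theorem add_smul_mem_interior_iff (hK : IsSolidCone K) (he : e ∈ interior K) {v : E} {t : ℝ} :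
    v + t • e ∈ interior K ↔ height K e v < t := by
  constructor
  · intro h
    have hc : Continuous fun ε : ℝ => v + (t - ε) • e := by fun_prop
    have h1 : Tendsto (fun ε : ℝ => v + (t - ε) • e) (𝓝[>] 0) (𝓝 (v + t • e)) := by
      have := (hc.tendsto 0).mono_left (nhdsWithin_le_nhds (s := Ioi 0))
      simpa using this
    obtain ⟨ε, hε, hε0⟩ := ((h1.eventually (isOpen_interior.mem_nhds h)).and
      self_mem_nhdsWithin).exists
    have := (hK.add_smul_mem_iff he).1 (interior_subset hε)
    have h0 : (0 : ℝ) < ε := hε0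
    linarith
  · intro h
    have h1 : (t - height K e v) • e ∈ interior K :=
      (hK.smul_mem_interior_iff (sub_pos.2 h)).2 he
    have := hK.interior_add_mem h1 ((hK.add_smul_mem_iff he).2 (le_refl (height K e v)))
    rw [sub_smul] at this
    convert this using 1
    abel

theorem add_smul_mem_frontier_iff (hK : IsSolidCone K) (he : e ∈ interior K) {v : E} {t : ℝ} :
    v + t • e ∈ frontier K ↔ height K e v = t := by
  rw [hK.mem_frontier_iff, hK.add_smul_mem_iff he, hK.add_smul_mem_interior_iff he, not_lt]
  exact ⟨fun h => le_antisymm h.1 h.2, fun h => ⟨h.le, h.ge⟩⟩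

theorem height_smul (hK : IsSolidCone K) (he : e ∈ interior K) {c : ℝ} (hc : 0 < c) (v : E) :
    height K e (c • v) = c * height K e v := by
  rw [← hK.add_smul_mem_frontier_iff he, mul_smul, ← smul_add, hK.smul_mem_frontier_iff hc,
    hK.add_smul_mem_frontier_iff he]

theorem height_add_le (hK : IsSolidCone K) (he : e ∈ interior K) (v w : E) :
    height K e (v + w) ≤ height K e v + height K e w := by
  rw [← hK.add_smul_mem_iff he, add_smul]
  have := hK.add_mem ((hK.add_smul_mem_iff he).2 (le_refl (height K e v)))
    ((hK.add_smul_mem_iff he).2 (le_refl (height K e w)))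
  convert this using 1
  abel

theorem exists_lipschitzWith_height (hK : IsSolidCone K) (he : e ∈ interior K) :
    ∃ C : ℝ≥0, LipschitzWith C (height K e) := by
  obtain ⟨C, hC0, hC⟩ := exists_add_smul_mem he hK
  refine ⟨⟨C, hC0.le⟩, LipschitzWith.of_le_add_mul _ fun v w => ?_⟩
  have h1 := hK.height_add_le he w (v - w)
  rw [add_sub_cancel] at h1
  have h2 := (hK.add_smul_mem_iff he).1 (hC (v - w))
  rw [dist_eq_norm]
  exact h1.trans (add_le_add le_rfl h2)

end IsSolidCone

/-- The points whose translates along `Y` hit `B`. -/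
def lineHits {E : Type*} [AddCommGroup E] [Module ℝ E] (Y : E) (B : Set E) : Set E :=
  {x | ∃ t : ℝ, x + t • Y ∈ B}

theorem lineHits_mono {E : Type*} [AddCommGroup E] [Module ℝ E] {Y : E} {B B' : Set E}
    (h : B ⊆ B') : lineHits Y B ⊆ lineHits Y B' := fun _ ⟨t, ht⟩ => ⟨t, h ht⟩

theorem lineHits_neg {E : Type*} [AddCommGroup E] [Module ℝ E] (Y : E) (B : Set E) :
    lineHits (-Y) B = lineHits Y B := by
  ext x
  constructor
  · rintro ⟨t, ht⟩
    exact ⟨-t, by simpa using ht⟩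
  · rintro ⟨t, ht⟩
    exact ⟨-t, by simpa using ht⟩

theorem lineHits_union {E : Type*} [AddCommGroup E] [Module ℝ E] (Y : E) (B B' : Set E) :
    lineHits Y (B ∪ B') = lineHits Y B ∪ lineHits Y B' := by
  ext x
  simp [lineHits, exists_or]

/-- The points of the boundary of `K` where the line in direction `Y` leaves `K`. -/
def exitSet {E : Type*} [NormedAddCommGroup E] [NormedSpace ℝ E] (K : Set E) (Y : E) : Set E :=
  {z | z ∈ frontier K ∧ ∀ r : ℝ, 0 < r → z + r • Y ∉ K}

namespace IsSolidCone

section Normed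

variable {E : Type*} [NormedAddCommGroup E] [NormedSpace ℝ E] {K : Set E}

theorem smul_mem_exitSet_iff (hK : IsSolidCone K) {c : ℝ} (hc : 0 < c) {Y z : E} :
    c • z ∈ exitSet K Y ↔ z ∈ exitSet K Y := by
  unfold exitSet
  simp only [mem_ofPred_eq, hK.smul_mem_frontier_iff hc]
  refine and_congr_right fun _ => ⟨fun h r hr hmem => ?_, fun h r hr hmem => ?_⟩
  · refine h (c * r) (by positivity) ?_
    rw [mul_smul, ← smul_add]
    exact hK.smul_mem c hc _ hmem
  · refine h (c⁻¹ * r) (by positivity) ?_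
    have := hK.smul_mem c⁻¹ (inv_pos.2 hc) _ hmem
    rwa [smul_add, smul_smul, smul_smul, inv_mul_cancel₀ hc.ne', one_smul] at this

theorem exitSet_unique (hK : IsSolidCone K) {x Y : E} {t t' : ℝ} (h : x + t • Y ∈ exitSet K Y)
    (h' : x + t' • Y ∈ exitSet K Y) : t = t' := by
  have key : ∀ {t t' : ℝ}, x + t • Y ∈ exitSet K Y → x + t' • Y ∈ exitSet K Y → t' ≤ t := by
    intro t t' h h'
    by_contra! hlt
    refine h.2 (t' - t) (sub_pos.2 hlt) ?_
    have h1 : x + t • Y + (t' - t) • Y = x + t' • Y := by module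
    rw [h1]
    exact (hK.mem_frontier_iff.1 h'.1).1
  exact le_antisymm (key h' h) (key h h')

theorem measurableSet_exitSet (hK : IsSolidCone K) [MeasurableSpace E] [BorelSpace E] (Y : E) :
    MeasurableSet (exitSet K Y) := by
  have : exitSet K Y = frontier K ∩ ⋂ n : ℕ, (fun z => z + (1 / ((n : ℝ) + 1)) • Y) ⁻¹' Kᶜ := by
    ext z
    simp only [exitSet, mem_ofPred_eq, mem_inter_iff, mem_iInter, mem_preimage, mem_compl_iff]
    refine and_congr_right fun hz => ⟨fun h n => h _ (by positivity), fun h r hr hmem => ?_⟩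
    obtain ⟨n, hn⟩ := exists_nat_one_div_lt hr
    refine h n ?_
    have hc := hK.convex (hK.mem_frontier_iff.1 hz).1 hmem (a := 1 - (1 / ((n : ℝ) + 1)) / r)
      (b := (1 / ((n : ℝ) + 1)) / r) (by
        rw [sub_nonneg, div_le_one hr]
        exact hn.le) (by positivity) (by ring)
    convert hc using 1
    have h1 : (1 / ((n : ℝ) + 1)) = (1 / ((n : ℝ) + 1)) / r * r := by field_simp
    rw [smul_add, smul_smul, ← h1, ← add_assoc, ← add_smul]
    simp
  rw [this]
  exact isClosed_frontier.measurableSet.inter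
    (MeasurableSet.iInter fun n => hK.isClosed.measurableSet.compl.preimage (by fun_prop))

theorem exitSet_eq_empty (hK : IsSolidCone K) {Y : E} (hY : Y ∈ K) : exitSet K Y = ∅ := by
  ext z
  simp only [mem_empty_iff_false, iff_false]
  intro h
  exact h.2 1 one_pos (by simpa using hK.add_mem (hK.mem_frontier_iff.1 h.1).1 hY)

theorem lineHits_interior_subset (hK : IsSolidCone K) {Y : E} (hY : Y ∉ K) :
    lineHits Y (interior K) ⊆ lineHits Y (exitSet K Y) := by
  rintro x ⟨t₀, ht₀⟩
  set S : Set ℝ := {t : ℝ | x + t • Y ∈ K} with hS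
  have hcl : IsClosed S := hK.isClosed.preimage (by fun_prop : Continuous fun t : ℝ => x + t • Y)
  have hne : S.Nonempty := ⟨t₀, (interior_subset ht₀ : x + t₀ • Y ∈ K)⟩
  have hbdd : BddAbove S := by
    by_contra hnb
    rw [not_bddAbove_iff] at hnb
    apply hY
    choose! u hu hu' using hnb
    have hlim : Tendsto (fun n : ℕ => ((n : ℝ) + 1)⁻¹ • (x - u n • Y + u n • Y)) atTop (𝓝 0) := by
      simp only [sub_add_cancel]
      have : Tendsto (fun n : ℕ => ((n : ℝ) + 1)⁻¹) atTop (𝓝 0) := by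
        simpa using tendsto_one_div_add_atTop_nhds_zero_nat (𝕜 := ℝ)
      simpa using this.smul_const x
    have hpos : ∀ n : ℕ, 0 < u (n + 1 : ℕ) := fun n => lt_trans (by positivity) (hu' _)
    have hmem : ∀ n : ℕ, (u (n + 1 : ℕ))⁻¹ • x + Y ∈ K := fun n => by
      have := hK.smul_mem _ (inv_pos.2 (hpos n)) _ (hu (n + 1 : ℕ))
      rwa [smul_add, smul_smul, inv_mul_cancel₀ (hpos n).ne', one_smul] at this
    have hu_lim : Tendsto (fun n : ℕ => u (n + 1 : ℕ)) atTop atTop := by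
      refine tendsto_atTop_mono (fun n => (hu' _).le) ?_
      exact tendsto_natCast_atTop_atTop.comp (tendsto_add_atTop_nat 1)
    have h2 : Tendsto (fun n : ℕ => (u (n + 1 : ℕ))⁻¹ • x + Y) atTop (𝓝 Y) := by
      have := (hu_lim.inv_tendsto_atTop.smul_const x).add_const Y
      simpa using this
    exact hK.isClosed.mem_of_tendsto h2 (Eventually.of_forall hmem)
  have hmax : sSup S ∈ S := hcl.csSup_mem hne hbdd
  have hlt : ∀ r : ℝ, 0 < r → x + sSup S • Y + r • Y ∉ K := by
    intro r hr hmem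
    have : sSup S + r ∈ S := by
      change x + (sSup S + r) • Y ∈ K
      rwa [add_smul, ← add_assoc]
    have := le_csSup hbdd this
    linarith
  refine ⟨sSup S, hK.mem_frontier_iff.2 ⟨hmax, fun hint => ?_⟩, hlt⟩
  have hc : Continuous fun r : ℝ => x + sSup S • Y + r • Y := by fun_prop
  have h1 : Tendsto (fun r : ℝ => x + sSup S • Y + r • Y) (𝓝[>] 0) (𝓝 (x + sSup S • Y)) := by
    have := (hc.tendsto 0).mono_left (nhdsWithin_le_nhds (s := Ioi 0))
    simpa using this
  obtain ⟨r, hr, hr0⟩ := ((h1.eventually (isOpen_interior.mem_nhds hint)).and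
    self_mem_nhdsWithin).exists
  exact hlt r hr0 (interior_subset hr)

theorem isOpen_lineHits {B : Set E} (hB : IsOpen B) (Y : E) : IsOpen (lineHits Y B) := by
  have : lineHits Y B = ⋃ t : ℝ, (fun x => x + t • Y) ⁻¹' B := by
    ext x
    simp [lineHits]
  rw [this]
  exact isOpen_iUnion fun t => hB.preimage (by fun_prop)

theorem convex_lineHits {B : Set E} (hB : Convex ℝ B) (Y : E) : Convex ℝ (lineHits Y B) := by
  rintro x ⟨t, ht⟩ y ⟨u, hu⟩ a b ha hb hab
  refine ⟨a * t + b * u, ?_⟩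
  convert hB ht hu ha hb hab using 1
  module

theorem lineHits_diff_subset (hK : IsSolidCone K) (Y : E) :
    lineHits Y K \ lineHits Y (interior K) ⊆ frontier (lineHits Y (interior K)) := by
  rintro x ⟨⟨t, ht⟩, hx⟩
  rw [(isOpen_lineHits isOpen_interior Y).frontier_eq]
  refine ⟨?_, hx⟩
  have hcl : x + t • Y ∈ closure (interior K) := by
    rw [hK.convex.closure_interior_eq_closure_of_nonempty_interior hK.nonempty_interior]
    exact subset_closure ht
  have : Continuous fun z : E => z - t • Y := by fun_prop
  have hmaps : MapsTo (fun z : E => z - t • Y) (interior K) (lineHits Y (interior K)) :=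
    fun z hz => ⟨t, by simpa using hz⟩
  have h2 := map_mem_closure this hcl hmaps
  simpa using h2

theorem lineHits_exitSet_inter_subset (hK : IsSolidCone K) (Y : E) :
    lineHits Y (exitSet K Y ∩ exitSet K (-Y)) ⊆ frontier (lineHits Y (interior K)) := by
  rintro x ⟨t, ht, ht'⟩
  refine hK.lineHits_diff_subset Y ⟨⟨t, (hK.mem_frontier_iff.1 ht.1).1⟩, ?_⟩
  rintro ⟨u, hu⟩
  rcases lt_trichotomy u t with h | rfl | h
  · refine ht'.2 (t - u) (sub_pos.2 h) ?_
    have h1 : x + t • Y + (t - u) • -Y = x + u • Y := by module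
    rw [h1]
    exact interior_subset hu
  · exact (hK.mem_frontier_iff.1 ht.1).2 hu
  · refine ht.2 (u - t) (sub_pos.2 h) ?_
    have h1 : x + t • Y + (u - t) • Y = x + u • Y := by module
    rw [h1]
    exact interior_subset hu

end Normed

end IsSolidCone

end ConvexCones

section Charts

open scoped ENNReal NNReal Topology
open Set Filter Module

theorem lipschitzOnWith_normalize {E : Type*} [NormedAddCommGroup E] [NormedSpace ℝ E] :
    LipschitzOnWith 2 (fun x : E => ‖x‖⁻¹ • x) {x | 1 ≤ ‖x‖} := by
  refine LipschitzOnWith.of_dist_le_mul fun x hx y hy => ?_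
  have hx1 : 1 ≤ ‖x‖ := hx
  have hy1 : 1 ≤ ‖y‖ := hy
  have hx0 : 0 < ‖x‖ := by linarith
  have hy0 : 0 < ‖y‖ := by linarith
  rw [dist_eq_norm, dist_eq_norm]
  have h1 : ‖x‖⁻¹ • x - ‖y‖⁻¹ • y = ‖x‖⁻¹ • (x - y) + (‖x‖⁻¹ - ‖y‖⁻¹) • y := by module
  have h2 : ‖‖x‖⁻¹ • (x - y)‖ ≤ ‖x - y‖ := by
    rw [norm_smul, norm_inv, norm_norm]
    exact mul_le_of_le_one_left (norm_nonneg _) (inv_le_one_of_one_le₀ hx1)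
  have h3 : ‖(‖x‖⁻¹ - ‖y‖⁻¹) • y‖ ≤ ‖x - y‖ := by
    have : ‖x‖⁻¹ - ‖y‖⁻¹ = (‖y‖ - ‖x‖) / (‖x‖ * ‖y‖) := by field_simp
    rw [norm_smul, Real.norm_eq_abs, this, abs_div, abs_of_pos (mul_pos hx0 hy0)]
    have h4 : |‖y‖ - ‖x‖| ≤ ‖x - y‖ := by
      rw [norm_sub_rev]
      exact abs_norm_sub_norm_le y x
    calc |‖y‖ - ‖x‖| / (‖x‖ * ‖y‖) * ‖y‖ = |‖y‖ - ‖x‖| / ‖x‖ := by field_simp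
      _ ≤ |‖y‖ - ‖x‖| := div_le_self (abs_nonneg _) hx1
      _ ≤ _ := h4
  calc _ ≤ ‖‖x‖⁻¹ • (x - y)‖ + ‖(‖x‖⁻¹ - ‖y‖⁻¹) • y‖ := by rw [h1]; exact norm_add_le _ _
    _ ≤ ‖x - y‖ + ‖x - y‖ := add_le_add h2 h3
    _ = (2 : ℝ≥0) * ‖x - y‖ := by push_cast; ring

variable {W E : Type*} [NormedAddCommGroup W] [InnerProductSpace ℝ W] [FiniteDimensional ℝ W]
  [NormedAddCommGroup E] [InnerProductSpace ℝ E] [FiniteDimensional ℝ E]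

theorem IsFrame.inner_fst_snd {L : (W × ℝ × ℝ) ≃ₗ[ℝ] E} (hL : IsFrame L) (x : W × ℝ × ℝ) :
    ⟪L x, L (0, 1, 0)⟫ = x.2.1 := by
  obtain ⟨w, s, r⟩ := x
  rw [hL.inner]
  simp

/-- The graph parametrization of the slice of the boundary of `K` at height `1` in the direction
`L (0, 1, 0)`. -/
noncomputable def sliceChart (K : Set E) (L : (W × ℝ × ℝ) ≃ₗ[ℝ] E) (w : W) : E :=
  L (w, 1, IsSolidCone.height K (L (0, 0, 1)) (L (w, 1, 0)))

/-- The central projection of `sliceChart` to the unit sphere. -/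
noncomputable def sphereChart (K : Set E) (L : (W × ℝ × ℝ) ≃ₗ[ℝ] E) (w : W) : E :=
  ‖sliceChart K L w‖⁻¹ • sliceChart K L w

/-- The left inverse of `sliceChart` and of `sphereChart`. -/
noncomputable def chartInv (L : (W × ℝ × ℝ) ≃ₗ[ℝ] E) (z : E) : W :=
  (L.symm z).2.1⁻¹ • (L.symm z).1

variable {K : Set E} {L : (W × ℝ × ℝ) ≃ₗ[ℝ] E}

theorem IsFrame.apply_add_smul (L : (W × ℝ × ℝ) ≃ₗ[ℝ] E) (w : W) (s r : ℝ) :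
    L (w, s, r) = L (w, s, 0) + r • L (0, 0, 1) := by
  rw [← map_smul, ← map_add]
  simp

theorem sliceChart_mem_frontier (hK : IsSolidCone K) (he : L (0, 0, 1) ∈ interior K) (w : W) :
    sliceChart K L w ∈ frontier K := by
  rw [sliceChart, IsFrame.apply_add_smul, hK.add_smul_mem_frontier_iff he]

theorem one_le_norm_sliceChart (hL : IsFrame L) (w : W) : 1 ≤ ‖sliceChart K L w‖ := by
  have h := hL w 1 (IsSolidCone.height K (L (0, 0, 1)) (L (w, 1, 0)))
  rw [sliceChart]
  nlinarith [norm_nonneg (L (w, 1, IsSolidCone.height K (L (0, 0, 1)) (L (w, 1, 0)))),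
    sq_nonneg ‖w‖, sq_nonneg (IsSolidCone.height K (L (0, 0, 1)) (L (w, 1, 0)))]

theorem norm_sliceChart_pos (hL : IsFrame L) (w : W) : 0 < ‖sliceChart K L w‖ :=
  one_pos.trans_le (one_le_norm_sliceChart hL w)

theorem norm_sphereChart (hL : IsFrame L) (w : W) : ‖sphereChart K L w‖ = 1 :=
  norm_smul_inv_norm (norm_pos_iff.1 (norm_sliceChart_pos hL w))

theorem sphereChart_mem_frontier (hK : IsSolidCone K) (hL : IsFrame L)
    (he : L (0, 0, 1) ∈ interior K) (w : W) : sphereChart K L w ∈ frontier K :=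
  (hK.smul_mem_frontier_iff (inv_pos.2 (norm_sliceChart_pos hL w))).2
    (sliceChart_mem_frontier hK he w)

theorem inner_sphereChart_pos (hL : IsFrame L) (w : W) :
    0 < ⟪sphereChart K L w, L (0, 1, 0)⟫ := by
  rw [sphereChart, inner_smul_left, sliceChart, hL.inner_fst_snd]
  simp only [conj_trivial, mul_one]
  exact inv_pos.2 (norm_sliceChart_pos hL w)

theorem chartInv_smul_sphereChart (hL : IsFrame L) (w : W) {s : ℝ} (hs : 0 < s) :
    chartInv L (s • sphereChart K L w) = w := by
  have := norm_sliceChart_pos (K := K) hL w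
  rw [chartInv, sphereChart, sliceChart] at *
  simp only [map_smul, LinearEquiv.symm_apply_apply, Prod.smul_mk, smul_eq_mul, mul_one, smul_smul]
  rw [inv_mul_cancel₀ (by positivity), one_smul]

theorem sphereChart_injective (hL : IsFrame L) : Function.Injective (sphereChart K L) := by
  intro w w' h
  have h1 := chartInv_smul_sphereChart (K := K) hL w one_pos
  rw [h, chartInv_smul_sphereChart hL w' one_pos] at h1
  exact h1.symm

theorem exists_smul_sphereChart_eq (hK : IsSolidCone K) (hL : IsFrame L)
    (he : L (0, 0, 1) ∈ interior K) {z : E} (hz : z ∈ frontier K) (hz' : 0 < ⟪z, L (0, 1, 0)⟫) :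
    ∃ s : ℝ, 0 < s ∧ ∃ w, z = s • sphereChart K L w := by
  obtain ⟨⟨w, s, r⟩, rfl⟩ := L.surjective z
  rw [hL.inner_fst_snd] at hz'
  simp only at hz'
  have hr : L (w, s, r) = s • sliceChart K L (s⁻¹ • w) := by
    rw [IsFrame.apply_add_smul, hK.add_smul_mem_frontier_iff he] at hz
    have h1 : L (w, s, 0) = s • L (s⁻¹ • w, 1, 0) := by
      rw [← map_smul]
      simp [smul_smul, hz'.ne']
    rw [h1, hK.height_smul he hz'] at hz
    rw [sliceChart, ← map_smul, ← hz]
    simp [smul_smul, hz'.ne']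
  have hpos := norm_sliceChart_pos (K := K) hL (s⁻¹ • w)
  refine ⟨s * ‖sliceChart K L (s⁻¹ • w)‖, by positivity, s⁻¹ • w, ?_⟩
  rw [sphereChart, smul_smul, mul_assoc, mul_inv_cancel₀ hpos.ne', mul_one, hr]

theorem exists_lipschitzWith_sphereChart (hK : IsSolidCone K) (hL : IsFrame L)
    (he : L (0, 0, 1) ∈ interior K) : ∃ C : ℝ≥0, LipschitzWith C (sphereChart K L) := by
  obtain ⟨C, hC⟩ := hK.exists_lipschitzWith_height he
  have hLc : LipschitzWith ‖(L.toContinuousLinearEquiv : (W × ℝ × ℝ) →L[ℝ] E)‖₊ L :=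
    (L.toContinuousLinearEquiv : (W × ℝ × ℝ) →L[ℝ] E).lipschitz
  have h1 : LipschitzWith 1 fun w : W => (w, (1 : ℝ), (0 : ℝ)) := by
    refine LipschitzWith.of_dist_le_mul fun x y => ?_
    simp [Prod.dist_eq]
  have h2 := hC.comp (hLc.comp h1)
  have h3 := hLc.comp (LipschitzWith.id.prodMk ((LipschitzWith.const (1 : ℝ)).prodMk h2))
  have h4 := lipschitzOnWith_normalize.comp (lipschitzOnWith_univ.2 h3)
    (fun w _ => one_le_norm_sliceChart (K := K) hL w)
  exact ⟨_, lipschitzOnWith_univ.1 h4⟩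

theorem continuous_sphereChart (hK : IsSolidCone K) (hL : IsFrame L)
    (he : L (0, 0, 1) ∈ interior K) : Continuous (sphereChart K L) := by
  obtain ⟨C, hC⟩ := exists_lipschitzWith_sphereChart hK hL he
  exact hC.continuous

theorem inner_fderiv_sphereChart (hL : IsFrame L) {w : W}
    (hw : DifferentiableAt ℝ (sphereChart K L) w) (v : W) :
    ⟪fderiv ℝ (sphereChart K L) w v, sphereChart K L w⟫ = 0 := by
  have h1 := hw.hasFDerivAt.inner ℝ hw.hasFDerivAt
  have h2 : (fun t => ⟪sphereChart K L t, sphereChart K L t⟫) = fun _ => (1 : ℝ) := by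
    ext t
    rw [real_inner_self_eq_norm_sq, norm_sphereChart hL, one_pow]
  rw [h2] at h1
  have h3 := h1.unique (hasFDerivAt_const (1 : ℝ) w)
  have h4 := congrArg (fun f : W →L[ℝ] ℝ => f v) h3
  simp [fderivInnerCLM_apply] at h4
  rw [real_inner_comm (fderiv ℝ (sphereChart K L) w v)] at h4
  linarith

theorem injective_fderiv_sphereChart (hL : IsFrame L) {w : W}
    (hw : DifferentiableAt ℝ (sphereChart K L) w) :
    Function.Injective (fderiv ℝ (sphereChart K L) w) := by
  have hz : (L.symm (sphereChart K L w)).2.1 ≠ 0 := by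
    have := inner_sphereChart_pos (K := K) hL w
    rw [← L.apply_symm_apply (sphereChart K L w), hL.inner_fst_snd] at this
    exact this.ne'
  have hLd : Differentiable ℝ fun z => L.symm z :=
    (L.toContinuousLinearEquiv.symm : E →L[ℝ] (W × ℝ × ℝ)).differentiable
  have hd : DifferentiableAt ℝ (chartInv L) (sphereChart K L w) := by
    have h1 : DifferentiableAt ℝ (fun z => (L.symm z).2.1) (sphereChart K L w) :=
      hLd.differentiableAt.snd.fst
    exact (h1.inv hz).smul hLd.differentiableAt.fst
  have hcomp := hd.hasFDerivAt.comp w hw.hasFDerivAt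
  have hid : chartInv L ∘ sphereChart K L = id := by
    ext1 t
    have := chartInv_smul_sphereChart (K := K) hL t one_pos
    simpa using this
  rw [hid] at hcomp
  have h3 := hcomp.unique (hasFDerivAt_id w)
  intro v v' hvv
  have h4 := congrArg (fun f : W →L[ℝ] W => f v) h3
  have h5 := congrArg (fun f : W →L[ℝ] W => f v') h3
  simp only [ContinuousLinearMap.comp_apply, ContinuousLinearMap.id_apply] at h4 h5
  rw [← h4, hvv, h5]

/-- The directions where `sphereChart` is differentiable. -/
def diffSet (K : Set E) (L : (W × ℝ × ℝ) ≃ₗ[ℝ] E) : Set W :=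
  {w | DifferentiableAt ℝ (sphereChart K L) w}

variable [MeasurableSpace W] [BorelSpace W] [MeasurableSpace E] [BorelSpace E]

theorem measurableSet_diffSet : MeasurableSet (diffSet K L) :=
  measurableSet_of_differentiableAt ℝ _

theorem volume_compl_diffSet (hK : IsSolidCone K) (hL : IsFrame L)
    (he : L (0, 0, 1) ∈ interior K) : volume (diffSet K L)ᶜ = 0 := by
  obtain ⟨C, hC⟩ := exists_lipschitzWith_sphereChart hK hL he
  exact hC.ae_differentiableAt

theorem euclideanHausdorffMeasure_image_eq_zero {C : ℝ≥0} {f : W → E} {s : Set W}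
    (hf : LipschitzOnWith C f s) (hs : volume s = 0) : μHE[finrank ℝ W] (f '' s) = 0 := by
  have h := hausdorffMeasure_image_le_of_edist_le (f := f) (g := id) (t := s) (c := C)
    (finrank ℝ W) (fun x hx y hy => hf hx hy)
  rw [image_id, InnerProductSpace.euclideanHausdorffMeasure_eq_volume, hs, mul_zero] at h
  exact nonpos_iff_eq_zero.1 h

theorem euclideanHausdorffMeasure_range_sphereChart (hK : IsSolidCone K) (hL : IsFrame L)
    (he : L (0, 0, 1) ∈ interior K) :
    μHE[finrank ℝ W] (range (sphereChart K L)) =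
      ∫⁻ w in diffSet K L, ENNReal.ofReal
        (fderiv ℝ (sphereChart K L) w : W →ₗ[ℝ] E).normDet := by
  have h1 := setLIntegral_normDet_fderiv (f := sphereChart K L)
    (f' := fderiv ℝ (sphereChart K L)) (measurableSet_diffSet (K := K) (L := L))
    (fun x hx => (DifferentiableAt.hasFDerivAt hx).hasFDerivWithinAt)
    (sphereChart_injective hL).injOn (fun x hx => injective_fderiv_sphereChart hL hx)
  rw [h1]
  obtain ⟨C, hC⟩ := exists_lipschitzWith_sphereChart hK hL he
  have h2 := euclideanHausdorffMeasure_image_eq_zero (hC.lipschitzOnWith (s := (diffSet K L)ᶜ))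
    (volume_compl_diffSet hK hL he)
  rw [← image_univ, ← union_compl_self (diffSet K L), image_union]
  exact le_antisymm ((measure_union_le _ _).trans (by rw [h2, add_zero]))
    (measure_mono subset_union_left)

theorem euclideanHausdorffMeasure_equator (hK : IsSolidCone K) (hL : IsFrame L)
    (he : L (0, 0, 1) ∈ interior K) :
    μHE[finrank ℝ W] {z | z ∈ frontier K ∧ ‖z‖ = 1 ∧ ⟪z, L (0, 1, 0)⟫ = 0} = 0 := by
  set φ : W → E := fun w => L (w, 0, IsSolidCone.height K (L (0, 0, 1)) (L (w, 0, 0))) with hφ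
  obtain ⟨C, hC⟩ := hK.exists_lipschitzWith_height he
  have hLc : LipschitzWith ‖(L.toContinuousLinearEquiv : (W × ℝ × ℝ) →L[ℝ] E)‖₊ L :=
    (L.toContinuousLinearEquiv : (W × ℝ × ℝ) →L[ℝ] E).lipschitz
  have h1 : LipschitzWith 1 fun w : W => (w, (0 : ℝ), (0 : ℝ)) := by
    refine LipschitzWith.of_dist_le_mul fun x y => ?_
    simp [Prod.dist_eq]
  have h3 := hLc.comp (LipschitzWith.id.prodMk ((LipschitzWith.const (0 : ℝ)).prodMk
    (hC.comp (hLc.comp h1))))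
  have hnorm : ∀ w ∈ Metric.sphere (0 : W) 1, φ w ∈ {x : E | 1 ≤ ‖x‖} := by
    intro w hw
    rw [mem_sphere_zero_iff_norm] at hw
    have h := hL w 0 (IsSolidCone.height K (L (0, 0, 1)) (L (w, 0, 0)))
    change 1 ≤ ‖L (w, 0, IsSolidCone.height K (L (0, 0, 1)) (L (w, 0, 0)))‖
    rw [hw] at h
    nlinarith [norm_nonneg (L (w, 0, IsSolidCone.height K (L (0, 0, 1)) (L (w, 0, 0)))),
      sq_nonneg (IsSolidCone.height K (L (0, 0, 1)) (L (w, 0, 0)))]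
  have h4 := lipschitzOnWith_normalize.comp (h3.lipschitzOnWith (s := Metric.sphere (0 : W) 1))
    hnorm
  have hvol : volume (Metric.sphere (0 : W) 1) = 0 :=
    Measure.addHaar_sphere_of_ne_zero _ _ one_ne_zero
  refine measure_mono_null ?_ (euclideanHausdorffMeasure_image_eq_zero h4 hvol)
  rintro z ⟨hz, hz1, hz0⟩
  obtain ⟨⟨w, s, r⟩, rfl⟩ := L.surjective z
  rw [hL.inner_fst_snd] at hz0
  simp only at hz0
  subst hz0
  rw [IsFrame.apply_add_smul, hK.add_smul_mem_frontier_iff he] at hz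
  have hzn := hz1
  rw [← hz] at hz1
  have hw : w ≠ 0 := by
    rintro rfl
    have h0 : IsSolidCone.height K (L (0, 0, 1)) (L ((0 : W), 0, 0)) = 0 := by
      rw [← hK.add_smul_mem_frontier_iff he, ← Prod.zero_eq_mk, ← Prod.zero_eq_mk]
      simpa using hK.zero_mem_frontier
    rw [h0] at hz1
    simp [← Prod.zero_eq_mk] at hz1
  have hw' : 0 < ‖w‖ := norm_pos_iff.2 hw
  refine ⟨‖w‖⁻¹ • w, by simp [norm_smul, hw], ?_⟩
  have h5 : φ (‖w‖⁻¹ • w) = ‖w‖⁻¹ • L (w, 0, r) := by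
    have h6 : L (‖w‖⁻¹ • w, 0, 0) = ‖w‖⁻¹ • L (w, 0, 0) := by
      rw [← map_smul]
      simp
    simp only [hφ]
    rw [h6, hK.height_smul he (inv_pos.2 hw'), hz, ← map_smul]
    simp
  change ‖φ (‖w‖⁻¹ • w)‖⁻¹ • φ (‖w‖⁻¹ • w) = _
  rw [h5, norm_smul, hzn, norm_inv, norm_norm, mul_one, inv_inv, smul_smul,
    mul_inv_cancel₀ hw'.ne', one_smul]

end Charts

section Crofton

open scoped ENNReal NNReal Topology
open Set Filter Module

variable {W E : Type*} [NormedAddCommGroup W] [InnerProductSpace ℝ W] [FiniteDimensional ℝ W]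
  [NormedAddCommGroup E] [InnerProductSpace ℝ E] [FiniteDimensional ℝ E]
  {K : Set E} {L : (W × ℝ × ℝ) ≃ₗ[ℝ] E}

theorem IsSolidCone.exists_supporting (hK : IsSolidCone K) {z : E} (hz : z ∈ frontier K) :
    ∃ ν : E, ν ≠ 0 ∧ (∀ x ∈ K, ⟪x, ν⟫ ≤ 0) ∧ ⟪z, ν⟫ = 0 := by
  obtain ⟨f, hf⟩ := geometric_hahn_banach_open_point hK.convex.interior isOpen_interior
    (hK.mem_frontier_iff.1 hz).2
  have hle : ∀ x ∈ K, f x ≤ f z := by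
    intro x hx
    have hx' : x ∈ closure (interior K) := by
      rw [hK.convex.closure_interior_eq_closure_of_nonempty_interior hK.nonempty_interior]
      exact subset_closure hx
    exact closure_minimal (fun y hy => (hf y hy).le)
      (isClosed_le f.continuous continuous_const) hx'
  have hneg : ∀ x ∈ K, f x ≤ 0 := by
    intro x hx
    by_contra! hpos
    have h1 := hle _ (hK.smul_mem ((|f z| + 1) / f x) (by positivity) x hx)
    rw [map_smul, smul_eq_mul, div_mul_cancel₀ _ hpos.ne'] at h1
    linarith [le_abs_self (f z)]
  have hz0 : f z = 0 := le_antisymm (hneg z (hK.mem_frontier_iff.1 hz).1)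
    (by simpa using hle 0 hK.zero_mem)
  obtain ⟨a, ha⟩ := hK.nonempty_interior
  have hinner : ∀ x, ⟪x, (InnerProductSpace.toDual ℝ E).symm f⟫ = f x := fun x => by
    rw [real_inner_comm, InnerProductSpace.toDual_symm_apply]
  refine ⟨(InnerProductSpace.toDual ℝ E).symm f, fun h => ?_, fun x hx => ?_, ?_⟩
  · have h1 := hinner a
    rw [h, inner_zero_right] at h1
    have h2 := hf a ha
    rw [← h1, hz0] at h2
    exact lt_irrefl _ h2
  · rw [hinner]
    exact hneg x hx
  · rw [hinner, hz0]

/-- The map `(w, s, r) ↦ s • Φ w + r • Y` for the chart `Φ = sphereChart K L`. -/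
noncomputable def coneMap (K : Set E) (L : (W × ℝ × ℝ) ≃ₗ[ℝ] E) (Y : E) (x : W × ℝ × ℝ) : E :=
  x.2.1 • sphereChart K L x.1 + x.2.2 • Y

/-- The cone over the part of the boundary of `K` parametrized differentiably by `sphereChart`. -/
def chartCone (K : Set E) (L : (W × ℝ × ℝ) ≃ₗ[ℝ] E) : Set E :=
  {z | ∃ s : ℝ, 0 < s ∧ ∃ w ∈ diffSet K L, z = s • sphereChart K L w}

theorem hasFDerivAt_coneMap (Y : E) {x : W × ℝ × ℝ} (hx : x.1 ∈ diffSet K L) :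
    HasFDerivAt (coneMap K L Y)
      (coneDeriv (fderiv ℝ (sphereChart K L) x.1) (sphereChart K L x.1) Y x.2.1) x := by
  have h1 : HasFDerivAt (fun x : W × ℝ × ℝ => sphereChart K L x.1)
      ((fderiv ℝ (sphereChart K L) x.1).comp (ContinuousLinearMap.fst ℝ W (ℝ × ℝ))) x :=
    (DifferentiableAt.hasFDerivAt hx).comp x hasFDerivAt_fst
  have h2 : HasFDerivAt (fun x : W × ℝ × ℝ => x.2.1)
      ((ContinuousLinearMap.fst ℝ ℝ ℝ).comp (ContinuousLinearMap.snd ℝ W (ℝ × ℝ))) x :=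
    hasFDerivAt_fst.comp x hasFDerivAt_snd
  have h3 : HasFDerivAt (fun x : W × ℝ × ℝ => x.2.2)
      ((ContinuousLinearMap.snd ℝ ℝ ℝ).comp (ContinuousLinearMap.snd ℝ W (ℝ × ℝ))) x :=
    hasFDerivAt_snd.comp x hasFDerivAt_snd
  refine ((h2.smul h1).add (h3.smul_const Y)).congr_fderiv ?_
  ext v <;> simp [coneDeriv]

theorem coneJacobian_eq_zero_of_notMem (hK : IsSolidCone K) (hL : IsFrame L)
    (he : L (0, 0, 1) ∈ interior K) {Y : E} {w : W} (hw : w ∈ diffSet K L)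
    (h1 : sphereChart K L w ∉ exitSet K Y) (h2 : sphereChart K L w ∉ exitSet K (-Y)) (s : ℝ) :
    coneJacobian L (fderiv ℝ (sphereChart K L) w) (sphereChart K L w) Y s = 0 := by
  have hz := sphereChart_mem_frontier hK hL he
  obtain ⟨ν, hν0, hνK, hνz⟩ := hK.exists_supporting (hz w)
  have hY : ∀ Y' : E, sphereChart K L w ∉ exitSet K Y' → ⟪Y', ν⟫ ≤ 0 := by
    intro Y' h
    have : ∃ r : ℝ, 0 < r ∧ sphereChart K L w + r • Y' ∈ K := by
      by_contra! hcon
      exact h ⟨hz w, hcon⟩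
    obtain ⟨r, hr, hmem⟩ := this
    have := hνK _ hmem
    rw [inner_add_left, hνz, zero_add, inner_smul_left] at this
    exact nonpos_of_mul_nonpos_right this (by simpa using hr)
  refine coneJacobian_eq_zero L _ _ _ _ hν0 (fun v => ?_) hνz ?_
  · have hd : HasFDerivAt (fun t => ⟪ν, sphereChart K L t⟫)
        ((innerSL ℝ ν).comp (fderiv ℝ (sphereChart K L) w)) w :=
      (innerSL ℝ ν).hasFDerivAt.comp w (DifferentiableAt.hasFDerivAt hw)
    have hmax : IsLocalMax (fun t => ⟪ν, sphereChart K L t⟫) w := by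
      refine Eventually.of_forall fun t => ?_
      simp only
      rw [real_inner_comm, real_inner_comm _ ν, hνz]
      exact hνK _ (hK.mem_frontier_iff.1 (hz t)).1
    have h := hmax.hasFDerivAt_eq_zero hd
    have h' := congrArg (fun f : W →L[ℝ] ℝ => f v) h
    rw [real_inner_comm]
    simpa using h'
  · have h3 := hY _ h1
    have h4 := hY _ h2
    rw [inner_neg_left] at h4
    linarith

variable [MeasurableSpace W] [BorelSpace W] [MeasurableSpace E] [BorelSpace E]

theorem continuous_coneMap (hK : IsSolidCone K) (hL : IsFrame L) (he : L (0, 0, 1) ∈ interior K)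
    (Y : E) : Continuous (coneMap K L Y) := by
  have := continuous_sphereChart hK hL he
  unfold coneMap
  fun_prop

theorem continuous_coneDeriv :
    Continuous fun p : ((W →L[ℝ] E) × E) × (E × ℝ) => coneDeriv p.1.1 p.1.2 p.2.1 p.2.2 := by
  have heq : (fun p : ((W →L[ℝ] E) × E) × (E × ℝ) => coneDeriv p.1.1 p.1.2 p.2.1 p.2.2) =
      fun p => (p.2.2 • p.1.1).comp (ContinuousLinearMap.fst ℝ W (ℝ × ℝ)) +
        (((ContinuousLinearMap.fst ℝ ℝ ℝ).comp
          (ContinuousLinearMap.snd ℝ W (ℝ × ℝ))).smulRight p.1.2 +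
        ((ContinuousLinearMap.snd ℝ ℝ ℝ).comp
          (ContinuousLinearMap.snd ℝ W (ℝ × ℝ))).smulRight p.2.1) := by
    funext p
    apply ContinuousLinearMap.ext
    intro x
    simp [coneDeriv_apply]
  rw [heq]
  have hr : ∀ c : (W × ℝ × ℝ) →L[ℝ] ℝ, Continuous fun y : E => c.smulRight y := fun c =>
    (ContinuousLinearMap.smulRightL ℝ (W × ℝ × ℝ) E c).continuous
  have h1 : Continuous fun p : ((W →L[ℝ] E) × E) × (E × ℝ) => p.2.2 • p.1.1 := by fun_prop
  exact (h1.clm_comp continuous_const).add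
    (((hr _).comp (continuous_snd.comp continuous_fst)).add
      ((hr _).comp (continuous_fst.comp continuous_snd)))

theorem continuous_coneJacobian (L : (W × ℝ × ℝ) ≃ₗ[ℝ] E) :
    Continuous fun p : ((W →L[ℝ] E) × E) × (E × ℝ) => coneJacobian L p.1.1 p.1.2 p.2.1 p.2.2 := by
  let Lc : (W × ℝ × ℝ) ≃L[ℝ] E := L.toContinuousLinearEquiv
  have h2 : Continuous fun p : ((W →L[ℝ] E) × E) × (E × ℝ) =>
      ((coneDeriv p.1.1 p.1.2 p.2.1 p.2.2).comp (Lc.symm : E →L[ℝ] (W × ℝ × ℝ))).det :=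
    ContinuousLinearMap.continuous_det.comp (continuous_coneDeriv.clm_comp continuous_const)
  exact h2.abs

theorem measurable_coneJacobian (hK : IsSolidCone K) (hL : IsFrame L)
    (he : L (0, 0, 1) ∈ interior K) :
    Measurable fun q : (W × ℝ × ℝ) × E =>
      coneJacobian L (fderiv ℝ (sphereChart K L) q.1.1) (sphereChart K L q.1.1) q.2 q.1.2.1 := by
  have hm1 : Measurable fun q : (W × ℝ × ℝ) × E => fderiv ℝ (sphereChart K L) q.1.1 :=
    (measurable_fderiv ℝ (sphereChart K L)).comp (measurable_fst.comp measurable_fst)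
  have hm2 : Measurable fun q : (W × ℝ × ℝ) × E => sphereChart K L q.1.1 :=
    (continuous_sphereChart hK hL he).measurable.comp (measurable_fst.comp measurable_fst)
  have hm3 : Measurable fun q : (W × ℝ × ℝ) × E => q.1.2.1 := by fun_prop
  have hJ : Measurable fun p : ((W →L[ℝ] E) × E) × (E × ℝ) =>
      coneJacobian L p.1.1 p.1.2 p.2.1 p.2.2 := (continuous_coneJacobian L).measurable
  have hq := (hm1.prodMk hm2).prodMk (measurable_snd.prodMk hm3)
  have h := hJ.comp hq
  simp only [Function.comp_def] at h
  exact h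

theorem measurable_crofton_integrand (hK : IsSolidCone K) (hL : IsFrame L)
    (he : L (0, 0, 1) ∈ interior K) :
    Measurable fun q : (W × ℝ × ℝ) × E =>
      gaussDensity (coneMap K L q.2 q.1) * ENNReal.ofReal
        (coneJacobian L (fderiv ℝ (sphereChart K L) q.1.1) (sphereChart K L q.1.1) q.2 q.1.2.1) := by
  refine Measurable.mul ?_ (measurable_coneJacobian hK hL he).ennreal_ofReal
  have hc : Continuous fun q : (W × ℝ × ℝ) × E => coneMap K L q.2 q.1 := by
    have := continuous_sphereChart hK hL he
    unfold coneMap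
    fun_prop
  exact (continuous_gaussDensity.comp hc).measurable

/-- The domain of differentiability of `coneMap`. -/
def coneDomain (K : Set E) (L : (W × ℝ × ℝ) ≃ₗ[ℝ] E) : Set (W × ℝ × ℝ) :=
  diffSet K L ×ˢ (Ioi (0 : ℝ) ×ˢ univ)

theorem measurableSet_coneDomain : MeasurableSet (coneDomain K L) :=
  measurableSet_diffSet.prod (measurableSet_Ioi.prod MeasurableSet.univ)

theorem croftonConst_mul_range_sphereChart (hK : IsSolidCone K) (hL : IsFrame L)
    (he : L (0, 0, 1) ∈ interior K) :
    croftonConst (finrank ℝ W) (L (0, 1, 0)) (L (0, 0, 1)) *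
        μHE[finrank ℝ W] (range (sphereChart K L)) =
      ∫⁻ Y, gaussDensity Y * ∫⁻ x in coneDomain K L, gaussDensity (coneMap K L Y x) *
        ENNReal.ofReal (coneJacobian L (fderiv ℝ (sphereChart K L) x.1) (sphereChart K L x.1) Y
          x.2.1) := by
  have hmeas := measurable_crofton_integrand hK hL he
  set f : (W × ℝ × ℝ) × E → ℝ≥0∞ := fun q =>
      gaussDensity (coneMap K L q.2 q.1) * ENNReal.ofReal
        (coneJacobian L (fderiv ℝ (sphereChart K L) q.1.1) (sphereChart K L q.1.1) q.2 q.1.2.1)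
    with hf
  have hprod : ∀ Y, ∫⁻ x in coneDomain K L, f (x, Y) =
      ∫⁻ w in diffSet K L, ∫⁻ s in Ioi (0 : ℝ), ∫⁻ r : ℝ, f ((w, s, r), Y) := by
    intro Y
    have hmY : Measurable fun x : W × ℝ × ℝ => f (x, Y) := hmeas.comp (by fun_prop)
    rw [coneDomain, Measure.volume_eq_prod, ← Measure.prod_restrict,
      lintegral_prod _ hmY.aemeasurable]
    refine lintegral_congr fun w => ?_
    have hmw : Measurable fun y : ℝ × ℝ => f ((w, y), Y) := hmeas.comp (by fun_prop)
    rw [Measure.volume_eq_prod, ← Measure.prod_restrict, Measure.restrict_univ,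
      lintegral_prod _ hmw.aemeasurable]
  have hmw : Measurable fun q : W × E => gaussDensity q.2 *
      ∫⁻ s in Ioi (0 : ℝ), ∫⁻ r : ℝ, f ((q.1, s, r), q.2) := by
    refine (measurable_gaussDensity.comp measurable_snd).mul ?_
    refine Measurable.lintegral_prod_right' (f := fun p : (W × E) × ℝ =>
      ∫⁻ r : ℝ, f ((p.1.1, p.2, r), p.1.2)) ?_
    refine Measurable.lintegral_prod_right' (f := fun p : ((W × E) × ℝ) × ℝ =>
      f ((p.1.1.1, p.1.2, p.2), p.1.1.2)) ?_
    exact hmeas.comp (by fun_prop)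
  have hJ : Measurable fun w => ENNReal.ofReal
      (fderiv ℝ (sphereChart K L) w : W →ₗ[ℝ] E).normDet :=
    (continuous_normDet.measurable.comp (measurable_fderiv ℝ _)).ennreal_ofReal
  rw [euclideanHausdorffMeasure_range_sphereChart hK hL he, ← lintegral_const_mul _ hJ]
  calc ∫⁻ w in diffSet K L, croftonConst (finrank ℝ W) (L (0, 1, 0)) (L (0, 0, 1)) *
        ENNReal.ofReal (fderiv ℝ (sphereChart K L) w : W →ₗ[ℝ] E).normDet
      = ∫⁻ w in diffSet K L, ∫⁻ Y, gaussDensity Y *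
          ∫⁻ s in Ioi (0 : ℝ), ∫⁻ r : ℝ, f ((w, s, r), Y) := by
        refine setLIntegral_congr_fun measurableSet_diffSet fun w hw => ?_
        exact (hL.lintegral_coneJacobian _ (norm_sphereChart hL w)
          (inner_fderiv_sphereChart hL hw)).symm
    _ = ∫⁻ Y, ∫⁻ w in diffSet K L, gaussDensity Y *
          ∫⁻ s in Ioi (0 : ℝ), ∫⁻ r : ℝ, f ((w, s, r), Y) :=
        lintegral_lintegral_swap hmw.aemeasurable
    _ = ∫⁻ Y, gaussDensity Y * ∫⁻ w in diffSet K L,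
          ∫⁻ s in Ioi (0 : ℝ), ∫⁻ r : ℝ, f ((w, s, r), Y) := by
        refine lintegral_congr fun Y => ?_
        exact lintegral_const_mul' _ _ ENNReal.ofReal_ne_top
    _ = _ := by
        refine lintegral_congr fun Y => ?_
        rw [← hprod]

theorem lintegral_coneMap_of_unique (hK : IsSolidCone K) (hL : IsFrame L)
    (he : L (0, 0, 1) ∈ interior K) (Y : E) {B : Set E} (hB : MeasurableSet B)
    (hcone : ∀ c : ℝ, 0 < c → ∀ z, c • z ∈ B ↔ z ∈ B)
    (huniq : ∀ (x : E) (t t' : ℝ), x + t • Y ∈ B → x + t' • Y ∈ B → t = t') :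
    MeasurableSet (lineHits Y (chartCone K L ∩ B)) ∧
    ∫⁻ x in coneDomain K L ∩ {x | sphereChart K L x.1 ∈ B}, gaussDensity (coneMap K L Y x) *
        ENNReal.ofReal (coneJacobian L (fderiv ℝ (sphereChart K L) x.1) (sphereChart K L x.1) Y
          x.2.1) = gauss E (lineHits Y (chartCone K L ∩ B)) := by
  set X : Set (W × ℝ × ℝ) := coneDomain K L ∩ {x | sphereChart K L x.1 ∈ B} with hX
  have hXm : MeasurableSet X := measurableSet_coneDomain.inter
    (hB.preimage ((continuous_sphereChart hK hL he).measurable.comp measurable_fst))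
  have himg : coneMap K L Y '' X = lineHits Y (chartCone K L ∩ B) := by
    ext x
    constructor
    · rintro ⟨⟨w, s, r⟩, ⟨⟨hw, hs, -⟩, hwB⟩, rfl⟩
      refine ⟨-r, ?_⟩
      have : coneMap K L Y (w, s, r) + -r • Y = s • sphereChart K L w := by
        simp [coneMap]
      rw [this]
      exact ⟨⟨s, hs, w, hw, rfl⟩, (hcone s hs _).2 hwB⟩
    · rintro ⟨t, ⟨s, hs, w, hw, hz⟩, hxB⟩
      refine ⟨(w, s, -t), ⟨⟨hw, hs, mem_univ _⟩, ?_⟩, ?_⟩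
      · rw [hz] at hxB
        exact (hcone s hs _).1 hxB
      · simp [coneMap, ← hz]
  have hinj : InjOn (coneMap K L Y) X := by
    rintro ⟨w, s, r⟩ ⟨⟨hw, hs, -⟩, hwB⟩ ⟨w', s', r'⟩ ⟨⟨hw', hs', -⟩, hwB'⟩ h
    have hs0 : 0 < s := hs
    have hs0' : 0 < s' := hs'
    simp only [coneMap] at h
    have h1 : s • sphereChart K L w ∈ B := (hcone s hs _).2 hwB
    have h2 : s' • sphereChart K L w' ∈ B := (hcone s' hs' _).2 hwB'
    have hrr : r = r' := by
      have h3 := huniq (s • sphereChart K L w) 0 (r - r') (by simpa using h1) (by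
        have : s • sphereChart K L w + (r - r') • Y = s' • sphereChart K L w' := by
          rw [sub_smul, ← add_sub_assoc, h]
          simp
        rwa [this])
      linarith
    subst hrr
    have h4 := add_right_cancel h
    have hw1 := chartInv_smul_sphereChart (K := K) hL w hs0
    rw [h4, chartInv_smul_sphereChart hL w' hs0'] at hw1
    subst hw1
    have hs1 := congrArg norm h4
    rw [norm_smul, norm_smul, norm_sphereChart hL, Real.norm_of_nonneg hs0.le,
      Real.norm_of_nonneg hs0'.le, mul_one, mul_one] at hs1
    rw [hs1]
  have hmimg : MeasurableSet (coneMap K L Y '' X) :=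
    hXm.image_of_continuousOn_injOn (continuous_coneMap hK hL he Y).continuousOn hinj
  rw [← himg]
  refine ⟨hmimg, ?_⟩
  rw [gauss, withDensity_apply _ hmimg,
    hL.lintegral_image hXm (fun x hx => hasFDerivAt_coneMap Y hx.1.1) hinj]
  refine lintegral_congr fun x => ?_
  rw [mul_comm]
  rfl

theorem lintegral_coneMap (hK : IsSolidCone K) (hL : IsFrame L)
    (he : L (0, 0, 1) ∈ interior K) (Y : E) :
    ∫⁻ x in coneDomain K L, gaussDensity (coneMap K L Y x) *
        ENNReal.ofReal (coneJacobian L (fderiv ℝ (sphereChart K L) x.1) (sphereChart K L x.1) Y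
          x.2.1) = gauss E (lineHits Y (chartCone K L ∩ exitSet K Y)) +
        gauss E (lineHits Y (chartCone K L ∩ exitSet K (-Y))) := by
  have hneg : ∀ (x : E) (t t' : ℝ), x + t • Y ∈ exitSet K (-Y) → x + t' • Y ∈ exitSet K (-Y) →
      t = t' := by
    intro x t t' h h'
    have := hK.exitSet_unique (x := x) (Y := -Y) (t := -t) (t' := -t') (by simpa using h)
      (by simpa using h')
    linarith
  obtain ⟨hm1, h1⟩ := lintegral_coneMap_of_unique hK hL he Y (hK.measurableSet_exitSet Y)
    (fun c hc z => hK.smul_mem_exitSet_iff hc) (fun x t t' => hK.exitSet_unique)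
  obtain ⟨hm2, h2⟩ := lintegral_coneMap_of_unique hK hL he Y
    (B := exitSet K (-Y) \ exitSet K Y)
    ((hK.measurableSet_exitSet (-Y)).diff (hK.measurableSet_exitSet Y))
    (fun c hc z => and_congr (hK.smul_mem_exitSet_iff hc) (not_congr (hK.smul_mem_exitSet_iff hc)))
    (fun x t t' h h' => hneg x t t' h.1 h'.1)
  have hnull : gauss E (lineHits Y (exitSet K Y ∩ exitSet K (-Y))) = 0 := by
    refine measure_mono_null (hK.lineHits_exitSet_inter_subset Y) (gauss_absolutelyContinuous ?_)
    exact (IsSolidCone.convex_lineHits hK.convex.interior Y).addHaar_frontier volume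
  have h3 : gauss E (lineHits Y (chartCone K L ∩ exitSet K (-Y))) =
      gauss E (lineHits Y (chartCone K L ∩ (exitSet K (-Y) \ exitSet K Y))) := by
    refine le_antisymm ?_ (measure_mono (lineHits_mono
      (inter_subset_inter_right _ sdiff_subset)))
    have hsub : lineHits Y (chartCone K L ∩ exitSet K (-Y)) ⊆
        lineHits Y (chartCone K L ∩ (exitSet K (-Y) \ exitSet K Y)) ∪
          lineHits Y (exitSet K Y ∩ exitSet K (-Y)) := by
      rw [← lineHits_union]
      refine lineHits_mono fun z hz => ?_
      by_cases hzY : z ∈ exitSet K Y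
      · exact Or.inr ⟨hzY, hz.2⟩
      · exact Or.inl ⟨hz.1, hz.2, hzY⟩
    exact (measure_mono hsub).trans ((measure_union_le _ _).trans (by rw [hnull, add_zero]))
  rw [h3, ← h1, ← h2]
  set f : W × ℝ × ℝ → ℝ≥0∞ := fun x => gaussDensity (coneMap K L Y x) *
        ENNReal.ofReal (coneJacobian L (fderiv ℝ (sphereChart K L) x.1) (sphereChart K L x.1) Y
          x.2.1) with hf
  have hΦ : Measurable fun x : W × ℝ × ℝ => sphereChart K L x.1 :=
    (continuous_sphereChart hK hL he).measurable.comp measurable_fst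
  have hA : MeasurableSet {x : W × ℝ × ℝ | sphereChart K L x.1 ∈ exitSet K Y} :=
    (hK.measurableSet_exitSet Y).preimage hΦ
  have hB : MeasurableSet {x : W × ℝ × ℝ | sphereChart K L x.1 ∈ exitSet K (-Y)} :=
    (hK.measurableSet_exitSet (-Y)).preimage hΦ
  rw [← lintegral_inter_add_sdiff f (coneDomain K L) hA]
  congr 1
  rw [← lintegral_inter_add_sdiff f _ hB]
  have hzero : ∫⁻ x in (coneDomain K L \ {x : W × ℝ × ℝ | sphereChart K L x.1 ∈ exitSet K Y}) \
      {x : W × ℝ × ℝ | sphereChart K L x.1 ∈ exitSet K (-Y)}, f x = 0 := by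
    rw [setLIntegral_congr_fun ((measurableSet_coneDomain.diff hA).diff hB)
      (g := fun _ => 0), lintegral_zero]
    intro x hx
    simp only [hf]
    rw [coneJacobian_eq_zero_of_notMem hK hL he hx.1.1.1 hx.1.2 hx.2]
    simp
  rw [hzero, add_zero]
  congr 2
  ext x
  constructor
  · rintro ⟨⟨h, h'⟩, h''⟩
    exact ⟨h, h'', h'⟩
  · rintro ⟨h, h'', h'⟩
    exact ⟨⟨h, h'⟩, h''⟩

end Crofton

section CroftonTotal

open scoped ENNReal NNReal Topology Pointwise
open Set Filter Module

variable {W E : Type*} [NormedAddCommGroup W] [InnerProductSpace ℝ W] [FiniteDimensional ℝ W]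
  [NormedAddCommGroup E] [InnerProductSpace ℝ E] [FiniteDimensional ℝ E]
  {K : Set E} {L : (W × ℝ × ℝ) ≃ₗ[ℝ] E}

/-- The frame with the middle vector reversed. -/
def flipFrame (L : (W × ℝ × ℝ) ≃ₗ[ℝ] E) : (W × ℝ × ℝ) ≃ₗ[ℝ] E :=
  ((LinearEquiv.refl ℝ W).prodCongr ((LinearEquiv.neg ℝ).prodCongr (LinearEquiv.refl ℝ ℝ))).trans L

theorem flipFrame_apply (L : (W × ℝ × ℝ) ≃ₗ[ℝ] E) (w : W) (s r : ℝ) :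
    flipFrame L (w, s, r) = L (w, -s, r) := rfl

theorem IsFrame.flipFrame (hL : IsFrame L) : IsFrame (flipFrame L) := fun w s r => by
  rw [flipFrame_apply, hL, neg_sq]

theorem flipFrame_middle (L : (W × ℝ × ℝ) ≃ₗ[ℝ] E) :
    flipFrame L (0, 1, 0) = -L (0, 1, 0) := by
  rw [flipFrame_apply, ← map_neg]
  simp

theorem flipFrame_last (L : (W × ℝ × ℝ) ≃ₗ[ℝ] E) : flipFrame L (0, 0, 1) = L (0, 0, 1) := by
  rw [flipFrame_apply]
  simp

theorem inner_pos_of_mem_chartCone (hL : IsFrame L) {z : E} (hz : z ∈ chartCone K L) :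
    0 < ⟪z, L (0, 1, 0)⟫ := by
  obtain ⟨s, hs, w, -, rfl⟩ := hz
  rw [inner_smul_left]
  exact mul_pos hs (inner_sphereChart_pos hL w)

variable [MeasurableSpace W] [BorelSpace W] [MeasurableSpace E] [BorelSpace E]

/-- Almost no line in a given direction hits the part of the boundary missed by the chart. -/
theorem volume_lineHits_diff_chartCone (hK : IsSolidCone K) (hL : IsFrame L)
    (he : L (0, 0, 1) ∈ interior K) (Y : E) :
    volume (lineHits Y {z | z ∈ frontier K ∧ 0 ≤ ⟪z, L (0, 1, 0)⟫ ∧ z ∉ chartCone K L}) = 0 := by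
  set N₀ : Set (W × ℝ × ℝ) := univ ×ˢ ({0} ×ˢ univ) with hN₀
  set N₁ : Set (W × ℝ × ℝ) := {x | 0 < x.2.1 ∧ x.2.1⁻¹ • x.1 ∉ diffSet K L} with hN₁
  have hN₀v : volume N₀ = 0 := by
    simp only [hN₀, Measure.volume_eq_prod, Measure.prod_prod]
    simp
  have hN₁v : volume N₁ = 0 := by
    have hm : MeasurableSet N₁ := by
      refine (measurableSet_lt measurable_const (measurable_fst.comp measurable_snd)).inter ?_
      have hf : Measurable fun x : W × ℝ × ℝ => x.2.1⁻¹ • x.1 := by fun_prop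
      exact measurableSet_diffSet.compl.preimage hf
    rw [Measure.volume_eq_prod, Measure.prod_apply_symm hm]
    refine lintegral_eq_zero_of_ae_eq_zero (Eventually.of_forall fun y => ?_)
    change volume ((fun x => (x, y)) ⁻¹' N₁) = 0
    rcases le_or_gt y.1 0 with hy | hy
    · have : (fun x : W => (x, y)) ⁻¹' N₁ = ∅ := by
        ext x
        simp [hN₁, not_lt.2 hy]
      rw [this, measure_empty]
    · have : (fun x : W => (x, y)) ⁻¹' N₁ = (fun x : W => y.1⁻¹ • x) ⁻¹' (diffSet K L)ᶜ := by
        ext x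
        simp [hN₁, hy]
      rw [this, Measure.addHaar_preimage_smul _ (inv_ne_zero hy.ne'),
        volume_compl_diffSet hK hL he, mul_zero]
  obtain ⟨C, hC⟩ := hK.exists_lipschitzWith_height he
  let Lc : (W × ℝ × ℝ) ≃L[ℝ] E := L.toContinuousLinearEquiv
  have hLc : LipschitzWith ‖(Lc : (W × ℝ × ℝ) →L[ℝ] E)‖₊ L :=
    (Lc : (W × ℝ × ℝ) →L[ℝ] E).lipschitz
  have hLs : LipschitzWith ‖(Lc.symm : E →L[ℝ] (W × ℝ × ℝ))‖₊ L.symm :=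
    (Lc.symm : E →L[ℝ] (W × ℝ × ℝ)).lipschitz
  have hfst : LipschitzWith 1 fun x : W × ℝ × ℝ => x.1 := LipschitzWith.prod_fst
  have hsnd : LipschitzWith (1 * 1) fun x : W × ℝ × ℝ => x.2.1 :=
    LipschitzWith.prod_fst.comp LipschitzWith.prod_snd
  have h1 := hfst.prodMk (hsnd.prodMk (LipschitzWith.const (0 : ℝ)))
  have hY : LipschitzWith ‖(ContinuousLinearMap.toSpanSingleton ℝ Y).comp
      ((ContinuousLinearMap.snd ℝ ℝ ℝ).comp (ContinuousLinearMap.snd ℝ W (ℝ × ℝ)))‖₊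
      fun x : W × ℝ × ℝ => x.2.2 • Y :=
    ((ContinuousLinearMap.toSpanSingleton ℝ Y).comp
      ((ContinuousLinearMap.snd ℝ ℝ ℝ).comp (ContinuousLinearMap.snd ℝ W (ℝ × ℝ)))).lipschitz
  have hΛ := ((hLc.comp (hfst.prodMk (hsnd.prodMk (hC.comp (hLc.comp h1))))).add hY).comp hLs
  have hvol : volume (L '' (N₀ ∪ N₁)) = 0 := by
    rw [← hL.measurePreserving.measure_preimage_emb
      Lc.toHomeomorph.toMeasurableEquiv.measurableEmbedding,
      preimage_image_eq _ L.injective]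
    exact measure_union_null hN₀v hN₁v
  have hnull := euclideanHausdorffMeasure_image_eq_zero
    (hΛ.lipschitzOnWith (s := L '' (N₀ ∪ N₁))) hvol
  rw [InnerProductSpace.euclideanHausdorffMeasure_eq_volume] at hnull
  refine measure_mono_null ?_ hnull
  rintro x ⟨t, hz, hpos, hzC⟩
  obtain ⟨⟨w, s, r⟩, hwsr⟩ := L.surjective (x + t • Y)
  rw [← hwsr] at hz hzC hpos
  rw [hL.inner_fst_snd] at hpos
  refine ⟨L (w, s, -t), mem_image_of_mem _ ?_, ?_⟩
  · rcases hpos.eq_or_lt with h0 | hpos'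
    · exact Or.inl ⟨mem_univ _, h0.symm, mem_univ _⟩
    · refine Or.inr ⟨hpos', fun hD => hzC ?_⟩
      obtain ⟨s', hs', w', hw'⟩ := exists_smul_sphereChart_eq hK hL he hz
        (by rwa [hL.inner_fst_snd])
      refine ⟨s', hs', w', ?_, hw'⟩
      have h2 := chartInv_smul_sphereChart (K := K) hL w' hs'
      rw [← hw', chartInv] at h2
      simp only [LinearEquiv.symm_apply_apply] at h2
      rwa [← h2]
  · rw [IsFrame.apply_add_smul, hK.add_smul_mem_frontier_iff he] at hz
    simp only [Function.comp_apply, LinearEquiv.symm_apply_apply, hz, hwsr]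
    simp

theorem gauss_lineHits_exitSet (hK : IsSolidCone K) (hL : IsFrame L)
    (he : L (0, 0, 1) ∈ interior K) (Y : E) (hY : Y ∉ K) :
    gauss E (lineHits Y (chartCone K L ∩ exitSet K Y)) +
      gauss E (lineHits Y (chartCone K (flipFrame L) ∩ exitSet K Y)) =
    gauss E (lineHits Y (interior K)) := by
  have he' : flipFrame L (0, 0, 1) ∈ interior K := by rwa [flipFrame_last]
  have hm := (lintegral_coneMap_of_unique hK hL.flipFrame he' Y (hK.measurableSet_exitSet Y)
    (fun c hc z => hK.smul_mem_exitSet_iff hc) (fun x t t' => hK.exitSet_unique)).1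
  rw [← measure_union _ hm]
  · refine measure_congr ?_
    have hnull1 := gauss_absolutelyContinuous (volume_lineHits_diff_chartCone hK hL he Y)
    have hnull2 := gauss_absolutelyContinuous
      (volume_lineHits_diff_chartCone hK hL.flipFrame he' Y)
    have hnull3 : gauss E (frontier (lineHits Y (interior K))) = 0 :=
      gauss_absolutelyContinuous
        ((IsSolidCone.convex_lineHits hK.convex.interior Y).addHaar_frontier volume)
    have h1 := measure_eq_zero_iff_ae_notMem.1 hnull1
    have h2 := measure_eq_zero_iff_ae_notMem.1 hnull2
    have h3 := measure_eq_zero_iff_ae_notMem.1 hnull3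
    filter_upwards [h1, h2, h3] with x hx1 hx2 hx3
    refine propext ⟨fun h => ?_, fun h => ?_⟩
    · by_contra hcon
      refine hx3 (hK.lineHits_diff_subset Y ⟨?_, hcon⟩)
      rcases h with ⟨t, ht⟩ | ⟨t, ht⟩
      · exact ⟨t, (hK.mem_frontier_iff.1 ht.2.1).1⟩
      · exact ⟨t, (hK.mem_frontier_iff.1 ht.2.1).1⟩
    · obtain ⟨t, ht⟩ := hK.lineHits_interior_subset hY h
      rcases le_total 0 ⟪x + t • Y, L (0, 1, 0)⟫ with hs | hs
      · refine Or.inl ⟨t, ?_, ht⟩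
        by_contra hcon
        exact hx1 ⟨t, ht.1, hs, hcon⟩
      · refine Or.inr ⟨t, ?_, ht⟩
        by_contra hcon
        refine hx2 ⟨t, ht.1, ?_, hcon⟩
        rw [flipFrame_middle, inner_neg_right]
        linarith
  · rw [Set.disjoint_left]
    rintro x ⟨t, ht1, ht2⟩ ⟨t', ht1', ht2'⟩
    obtain rfl := hK.exitSet_unique ht2 ht2'
    have h1 := inner_pos_of_mem_chartCone hL ht1
    have h2 := inner_pos_of_mem_chartCone hL.flipFrame ht1'
    rw [flipFrame_middle, inner_neg_right] at h2
    linarith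

theorem IsSolidCone.lineHits_interior_of_mem_interior (hK : IsSolidCone K) {Y : E}
    (hY : Y ∈ interior K) : lineHits Y (interior K) = univ := by
  refine eq_univ_of_forall fun x => ?_
  refine ⟨height K Y x + 1, ?_⟩
  rw [hK.add_smul_mem_interior_iff hY]
  linarith

theorem lineHits_inter_neg_eq_empty (hK : IsSolidCone K) {Y : E} (hY : Y ∉ K) (hY' : -Y ∉ K) :
    lineHits Y (interior K) ∩ -lineHits Y (interior K) = ∅ := by
  rw [eq_empty_iff_forall_notMem]
  rintro x ⟨⟨t, ht⟩, ⟨u, hu⟩⟩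
  have h := hK.interior_add_mem ht (interior_subset hu)
  have h1 : x + t • Y + (-x + u • Y) = (t + u) • Y := by module
  rw [h1] at h
  rcases lt_trichotomy (t + u) 0 with h0 | h0 | h0
  · have h2 : (t + u) • Y = (-(t + u)) • (-Y) := by module
    rw [h2, hK.smul_mem_interior_iff (by linarith)] at h
    exact hY' (interior_subset h)
  · rw [h0, zero_smul] at h
    exact hK.zero_notMem_interior h
  · rw [hK.smul_mem_interior_iff h0] at h
    exact hY (interior_subset h)

theorem gauss_neg (s : Set E) : gauss E (-s) = gauss E s := by
  have h := (LinearIsometryEquiv.neg ℝ (E := E)).measurePreserving_gauss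
  have h2 := h.measure_preimage_emb
    (LinearIsometryEquiv.neg ℝ (E := E)).toHomeomorph.toMeasurableEquiv.measurableEmbedding s
  rw [← h2]
  rfl

/-- The pairs of vectors which span a subspace meeting the interior of `K`. -/
def meetingPairs (K : Set E) : Set (E × E) := {q | ∃ a b : ℝ, a • q.1 + b • q.2 ∈ interior K}

theorem isOpen_meetingPairs (K : Set E) : IsOpen (meetingPairs K) := by
  have : meetingPairs K = ⋃ a : ℝ, ⋃ b : ℝ, (fun q : E × E => a • q.1 + b • q.2) ⁻¹' interior K := by
    ext q
    simp [meetingPairs]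
  rw [this]
  exact isOpen_iUnion fun a => isOpen_iUnion fun b => isOpen_interior.preimage (by fun_prop)

/-- The probability that a random plane through the origin meets the interior of `K`. -/
noncomputable def meetingProb (K : Set E) : ℝ≥0∞ := ((gauss E).prod (gauss E)) (meetingPairs K)

theorem slice_meetingPairs (hK : IsSolidCone K) (Y : E) :
    (fun X => (X, Y)) ⁻¹' meetingPairs K =
      lineHits Y (interior K) ∪ -lineHits Y (interior K) := by
  ext X
  constructor
  · rintro ⟨a, b, h⟩
    simp only at h
    rcases lt_trichotomy a 0 with h0 | rfl | h0
    · refine Or.inr ⟨(-a)⁻¹ * b, ?_⟩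
      rw [← hK.smul_mem_interior_iff (neg_pos.2 h0)]
      convert h using 1
      rw [smul_add, smul_smul, ← mul_assoc, mul_inv_cancel₀ (neg_pos.2 h0).ne', one_mul]
      simp
    · rw [zero_smul, zero_add] at h
      left
      rcases lt_trichotomy b 0 with hb | rfl | hb
      · have : -Y ∈ interior K := by
          rw [← hK.smul_mem_interior_iff (neg_pos.2 hb)]
          simpa using h
        rw [← lineHits_neg, hK.lineHits_interior_of_mem_interior this]
        trivial
      · rw [zero_smul] at h
        exact absurd h hK.zero_notMem_interior
      · rw [hK.smul_mem_interior_iff hb] at h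
        rw [hK.lineHits_interior_of_mem_interior h]
        trivial
    · refine Or.inl ⟨a⁻¹ * b, ?_⟩
      rw [← hK.smul_mem_interior_iff h0]
      convert h using 1
      rw [smul_add, smul_smul, ← mul_assoc, mul_inv_cancel₀ h0.ne', one_mul]
  · rintro (⟨t, ht⟩ | ⟨t, ht⟩)
    · exact ⟨1, t, by simpa using ht⟩
    · exact ⟨-1, t, by simpa using ht⟩

theorem exitSums_eq (hK : IsSolidCone K) (hL : IsFrame L)
    (he : L (0, 0, 1) ∈ interior K) (Y : E) (hY : Y ∉ frontier K) (hY' : -Y ∉ frontier K) :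
    (gauss E (lineHits Y (chartCone K L ∩ exitSet K Y)) +
      gauss E (lineHits Y (chartCone K L ∩ exitSet K (-Y)))) +
    (gauss E (lineHits Y (chartCone K (flipFrame L) ∩ exitSet K Y)) +
      gauss E (lineHits Y (chartCone K (flipFrame L) ∩ exitSet K (-Y)))) =
    gauss E (lineHits Y (interior K) ∪ -lineHits Y (interior K)) := by
  rw [add_add_add_comm]
  have hin : ∀ {Y : E}, Y ∈ K → gauss E (lineHits Y (chartCone K L ∩ exitSet K Y)) +
      gauss E (lineHits Y (chartCone K (flipFrame L) ∩ exitSet K Y)) = 0 := by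
    intro Y h
    rw [hK.exitSet_eq_empty h]
    simp [lineHits]
  have hneg : ∀ B, lineHits Y B = lineHits (-Y) B := fun B => (lineHits_neg Y B).symm
  have hfr : ∀ {Y : E}, Y ∉ frontier K → Y ∈ K → Y ∈ interior K := by
    intro Y h hYK
    by_contra hcon
    exact h (hK.mem_frontier_iff.2 ⟨hYK, hcon⟩)
  have hout := gauss_lineHits_exitSet hK hL he Y
  have hout' := gauss_lineHits_exitSet hK hL he (-Y)
  rw [hneg (chartCone K L ∩ exitSet K (-Y)), hneg (chartCone K (flipFrame L) ∩ exitSet K (-Y))]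
  by_cases h : Y ∈ K
  · have h1 := hfr hY h
    rw [hin h, zero_add, hout' (hK.neg_notMem h1), ← hneg, hK.lineHits_interior_of_mem_interior h1,
      univ_union]
  · by_cases h' : -Y ∈ K
    · have h1 := hfr hY' h'
      rw [hin h', add_zero, hout h, hneg, hK.lineHits_interior_of_mem_interior h1, univ_union]
    · rw [hout h, hout' h', ← hneg, measure_union, gauss_neg]
      · rw [Set.disjoint_iff_inter_eq_empty]
        exact lineHits_inter_neg_eq_empty hK h h'
      · exact (IsSolidCone.isOpen_lineHits isOpen_interior Y).neg.measurableSet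

theorem frontier_inter_sphere_eq (hK : IsSolidCone K) (hL : IsFrame L)
    (he : L (0, 0, 1) ∈ interior K) :
    frontier K ∩ Metric.sphere 0 1 =
      range (sphereChart K L) ∪ (range (sphereChart K (flipFrame L)) ∪
        {z | z ∈ frontier K ∧ ‖z‖ = 1 ∧ ⟪z, L (0, 1, 0)⟫ = 0}) := by
  have he' : flipFrame L (0, 0, 1) ∈ interior K := by rwa [flipFrame_last]
  ext z
  rw [mem_inter_iff, mem_sphere_zero_iff_norm]
  have hone : ∀ {L : (W × ℝ × ℝ) ≃ₗ[ℝ] E}, IsFrame L → L (0, 0, 1) ∈ interior K →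
      z ∈ frontier K → ‖z‖ = 1 → 0 < ⟪z, L (0, 1, 0)⟫ → z ∈ range (sphereChart K L) := by
    intro L hL he hz hz1 hpos
    obtain ⟨s, hs, w, rfl⟩ := exists_smul_sphereChart_eq hK hL he hz hpos
    rw [norm_smul, norm_sphereChart hL, mul_one, Real.norm_of_nonneg hs.le] at hz1
    exact ⟨w, by rw [hz1, one_smul]⟩
  constructor
  · rintro ⟨hz, hz1⟩
    rcases lt_trichotomy ⟪z, L (0, 1, 0)⟫ 0 with h | h | h
    · refine Or.inr (Or.inl (hone hL.flipFrame he' hz hz1 ?_))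
      rw [flipFrame_middle, inner_neg_right]
      linarith
    · exact Or.inr (Or.inr ⟨hz, hz1, h⟩)
    · exact Or.inl (hone hL he hz hz1 h)
  · rintro (⟨w, rfl⟩ | ⟨w, rfl⟩ | ⟨hz, hz1, -⟩)
    · exact ⟨sphereChart_mem_frontier hK hL he w, norm_sphereChart hL w⟩
    · exact ⟨sphereChart_mem_frontier hK hL.flipFrame he' w, norm_sphereChart hL.flipFrame w⟩
    · exact ⟨hz, hz1⟩

theorem measure_frontier_inter_sphere (hK : IsSolidCone K) (hL : IsFrame L)
    (he : L (0, 0, 1) ∈ interior K) :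
    μHE[finrank ℝ W] (frontier K ∩ Metric.sphere 0 1) =
      μHE[finrank ℝ W] (range (sphereChart K L)) +
        μHE[finrank ℝ W] (range (sphereChart K (flipFrame L))) := by
  have he' : flipFrame L (0, 0, 1) ∈ interior K := by rwa [flipFrame_last]
  have hm : MeasurableSet (range (sphereChart K (flipFrame L))) := by
    rw [← image_univ]
    exact MeasurableSet.univ.image_of_continuousOn_injOn
      (continuous_sphereChart hK hL.flipFrame he').continuousOn
      (sphereChart_injective hL.flipFrame).injOn
  rw [frontier_inter_sphere_eq hK hL he, ← union_assoc, ← measure_union _ hm]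
  · refine le_antisymm ((measure_union_le _ _).trans ?_) (measure_mono subset_union_left)
    rw [euclideanHausdorffMeasure_equator hK hL he, add_zero]
  · rw [Set.disjoint_left]
    rintro _ ⟨w, rfl⟩ ⟨w', hw'⟩
    have h1 := inner_sphereChart_pos (K := K) hL w
    have h2 := inner_sphereChart_pos (K := K) hL.flipFrame w'
    rw [hw', flipFrame_middle, inner_neg_right] at h2
    linarith

/-- The Crofton formula for boundaries of convex cones. -/
theorem croftonConst_mul_measure_frontier (hK : IsSolidCone K) (hL : IsFrame L)
    (he : L (0, 0, 1) ∈ interior K) :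
    croftonConst (finrank ℝ W) (L (0, 1, 0)) (L (0, 0, 1)) *
      μHE[finrank ℝ W] (frontier K ∩ Metric.sphere 0 1) = meetingProb K := by
  have he' : flipFrame L (0, 0, 1) ∈ interior K := by rwa [flipFrame_last]
  have hc : croftonConst (finrank ℝ W) (L (0, 1, 0)) (L (0, 0, 1)) =
      croftonConst (finrank ℝ W) (flipFrame L (0, 1, 0)) (flipFrame L (0, 0, 1)) := by
    rw [← croftonConst_map _ (hL.rotation hL.flipFrame), hL.rotation_apply, hL.rotation_apply]
  rw [measure_frontier_inter_sphere hK hL he, mul_add,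
    croftonConst_mul_range_sphereChart hK hL he, hc,
    croftonConst_mul_range_sphereChart hK hL.flipFrame he']
  rw [meetingProb, Measure.prod_apply_symm (isOpen_meetingPairs K).measurableSet,
    lintegral_gauss _ (measurable_measure_prodMk_right (isOpen_meetingPairs K).measurableSet),
    ← lintegral_add_left']
  · refine lintegral_congr_ae ?_
    have hnull : volume (frontier K) = 0 := hK.convex.addHaar_frontier volume
    have h1 := measure_eq_zero_iff_ae_notMem.1 hnull
    have hnull' : volume (-frontier K) = 0 := by rw [Measure.measure_neg, hnull]
    have h2 := measure_eq_zero_iff_ae_notMem.1 hnull'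
    filter_upwards [h1, h2] with Y hY hY'
    rw [lintegral_coneMap hK hL he, lintegral_coneMap hK hL.flipFrame he', ← mul_add,
      exitSums_eq hK hL he Y hY hY', slice_meetingPairs hK]
  · refine (Measurable.mul measurable_gaussDensity ?_).aemeasurable
    exact (Measurable.lintegral_prod_left' (μ := volume.restrict (coneDomain K L))
      (measurable_crofton_integrand hK hL he))

end CroftonTotal

section MeetingProbability

open scoped ENNReal NNReal Topology Pointwise
open Set Filter Module

variable {E : Type*} [NormedAddCommGroup E] [InnerProductSpace ℝ E]

theorem isSolidCone_halfSpace {e : E} (he : e ≠ 0) : IsSolidCone {x : E | 0 ≤ ⟪x, e⟫} where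
  isClosed := isClosed_le continuous_const (by fun_prop)
  convex := by
    intro x hx y hy a b ha hb _
    change 0 ≤ ⟪a • x + b • y, e⟫
    rw [inner_add_left, inner_smul_left, inner_smul_left]
    exact add_nonneg (mul_nonneg ha hx) (mul_nonneg hb hy)
  smul_mem c hc x hx := by
    change 0 ≤ ⟪c • x, e⟫
    rw [inner_smul_left]
    exact mul_nonneg hc.le hx
  nonempty_interior := by
    refine ⟨e, interior_maximal (s := {x : E | 0 ≤ ⟪x, e⟫}) (t := {x : E | 0 < ⟪x, e⟫})
      (fun x (hx : 0 < ⟪x, e⟫) => (hx.le : 0 ≤ ⟪x, e⟫)) (isOpen_lt continuous_const (by fun_prop)) ?_⟩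
    exact real_inner_self_pos.2 he
  ne_univ := by
    intro h
    have h1 : -e ∈ {x : E | 0 ≤ ⟪x, e⟫} := h ▸ mem_univ _
    have h2 : 0 ≤ ⟪-e, e⟫ := h1
    rw [inner_neg_left] at h2
    linarith [real_inner_self_pos.2 he]

theorem mem_interior_halfSpace {e x : E} (h : 0 < ⟪x, e⟫) :
    x ∈ interior {x : E | 0 ≤ ⟪x, e⟫} :=
  interior_maximal (s := {x : E | 0 ≤ ⟪x, e⟫}) (t := {x : E | 0 < ⟪x, e⟫})
      (fun x (hx : 0 < ⟪x, e⟫) => (hx.le : 0 ≤ ⟪x, e⟫)) (isOpen_lt continuous_const (by fun_prop)) h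

theorem frontier_halfSpace_eq {e : E} (he : e ≠ 0) :
    frontier {x : E | 0 ≤ ⟪x, e⟫} = {x | ⟪x, e⟫ = 0} := by
  have hH := isSolidCone_halfSpace he
  ext x
  rw [hH.mem_frontier_iff]
  constructor
  · rintro ⟨h1, h2⟩
    by_contra hne
    exact h2 (mem_interior_halfSpace (lt_of_le_of_ne h1 (Ne.symm hne)))
  · intro h
    have h0 : ⟪x, e⟫ = 0 := h
    refine ⟨h0.ge, fun hint => hH.neg_notMem hint ?_⟩
    change 0 ≤ ⟪-x, e⟫
    rw [inner_neg_left, h0, neg_zero]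

variable [FiniteDimensional ℝ E] [MeasurableSpace E] [BorelSpace E]

theorem meetingProb_mono {K H : Set E} (h : K ⊆ H) : meetingProb K ≤ meetingProb H :=
  measure_mono fun _ ⟨a, b, hab⟩ => ⟨a, b, interior_mono h hab⟩

theorem meetingProb_halfSpace {e : E} (he : e ≠ 0) : meetingProb {x : E | 0 ≤ ⟪x, e⟫} = 1 := by
  have hvol : volume {x : E | ⟪x, e⟫ = 0} = 0 := by
    rw [← frontier_halfSpace_eq he]
    exact (isSolidCone_halfSpace he).convex.addHaar_frontier volume
  have hnull : ((gauss E).prod (gauss E)) ({x : E | ⟪x, e⟫ = 0} ×ˢ univ) = 0 := by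
    rw [Measure.prod_prod, gauss_absolutelyContinuous hvol, zero_mul]
  rw [meetingProb, ← prob_compl_eq_zero_iff (isOpen_meetingPairs _).measurableSet]
  refine measure_mono_null ?_ hnull
  intro q hq
  refine ⟨?_, mem_univ _⟩
  by_contra hne
  apply hq
  rcases lt_or_gt_of_ne hne with h | h
  · refine ⟨-1, 0, mem_interior_halfSpace ?_⟩
    rw [zero_smul, add_zero, inner_smul_left]
    simpa using h
  · exact ⟨1, 0, mem_interior_halfSpace (by simpa using h)⟩

theorem meetingProb_ne_zero {K : Set E} (hK : IsSolidCone K) : meetingProb K ≠ 0 := by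
  obtain ⟨x, hx⟩ := hK.nonempty_interior
  exact ((isOpen_meetingPairs K).measure_pos _ ⟨(x, 0), 1, 0, by simpa using hx⟩).ne'

theorem meetingProb_lt {K H : Set E} (hK : IsSolidCone K) (hKH : K ⊆ H) {x y : E}
    (hx : x ∈ interior H) (hxy : ∀ a b : ℝ, a • x + b • y ∈ K → a = 0 ∧ b = 0) :
    meetingProb K < meetingProb H := by
  have hsub : meetingPairs K ⊆ meetingPairs H :=
    fun _ ⟨a, b, hab⟩ => ⟨a, b, interior_mono hKH hab⟩
  have hnhds : meetingPairs H \ meetingPairs K ∈ 𝓝 (x, y) := by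
    have h1 : ∀ᶠ q in 𝓝 (x, y), q ∈ meetingPairs H :=
      (isOpen_meetingPairs H).mem_nhds ⟨1, 0, by simpa using hx⟩
    have h2 : ∀ᶠ q : E × E in 𝓝 (x, y), ∀ c ∈ Metric.sphere (0 : ℝ × ℝ) 1,
        c.1 • q.1 + c.2 • q.2 ∉ K := by
      refine (isCompact_sphere _ _).eventually_forall_of_forall_eventually fun c hc => ?_
      have hcont : Continuous fun z : (E × E) × (ℝ × ℝ) => z.2.1 • z.1.1 + z.2.2 • z.1.2 := by
        fun_prop
      refine (hK.isClosed.isOpen_compl.preimage hcont).mem_nhds ?_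
      intro hmem
      obtain ⟨ha, hb⟩ := hxy _ _ hmem
      have : c = 0 := Prod.ext ha hb
      simp [this] at hc
    filter_upwards [h1, h2] with q hq1 hq2
    refine ⟨hq1, ?_⟩
    rintro ⟨a, b, hab⟩
    have hne : ((a, b) : ℝ × ℝ) ≠ 0 := by
      rintro h
      obtain ⟨rfl, rfl⟩ := Prod.mk_eq_zero.1 h
      simp [hK.zero_notMem_interior] at hab
    have hpos : 0 < ‖((a, b) : ℝ × ℝ)‖⁻¹ := inv_pos.2 (norm_pos_iff.2 hne)
    refine hq2 (‖((a, b) : ℝ × ℝ)‖⁻¹ • (a, b)) ?_ ?_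
    · rw [mem_sphere_zero_iff_norm]
      exact norm_smul_inv_norm hne
    · have := hK.smul_mem _ hpos _ (interior_subset hab)
      rw [smul_add, smul_smul, smul_smul] at this
      exact this
  have hpos : 0 < ((gauss E).prod (gauss E)) (meetingPairs H \ meetingPairs K) :=
    Measure.measure_pos_of_mem_nhds _ hnhds
  have hadd := measure_sdiff_add_inter (μ := (gauss E).prod (gauss E)) (s := meetingPairs H)
    (isOpen_meetingPairs K).measurableSet
  rw [inter_eq_self_of_subset_right hsub] at hadd
  rw [meetingProb, meetingProb, ← hadd, add_comm]
  exact ENNReal.lt_add_right (measure_ne_top _ _) hpos.ne'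

theorem meetingProb_prod {U : Type*} [NormedAddCommGroup U] [InnerProductSpace ℝ U]
    [FiniteDimensional ℝ U] [MeasurableSpace U] [BorelSpace U] (L : (U × ℝ) ≃ₗ[ℝ] E)
    (hL : ∀ u t, ‖L (u, t)‖ ^ 2 = ‖u‖ ^ 2 + ‖t‖ ^ 2) (D : Set U) :
    meetingProb ((fun x => (L.symm x).1) ⁻¹' D) = meetingProb D := by
  have hcont : Continuous L.symm := L.toContinuousLinearEquiv.symm.continuous
  have hopen : IsOpenMap fun x => (L.symm x).1 :=
    isOpenMap_fst.comp L.toContinuousLinearEquiv.symm.toHomeomorph.isOpenMap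
  have hint : interior ((fun x => (L.symm x).1) ⁻¹' D) = (fun x => (L.symm x).1) ⁻¹' interior D :=
    (hopen.preimage_interior_eq_interior_preimage (continuous_fst.comp hcont) D).symm
  have hmp := measurePreserving_fst_symm_gauss L hL
  have hpre : meetingPairs ((fun x => (L.symm x).1) ⁻¹' D) =
      Prod.map (fun x => (L.symm x).1) (fun x => (L.symm x).1) ⁻¹' meetingPairs D := by
    ext q
    simp [meetingPairs, hint]
  rw [meetingProb, hpre, (hmp.prod hmp).measure_preimage
    (isOpen_meetingPairs D).measurableSet.nullMeasurableSet]
  rfl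

theorem exists_unit_orthogonal {e : E} (hd : 2 ≤ finrank ℝ E) : ∃ ξ : E, ‖ξ‖ = 1 ∧ ⟪ξ, e⟫ = 0 := by
  set S : Submodule ℝ E := Submodule.span ℝ {e}
  have h2 : Sᗮ ≠ ⊥ := by
    intro h
    have := S.finrank_add_finrank_orthogonal
    have h1 : finrank ℝ S ≤ 1 := by simpa using finrank_span_le_card (R := ℝ) ({e} : Set E)
    rw [h, finrank_bot] at this
    omega
  obtain ⟨v, hv, hv0⟩ := Submodule.exists_mem_ne_zero_of_ne_bot h2
  refine ⟨‖v‖⁻¹ • v, norm_smul_inv_norm hv0, ?_⟩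
  rw [inner_smul_left, (Submodule.mem_orthogonal' _ _).1 hv _ (Submodule.mem_span_singleton_self e),
    mul_zero]

theorem IsSolidCone.exists_isFrame_mem_interior {k : ℕ} (hd : finrank ℝ E = k + 2) {K : Set E}
    (hK : IsSolidCone K) : ∃ L : (EuclideanSpace ℝ (Fin k) × ℝ × ℝ) ≃ₗ[ℝ] E, IsFrame L ∧
      L (0, 0, 1) ∈ interior K := by
  obtain ⟨x, hx⟩ := hK.nonempty_interior
  have hx0 : x ≠ 0 := fun h => hK.zero_notMem_interior (h ▸ hx)
  obtain ⟨ξ, hξ, hξx⟩ := exists_unit_orthogonal (e := ‖x‖⁻¹ • x) (by omega : 2 ≤ finrank ℝ E)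
  obtain ⟨L, hL, -, he⟩ := exists_isFrame (W := EuclideanSpace ℝ (Fin k)) (by simpa using hd) hξ
    (norm_smul_inv_norm hx0) hξx
  refine ⟨L, hL, ?_⟩
  rw [he, RCLike.ofReal_real_eq_id, id]
  exact (hK.smul_mem_interior_iff (inv_pos.2 (norm_pos_iff.2 hx0))).2 hx

/-- The normalized area of the spherical boundary of a convex cone is a meeting probability. -/
theorem areaRatio_frontier {k : ℕ} (hd : finrank ℝ E = k + 2) {K : Set E} (hK : IsSolidCone K) :
    areaRatio k (frontier K ∩ Metric.sphere 0 1) = meetingProb K := by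
  obtain ⟨L, hL, he⟩ := hK.exists_isFrame_mem_interior hd
  set e := L (0, 0, 1) with he_def
  have hnorm : ‖e‖ = 1 := by
    have := hL 0 0 1
    rw [← he_def] at this
    have h1 : ‖e‖ ^ 2 = 1 ^ 2 := by rw [this]; simp
    exact (sq_eq_sq₀ (norm_nonneg _) zero_le_one).1 h1
  have he0 : e ≠ 0 := by
    rintro h
    simp [h] at hnorm
  have hH := isSolidCone_halfSpace he0
  have heH : L (0, 0, 1) ∈ interior {x : E | 0 ≤ ⟪x, e⟫} :=
    mem_interior_halfSpace (real_inner_self_pos.2 he0)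
  have h1 := croftonConst_mul_measure_frontier hK hL he
  have h2 := croftonConst_mul_measure_frontier hH hL heH
  rw [meetingProb_halfSpace he0, frontier_halfSpace_eq he0] at h2
  rw [finrank_euclideanSpace_fin] at h1 h2
  have hS : finrank ℝ (EuclideanSpace ℝ (Fin (k + 1))) =
      finrank ℝ (Submodule.span ℝ {e})ᗮ := by
    have h3 := (Submodule.span ℝ {e}).finrank_add_finrank_orthogonal
    rw [finrank_span_singleton he0] at h3
    rw [finrank_euclideanSpace_fin]
    omega
  let ι := (stdOrthonormalBasis ℝ (EuclideanSpace ℝ (Fin (k + 1)))).equiv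
    (stdOrthonormalBasis ℝ (Submodule.span ℝ {e})ᗮ) (finCongr hS)
  let j : EuclideanSpace ℝ (Fin (k + 1)) →ₗᵢ[ℝ] E :=
    (Submodule.span ℝ {e})ᗮ.subtypeₗᵢ.comp ι.toLinearIsometry
  have himg : j '' Metric.sphere 0 1 = {x : E | ⟪x, e⟫ = 0} ∩ Metric.sphere 0 1 := by
    ext x
    constructor
    · rintro ⟨u, hu, rfl⟩
      refine ⟨?_, ?_⟩
      · exact (Submodule.mem_orthogonal' _ _).1 (ι u).2 e (Submodule.mem_span_singleton_self e)
      · rw [mem_sphere_zero_iff_norm, j.norm_map]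
        simpa using hu
    · rintro ⟨hx, hx1⟩
      have hmem : x ∈ (Submodule.span ℝ {e})ᗮ := by
        rw [Submodule.mem_orthogonal_singleton_iff_inner_left]
        exact hx
      have hjx : j (ι.symm ⟨x, hmem⟩) = x := by simp [j]
      refine ⟨ι.symm ⟨x, hmem⟩, ?_, hjx⟩
      rw [mem_sphere_zero_iff_norm, ← j.norm_map, hjx]
      simpa using hx1
  rw [← himg, j.isometry.euclideanHausdorffMeasure_image] at h2
  have hc0 : croftonConst k (L (0, 1, 0)) (L (0, 0, 1)) ≠ 0 := by
    rintro h
    simp [h] at h2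
  have hct : croftonConst k (L (0, 1, 0)) (L (0, 0, 1)) ≠ ⊤ := by
    intro h
    rw [h] at h2
    rcases eq_or_ne (μHE[k] (Metric.sphere (0 : EuclideanSpace ℝ (Fin (k + 1))) 1)) 0 with h0 | h0
    · simp [h0] at h2
    · rw [ENNReal.top_mul h0] at h2
      exact ENNReal.top_ne_one h2
  rw [areaRatio, ← ENNReal.mul_div_mul_left _ _ hc0 hct, h1, h2, div_one]

end MeetingProbability

section BlowUp

open scoped ENNReal NNReal Topology Pointwise
open Set Filter Module

theorem IsPreconnected.exists_mem_frontier {X : Type*} [TopologicalSpace X] {t u : Set X}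
    (ht : IsPreconnected t) (h : (t ∩ u).Nonempty) (h' : (t ∩ uᶜ).Nonempty) :
    ∃ y ∈ t, y ∈ frontier u := by
  by_contra! hcon
  obtain ⟨a, hat, hau⟩ := h
  obtain ⟨b, hbt, hbu⟩ := h'
  have hcover : t ⊆ interior u ∪ (closure u)ᶜ := fun y hy => by
    by_contra hy'
    rw [mem_union, not_or, notMem_compl_iff] at hy'
    exact hcon y hy ⟨hy'.2, hy'.1⟩
  obtain ⟨y, -, hy, hy'⟩ := ht _ _ isOpen_interior isClosed_closure.isOpen_compl hcover
    ⟨a, hat, (hcover hat).resolve_right fun h => h (subset_closure hau)⟩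
    ⟨b, hbt, (hcover hbt).resolve_left fun h => hbu (interior_subset h)⟩
  exact hy' (subset_closure (interior_subset hy))

section Normed

variable {E : Type*} [NormedAddCommGroup E] [NormedSpace ℝ E] {K : Set E}

theorem isSolidCone_of_smul_mem_frontier (hc : IsClosed K) (hconv : Convex ℝ K)
    (hne : (interior K).Nonempty) (hK : K ≠ univ)
    (hfr : ∀ c : ℝ, 0 < c → ∀ x ∈ frontier K, c • x ∈ frontier K) : IsSolidCone K where
  isClosed := hc
  convex := hconv
  nonempty_interior := hne
  ne_univ := hK
  smul_mem c hc0 := by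
    have hint : ∀ x ∈ interior K, c • x ∈ K := by
      intro x hx
      by_contra hcon
      obtain ⟨y, hy, hyf⟩ := (convex_segment x (c • x)).isPreconnected.exists_mem_frontier
        (u := K) ⟨x, left_mem_segment ℝ _ _, interior_subset hx⟩
        ⟨c • x, right_mem_segment ℝ _ _, hcon⟩
      obtain ⟨a, b, ha, hb, hab, rfl⟩ := hy
      have hpos : 0 < a + b * c := by
        rcases ha.eq_or_lt with rfl | ha
        · rw [zero_add] at hab
          rw [hab]
          linarith
        · positivity
      have := hfr _ (inv_pos.2 hpos) _ hyf
      have h1 : (a + b * c)⁻¹ • (a • x + b • c • x) = x := by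
        rw [smul_smul b, ← add_smul, smul_smul, inv_mul_cancel₀ hpos.ne', one_smul]
      rw [h1] at this
      exact this.2 hx
    intro x hx
    have hx' : x ∈ closure (interior K) := by
      rw [hconv.closure_interior_eq_closure_of_nonempty_interior hne]
      exact subset_closure hx
    exact closure_minimal (t := (fun y => c • y) ⁻¹' K) hint (hc.preimage (by fun_prop)) hx'

/-- The tangent cone at the boundary point `p` of the convex cone `K`. -/
def blowUp (K : Set E) (p : E) : Set E := closure (lineHits p (interior K))

variable {p : E}

theorem IsSolidCone.interior_blowUp (hK : IsSolidCone K) (p : E) :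
    interior (blowUp K p) = lineHits p (interior K) := by
  have ho := IsSolidCone.isOpen_lineHits (isOpen_interior (s := K)) p
  obtain ⟨x, hx⟩ := hK.nonempty_interior
  rw [blowUp, (IsSolidCone.convex_lineHits hK.convex.interior
    p).interior_closure_eq_interior_of_nonempty_interior, ho.interior_eq]
  rw [ho.interior_eq]
  exact ⟨x, 0, by simpa using hx⟩

theorem IsSolidCone.subset_blowUp (hK : IsSolidCone K) (p : E) : K ⊆ blowUp K p := by
  intro x hx
  have hx' : x ∈ closure (interior K) := by
    rw [hK.convex.closure_interior_eq_closure_of_nonempty_interior hK.nonempty_interior]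
    exact subset_closure hx
  have hsub : interior K ⊆ lineHits p (interior K) := fun y hy => ⟨0, by simpa using hy⟩
  exact closure_mono hsub hx'

theorem add_smul_mem_blowUp (t : ℝ) {x : E} (hx : x ∈ blowUp K p) : x + t • p ∈ blowUp K p := by
  refine map_mem_closure (f := fun x => x + t • p) (by fun_prop) hx ?_
  rintro y ⟨u, hu⟩
  refine ⟨u - t, ?_⟩
  have : y + t • p + (u - t) • p = y + u • p := by module
  rwa [this]

theorem add_smul_mem_blowUp_iff (t : ℝ) {x : E} : x + t • p ∈ blowUp K p ↔ x ∈ blowUp K p := by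
  refine ⟨fun h => ?_, add_smul_mem_blowUp t⟩
  simpa using add_smul_mem_blowUp (-t) h

end Normed

variable {E : Type*} [NormedAddCommGroup E] [InnerProductSpace ℝ E] [FiniteDimensional ℝ E]
  {K : Set E} {p : E}

theorem isSolidCone_blowUp (hK : IsSolidCone K) (hp : p ∈ frontier K) :
    IsSolidCone (blowUp K p) where
  isClosed := isClosed_closure
  convex := (IsSolidCone.convex_lineHits hK.convex.interior p).closure
  smul_mem c hc x hx := by
    refine map_mem_closure (f := fun x => c • x) (by fun_prop) hx ?_
    rintro y ⟨u, hu⟩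
    refine ⟨c * u, ?_⟩
    have := (hK.smul_mem_interior_iff hc).2 hu
    rwa [smul_add, smul_smul] at this
  nonempty_interior := by
    obtain ⟨x, hx⟩ := hK.nonempty_interior
    rw [hK.interior_blowUp]
    exact ⟨x, 0, by simpa using hx⟩
  ne_univ := by
    obtain ⟨ν, hν0, hν, hνp⟩ := hK.exists_supporting hp
    intro h
    have h1 : blowUp K p ⊆ {x | ⟪x, ν⟫ ≤ 0} := by
      refine closure_minimal ?_ (isClosed_le (by fun_prop) continuous_const)
      rintro x ⟨t, ht⟩
      have := hν _ (interior_subset ht)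
      rw [inner_add_left, inner_smul_left, hνp, mul_zero, add_zero] at this
      exact this
    have h2 : ⟪ν, ν⟫ ≤ 0 := h1 (h ▸ mem_univ ν)
    exact absurd h2 (not_le.2 (real_inner_self_pos.2 hν0))

theorem posTangentConeAt_frontier_subset (hK : IsSolidCone K) (hp : p ∈ frontier K) :
    posTangentConeAt (frontier K) p ⊆ frontier (blowUp K p) := by
  have hH := isSolidCone_blowUp hK hp
  have hpK := (hK.mem_frontier_iff.1 hp).1
  intro v hv
  obtain ⟨α, l, hl, c, d, hd, hmem, hcd⟩ := exists_fun_of_mem_tangentConeAt hv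
  rw [hH.mem_frontier_iff]
  constructor
  · refine hH.isClosed.mem_of_tendsto hcd (hmem.mono fun a ha => ?_)
    have h1 := hK.smul_mem' (c a).2 (hK.mem_frontier_iff.1 ha).1
    have h2 := add_smul_mem_blowUp (p := p) (-(c a : ℝ)) (hK.subset_blowUp p h1)
    convert h2 using 1
    change (c a : ℝ) • d a = (c a : ℝ) • (p + d a) + -(c a : ℝ) • p
    module
  · intro hint
    have hv0 : v ≠ 0 := fun h => hH.zero_notMem_interior (h ▸ hint)
    rw [hK.interior_blowUp] at hint
    obtain ⟨t, ht⟩ := hint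
    have h1 : ∀ᶠ a in l, c a • d a + t • p ∈ interior K :=
      (hcd.add_const _).eventually (isOpen_interior.mem_nhds ht)
    have hvpos : 0 < ‖v‖ := norm_pos_iff.2 hv0
    have h2 : ∀ᶠ a in l, ‖v‖ / 2 < ‖c a • d a‖ :=
      hcd.norm.eventually (lt_mem_nhds (by linarith))
    have h3 : ∀ᶠ a in l, |t| * ‖d a‖ < ‖v‖ / 2 := by
      have := hd.norm.const_mul |t|
      rw [norm_zero, mul_zero] at this
      exact this.eventually (gt_mem_nhds (by linarith))
    obtain ⟨a, ha1, ha2, ha3, ha4⟩ := (h1.and (h2.and (h3.and hmem))).exists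
    have hca : |t| < c a := by
      by_contra! hle
      have h4 : ‖c a • d a‖ = (c a : ℝ) * ‖d a‖ := by
        change ‖(c a : ℝ) • d a‖ = _
        rw [norm_smul, Real.norm_of_nonneg (c a).coe_nonneg]
      have h5 := mul_le_mul_of_nonneg_right hle (norm_nonneg (d a))
      linarith
    have hct : 0 ≤ (c a : ℝ) - t := by linarith [le_abs_self t]
    have h6 := hK.interior_add_mem ha1 (hK.smul_mem' hct hpK)
    have h7 : c a • d a + t • p + ((c a : ℝ) - t) • p = (c a : ℝ) • (p + d a) := by
      change (c a : ℝ) • d a + t • p + ((c a : ℝ) - t) • p = (c a : ℝ) • (p + d a)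
      module
    rw [h7, hK.smul_mem_interior_iff ((abs_nonneg t).trans_lt hca)] at h6
    exact (hK.mem_frontier_iff.1 ha4).2 h6

theorem exists_frontier_near_ray (hK : IsSolidCone K) (hp : p ∈ frontier K) {v : E}
    (hv : v ∈ frontier (blowUp K p)) {ε : ℝ} (hε : 0 < ε) (m : ℕ) :
    ∃ N : ℕ, m < N ∧ ∃ y ∈ frontier K, ‖y - (v + (N : ℝ) • p)‖ < ε := by
  have hH := isSolidCone_blowUp hK hp
  have hpK := (hK.mem_frontier_iff.1 hp).1
  obtain ⟨hvH, hvint⟩ := hH.mem_frontier_iff.1 hv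
  obtain ⟨u, ⟨t, ht⟩, hu⟩ := Metric.mem_closure_iff.1 hvH ε hε
  obtain ⟨N₀, hN₀⟩ := exists_nat_ge t
  set N := max (m + 1) N₀ with hN
  have hNt : t ≤ N := hN₀.trans (by exact_mod_cast le_max_right _ _)
  refine ⟨N, lt_of_lt_of_le (Nat.lt_succ_self m) (le_max_left _ _), ?_⟩
  have huK : u + (N : ℝ) • p ∈ K := by
    have := hK.add_mem (interior_subset ht) (hK.smul_mem' (sub_nonneg.2 hNt) hpK)
    convert this using 1
    module
  have hvK : v + (N : ℝ) • p ∉ interior K := fun h => hvint (by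
    rw [hK.interior_blowUp]
    exact ⟨N, h⟩)
  by_cases hvK' : v + (N : ℝ) • p ∈ K
  · exact ⟨_, hK.mem_frontier_iff.2 ⟨hvK', hvK⟩, by simpa using hε⟩
  · obtain ⟨y, hy, hyf⟩ := (convex_segment (u + (N : ℝ) • p)
      (v + (N : ℝ) • p)).isPreconnected.exists_mem_frontier
      (u := K) ⟨_, left_mem_segment ℝ _ _, huK⟩ ⟨_, right_mem_segment ℝ _ _, hvK'⟩
    refine ⟨y, hyf, ?_⟩
    obtain ⟨a, b, ha, hb, hab, rfl⟩ := hy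
    have h1 : a • (u + (N : ℝ) • p) + b • (v + (N : ℝ) • p) - (v + (N : ℝ) • p) =
        a • (u - v) := by
      have : b = 1 - a := by linarith
      rw [this]
      module
    rw [h1, norm_smul, Real.norm_of_nonneg ha]
    rw [dist_eq_norm, norm_sub_rev] at hu
    calc a * ‖u - v‖ ≤ 1 * ‖u - v‖ := by
          refine mul_le_mul_of_nonneg_right ?_ (norm_nonneg _)
          linarith
      _ < ε := by rwa [one_mul]

theorem frontier_blowUp_subset (hK : IsSolidCone K) (hp : p ∈ frontier K) :
    frontier (blowUp K p) ⊆ posTangentConeAt (frontier K) p := by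
  intro v hv
  have h := fun m : ℕ => exists_frontier_near_ray hK hp hv
    (Nat.one_div_pos_of_nat (α := ℝ) (n := m)) m
  choose N hN y hy hyN using h
  have hpos : ∀ m, (0 : ℝ) < N m := fun m => by exact_mod_cast (Nat.zero_le m).trans_lt (hN m)
  have hlim : Tendsto (fun m => y m - (N m : ℝ) • p) atTop (𝓝 v) := by
    have h0 : Tendsto (fun m => y m - (v + (N m : ℝ) • p)) atTop (𝓝 0) :=
      squeeze_zero_norm (fun m => (hyN m).le) tendsto_one_div_add_atTop_nhds_zero_nat
    have h1 := h0.add_const v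
    rw [zero_add] at h1
    refine h1.congr fun m => ?_
    abel
  have hNlim : Tendsto (fun m => (N m : ℝ)) atTop atTop :=
    tendsto_natCast_atTop_atTop.comp (tendsto_atTop_mono (fun m => (hN m).le) tendsto_id)
  refine mem_tangentConeAt_of_seq atTop (fun m => (N m : ℝ≥0))
    (fun m => (N m : ℝ)⁻¹ • (y m - (N m : ℝ) • p)) ?_ ?_ ?_
  · have := hNlim.inv_tendsto_atTop.smul hlim
    rwa [zero_smul] at this
  · refine Eventually.of_forall fun m => ?_
    have h1 : p + (N m : ℝ)⁻¹ • (y m - (N m : ℝ) • p) = (N m : ℝ)⁻¹ • y m := by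
      rw [smul_sub, smul_smul, inv_mul_cancel₀ (hpos m).ne', one_smul]
      abel
    rw [h1]
    exact (hK.smul_mem_frontier_iff (inv_pos.2 (hpos m))).2 (hy m)
  · refine hlim.congr fun m => ?_
    change _ = ((N m : ℝ≥0) : ℝ) • ((N m : ℝ)⁻¹ • (y m - (N m : ℝ) • p))
    rw [NNReal.coe_natCast, smul_smul, mul_inv_cancel₀ (hpos m).ne', one_smul]

/-- The tangent cone of the boundary of a convex cone is the boundary of the blow-up. -/
theorem posTangentConeAt_frontier (hK : IsSolidCone K) (hp : p ∈ frontier K) :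
    posTangentConeAt (frontier K) p = frontier (blowUp K p) :=
  (posTangentConeAt_frontier_subset hK hp).antisymm (frontier_blowUp_subset hK hp)

theorem IsSolidCone.subset_of_neg_mem (hK : IsSolidCone K) (hp : p ∈ K) (hp' : -p ∈ K) :
    blowUp K p ⊆ K := by
  refine closure_minimal ?_ hK.isClosed
  rintro x ⟨t, ht⟩
  have h : -(t • p) ∈ K := by
    rcases le_total 0 t with h0 | h0
    · have := hK.smul_mem' h0 hp'
      rwa [smul_neg] at this
    · have := hK.smul_mem' (neg_nonneg.2 h0) hp
      rwa [neg_smul] at this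
  simpa using hK.add_mem (interior_subset ht) h

/-- The largest linear subspace contained in a convex cone. -/
def IsSolidCone.lineality (hK : IsSolidCone K) : Submodule ℝ E where
  carrier := {x | x ∈ K ∧ -x ∈ K}
  add_mem' {x y} hx hy := ⟨hK.add_mem hx.1 hy.1, by
    rw [neg_add]
    exact hK.add_mem hx.2 hy.2⟩
  zero_mem' := ⟨hK.zero_mem, by simpa using hK.zero_mem⟩
  smul_mem' c x hx := by
    rcases le_total 0 c with h0 | h0
    · refine ⟨hK.smul_mem' h0 hx.1, ?_⟩
      rw [← smul_neg]
      exact hK.smul_mem' h0 hx.2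
    · constructor
      · have := hK.smul_mem' (neg_nonneg.2 h0) hx.2
        rwa [smul_neg, neg_smul, neg_neg] at this
      · have := hK.smul_mem' (neg_nonneg.2 h0) hx.1
        rwa [neg_smul] at this

theorem IsSolidCone.exists_separating (hK : IsSolidCone K) {x : E} (hx : x ∉ K) :
    ∃ ν : E, (∀ y ∈ K, ⟪y, ν⟫ ≤ 0) ∧ 0 < ⟪x, ν⟫ := by
  obtain ⟨f, u, hf, hfx⟩ := geometric_hahn_banach_closed_point hK.convex hK.isClosed hx
  have hu : 0 < u := by simpa using hf 0 hK.zero_mem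
  have hinner : ∀ x, ⟪x, (InnerProductSpace.toDual ℝ E).symm f⟫ = f x := fun x => by
    rw [real_inner_comm, InnerProductSpace.toDual_symm_apply]
  refine ⟨(InnerProductSpace.toDual ℝ E).symm f, fun y hy => ?_, ?_⟩
  · rw [hinner]
    by_contra! hpos
    have h1 := hf _ (hK.smul_mem (u / f y) (by positivity) y hy)
    rw [map_smul, smul_eq_mul, div_mul_cancel₀ _ hpos.ne'] at h1
    exact lt_irrefl _ h1
  · rw [hinner]
    linarith

/-- A supporting functional which vanishes only on the lineality space. -/
theorem IsSolidCone.exists_strict_supporting (hK : IsSolidCone K) :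
    ∃ ν : E, (∀ x ∈ K, ⟪x, ν⟫ ≤ 0) ∧ ∀ x ∈ K, ⟪x, ν⟫ = 0 → -x ∈ K := by
  set P : Set E := {ν | ∀ x ∈ K, ⟪x, ν⟫ ≤ 0} with hP
  set V : E → Submodule ℝ E := fun ν => Submodule.span ℝ {x | x ∈ K ∧ ⟪x, ν⟫ = 0} with hV
  have hPne : P.Nonempty := ⟨0, fun x _ => by simp⟩
  obtain ⟨ν, hν, hmin⟩ : ∃ ν ∈ P, ∀ g ∈ P, finrank ℝ (V ν) ≤ finrank ℝ (V g) := by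
    let S : Set ℕ := (fun ν => finrank ℝ (V ν)) '' P
    obtain ⟨ν, hν, hmin⟩ := Nat.sInf_mem (s := S) (hPne.image _)
    exact ⟨ν, hν, fun g hg => hmin.le.trans (Nat.sInf_le ⟨g, hg, rfl⟩)⟩
  refine ⟨ν, hν, fun x hx hx0 => ?_⟩
  by_contra hneg
  obtain ⟨g, hg, hgx⟩ := hK.exists_separating hneg
  have hνg : ν + g ∈ P := fun y hy => by
    rw [inner_add_right]
    exact add_nonpos (hν y hy) (hg y hy)
  have hzero : ∀ y ∈ K, ⟪y, ν + g⟫ = 0 → ⟪y, ν⟫ = 0 ∧ ⟪y, g⟫ = 0 := by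
    intro y hy h
    rw [inner_add_right] at h
    have h1 := hν y hy
    have h2 := hg y hy
    constructor <;> linarith
  have hle : V (ν + g) ≤ V ν := Submodule.span_mono fun y hy => ⟨hy.1, (hzero y hy.1 hy.2).1⟩
  have heq : V (ν + g) = V ν := Submodule.eq_of_le_of_finrank_le hle (hmin _ hνg)
  have hxV : x ∈ V (ν + g) := heq ▸ Submodule.subset_span ⟨hx, hx0⟩
  have hVg : V (ν + g) ≤ (Submodule.span ℝ {g})ᗮ := by
    refine Submodule.span_le.2 fun y hy => ?_
    rw [SetLike.mem_coe, Submodule.mem_orthogonal_singleton_iff_inner_left]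
    exact (hzero y hy.1 hy.2).2
  have h0 := (Submodule.mem_orthogonal_singleton_iff_inner_left).1 (hVg hxV)
  rw [inner_neg_left, h0] at hgx
  simp at hgx

theorem IsSolidCone.frontier_eq_lineality (hK : IsSolidCone K)
    (hd : finrank ℝ E ≤ finrank ℝ hK.lineality + 1) : frontier K = hK.lineality := by
  obtain ⟨x, hx⟩ := hK.nonempty_interior
  have hxL : x ∉ hK.lineality := fun h => hK.neg_notMem hx h.2
  have htop : hK.lineality ⊔ Submodule.span ℝ {x} = ⊤ := by
    have hlt : hK.lineality < hK.lineality ⊔ Submodule.span ℝ {x} := by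
      refine lt_of_le_of_ne le_sup_left fun h => hxL ?_
      rw [h]
      exact Submodule.mem_sup_right (Submodule.mem_span_singleton_self x)
    have h1 := Submodule.finrank_lt_finrank_of_lt hlt
    exact Submodule.eq_top_of_finrank_eq (le_antisymm (Submodule.finrank_le _) (by omega))
  ext z
  rw [hK.mem_frontier_iff]
  constructor
  · rintro ⟨hz, hzint⟩
    have hz' : z ∈ hK.lineality ⊔ Submodule.span ℝ {x} := htop ▸ Submodule.mem_top
    obtain ⟨m, hm, y, hy, rfl⟩ := Submodule.mem_sup.1 hz'
    obtain ⟨t, rfl⟩ := Submodule.mem_span_singleton.1 hy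
    rcases lt_trichotomy t 0 with ht | rfl | ht
    · exfalso
      have h1 := hK.interior_add_mem ((hK.smul_mem_interior_iff (neg_pos.2 ht)).2 hx) hm.2
      refine hK.neg_notMem h1 ?_
      convert hz using 1
      module
    · simpa using hm
    · exfalso
      refine hzint ?_
      rw [add_comm]
      exact hK.interior_add_mem ((hK.smul_mem_interior_iff ht).2 hx) hm.1
  · rintro ⟨h1, h2⟩
    exact ⟨h1, fun h => hK.neg_notMem h h2⟩

theorem meetingProb_lt_blowUp [MeasurableSpace E] [BorelSpace E] (hK : IsSolidCone K)
    (hp : p ∈ frontier K) (hp' : -p ∉ K)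
    (hd : finrank ℝ (isSolidCone_blowUp hK hp).lineality + 2 ≤ finrank ℝ E) :
    meetingProb K < meetingProb (blowUp K p) := by
  have hH := isSolidCone_blowUp hK hp
  have hpK := (hK.mem_frontier_iff.1 hp).1
  obtain ⟨ν, hν, hν0⟩ := hK.exists_strict_supporting
  have hpν : ⟪p, ν⟫ < 0 := lt_of_le_of_ne (hν p hpK) fun h => hp' (hν0 p hpK h)
  obtain ⟨x₀, hx₀⟩ := hH.nonempty_interior
  set x := x₀ + (-(⟪x₀, ν⟫ / ⟪p, ν⟫)) • p with hx_def
  have hx : x ∈ interior (blowUp K p) := by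
    rw [hK.interior_blowUp] at hx₀ ⊢
    obtain ⟨t, ht⟩ := hx₀
    refine ⟨t + ⟪x₀, ν⟫ / ⟪p, ν⟫, ?_⟩
    convert ht using 1
    rw [hx_def]
    module
  have hxν : ⟪x, ν⟫ = 0 := by
    rw [hx_def, inner_add_left, inner_smul_left]
    simp only [map_neg, conj_trivial]
    rw [neg_mul, div_mul_cancel₀ _ hpν.ne, add_neg_cancel]
  have hlt : hK.lineality < hH.lineality := by
    refine lt_of_le_of_ne (fun y hy => ⟨hK.subset_blowUp p hy.1, hK.subset_blowUp p hy.2⟩) ?_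
    intro h
    have hpH : p ∈ hH.lineality := by
      refine ⟨hK.subset_blowUp p hpK, ?_⟩
      have := add_smul_mem_blowUp (p := p) (-1) hH.zero_mem
      simpa using this
    rw [← h] at hpH
    exact hp' hpH.2
  have hν0' : ν ≠ 0 := by
    rintro rfl
    simp at hpν
  have h1 := Submodule.finrank_lt_finrank_of_lt hlt
  have h2 : finrank ℝ (hK.lineality ⊔ Submodule.span ℝ {x} : Submodule ℝ E) ≤
      finrank ℝ hK.lineality + 1 :=
    (Submodule.finrank_add_le_finrank_add_finrank _ _).trans
      (add_le_add le_rfl (by simpa using finrank_span_le_card (R := ℝ) ({x} : Set E)))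
  have h3 := (Submodule.span ℝ {ν}).finrank_add_finrank_orthogonal
  rw [finrank_span_singleton hν0'] at h3
  have hnot : ¬ (Submodule.span ℝ {ν})ᗮ ≤ hK.lineality ⊔ Submodule.span ℝ {x} := by
    intro h
    have := Submodule.finrank_mono h
    omega
  obtain ⟨y, hy, hyn⟩ := SetLike.not_le_iff_exists.1 hnot
  rw [Submodule.mem_orthogonal_singleton_iff_inner_left] at hy
  refine meetingProb_lt hK (hK.subset_blowUp p) hx (y := y) fun a b hab => ?_
  have h4 : ⟪a • x + b • y, ν⟫ = 0 := by
    rw [inner_add_left, inner_smul_left, inner_smul_left, hxν, hy]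
    simp
  have hmem : a • x + b • y ∈ hK.lineality := ⟨hab, hν0 _ hab h4⟩
  have hb : b = 0 := by
    by_contra hb
    apply hyn
    have h5 : y = b⁻¹ • (a • x + b • y) + (-(b⁻¹ * a)) • x := by
      rw [smul_add, smul_smul, smul_smul, inv_mul_cancel₀ hb]
      module
    rw [h5]
    exact Submodule.add_mem_sup (Submodule.smul_mem _ _ hmem)
      (Submodule.smul_mem _ _ (Submodule.mem_span_singleton_self x))
  refine ⟨?_, hb⟩
  by_contra ha
  rw [hb, zero_smul, add_zero] at hmem
  have h6 := hK.lineality.smul_mem a⁻¹ hmem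
  rw [smul_smul, inv_mul_cancel₀ ha, one_smul] at h6
  exact hH.neg_notMem hx (hK.subset_blowUp p h6.2)

end BlowUp

section TangentLink

open scoped ENNReal NNReal Topology Pointwise
open Set Filter Module

/-- An isometry between two cones with apex `0` may be chosen linear. -/
theorem exists_linearIsometryEquiv_image_eq {E : Type*} [NormedAddCommGroup E] [NormedSpace ℝ E]
    {S T : Set E} (hS : ∀ c : ℝ, 0 < c → ∀ x ∈ S, c • x ∈ S)
    (hT : ∀ c : ℝ, 0 < c → ∀ x ∈ T, c • x ∈ T) (φ : E ≃ᵢ E) (h : φ '' S = T) :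
    ∃ A : E ≃ₗᵢ[ℝ] E, A '' S = T := by
  set A := φ.toRealLinearIsometryEquiv with hA
  set a := φ 0 with ha
  have hφ : ∀ x, φ x = A x + a := fun x => by
    rw [hA, IsometryEquiv.toRealLinearIsometryEquiv_apply, sub_add_cancel]
  have hscale : ∀ c : ℝ, 0 < c → ∀ y ∈ T, c • y + (1 - c) • a ∈ T := by
    intro c hc y hy
    rw [← h] at hy ⊢
    obtain ⟨x, hx, rfl⟩ := hy
    refine ⟨c • x, hS c hc x hx, ?_⟩
    rw [hφ, hφ, map_smul]
    module
  have hsub : ∀ y ∈ T, y - a ∈ T := fun y hy => by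
    have := hscale 2 (by norm_num) _ (hT (1 / 2) (by norm_num) y hy)
    convert this using 1
    module
  have hadd : ∀ y ∈ T, y + a ∈ T := fun y hy => by
    have := hT 2 (by norm_num) _ (hscale (1 / 2) (by norm_num) y hy)
    convert this using 1
    module
  refine ⟨A, Subset.antisymm ?_ fun y hy => ?_⟩
  · rintro _ ⟨x, hx, rfl⟩
    have := hsub _ (h ▸ mem_image_of_mem φ hx)
    rwa [hφ, add_sub_cancel_right] at this
  · have := hadd y hy
    rw [← h] at this
    obtain ⟨x, hx, hxy⟩ := this
    rw [hφ] at hxy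
    exact ⟨x, hx, add_right_cancel hxy⟩

theorem areaRatio_image_of_isometry {E F : Type*} [NormedAddCommGroup E] [MeasurableSpace E]
    [BorelSpace E] [NormedAddCommGroup F] [MeasurableSpace F] [BorelSpace F] (d : ℕ) {f : E → F}
    (hf : Isometry f) (A : Set E) : areaRatio d (f '' A) = areaRatio d A := by
  rw [areaRatio, areaRatio, hf.euclideanHausdorffMeasure_image]

variable {E : Type*} [NormedAddCommGroup E] [InnerProductSpace ℝ E] {K : Set E} {p : E}

theorem inner_coe_orthogonal_singleton (u : (ℝ ∙ p)ᗮ) : ⟪(u : E), p⟫ = 0 :=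
  Submodule.mem_orthogonal_singleton_iff_inner_left.1 u.2

variable [FiniteDimensional ℝ E]

theorem finrank_orthogonal_singleton_prod (hp : ‖p‖ = 1) :
    finrank ℝ ((ℝ ∙ p)ᗮ × ℝ) = finrank ℝ E := by
  have h0 : p ≠ 0 := by
    rintro rfl
    simp at hp
  have h := (ℝ ∙ p).finrank_add_finrank_orthogonal
  rw [finrank_span_singleton h0] at h
  rw [finrank_prod, finrank_self, ← h, add_comm]

/-- The orthogonal decomposition `pᗮ × ℝ ≃ E` determined by a unit vector `p`. -/
noncomputable def orthogonalSplit (hp : ‖p‖ = 1) : ((ℝ ∙ p)ᗮ × ℝ) ≃ₗ[ℝ] E :=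
  LinearMap.linearEquivOfInjective
    ((ℝ ∙ p)ᗮ.subtype.coprod (LinearMap.toSpanSingleton ℝ E p)) (by
      rw [← LinearMap.ker_eq_bot, LinearMap.ker_eq_bot']
      rintro ⟨u, t⟩ h
      have h1 : (u : E) + t • p = 0 := h
      have h2 : ⟪(u : E) + t • p, p⟫ = 0 := by rw [h1, inner_zero_left]
      rw [inner_add_left, inner_coe_orthogonal_singleton, inner_smul_left, zero_add,
        real_inner_self_eq_norm_sq, hp] at h2
      have ht : t = 0 := by simpa using h2
      rw [ht, zero_smul, add_zero] at h1
      rw [ht, Submodule.coe_eq_zero.1 h1]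
      rfl) (finrank_orthogonal_singleton_prod hp)

theorem orthogonalSplit_apply (hp : ‖p‖ = 1) (u : (ℝ ∙ p)ᗮ) (t : ℝ) :
    orthogonalSplit hp (u, t) = u + t • p := rfl

theorem norm_orthogonalSplit_sq (hp : ‖p‖ = 1) (u : (ℝ ∙ p)ᗮ) (t : ℝ) :
    ‖orthogonalSplit hp (u, t)‖ ^ 2 = ‖u‖ ^ 2 + ‖t‖ ^ 2 := by
  rw [orthogonalSplit_apply, norm_add_sq_real, inner_smul_right, inner_coe_orthogonal_singleton,
    norm_smul, hp, Submodule.coe_norm]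
  ring

theorem exists_eq_coe_add_smul (hp : ‖p‖ = 1) (x : E) :
    ∃ (u : (ℝ ∙ p)ᗮ) (t : ℝ), x = u + t • p :=
  ⟨((orthogonalSplit hp).symm x).1, ((orthogonalSplit hp).symm x).2, by
    rw [← orthogonalSplit_apply hp, LinearEquiv.apply_symm_apply]⟩

/-- The cross-section of the blow-up at `p` by the hyperplane orthogonal to `p`. -/
def blowUpSection (K : Set E) (p : E) : Set (ℝ ∙ p)ᗮ := (↑) ⁻¹' blowUp K p

theorem blowUp_eq_preimage (hp : ‖p‖ = 1) :
    blowUp K p = (fun x => ((orthogonalSplit hp).symm x).1) ⁻¹' blowUpSection K p := by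
  ext x
  obtain ⟨⟨u, t⟩, rfl⟩ := (orthogonalSplit hp).surjective x
  rw [mem_preimage, LinearEquiv.symm_apply_apply, orthogonalSplit_apply, add_smul_mem_blowUp_iff]
  rfl

theorem continuous_fst_orthogonalSplit_symm (hp : ‖p‖ = 1) :
    Continuous fun x => ((orthogonalSplit hp).symm x).1 :=
  continuous_fst.comp (orthogonalSplit hp).toContinuousLinearEquiv.symm.continuous

theorem isOpenMap_fst_orthogonalSplit_symm (hp : ‖p‖ = 1) :
    IsOpenMap fun x => ((orthogonalSplit hp).symm x).1 :=
  isOpenMap_fst.comp (orthogonalSplit hp).toContinuousLinearEquiv.symm.toHomeomorph.isOpenMap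

theorem isSolidCone_blowUpSection (hp : ‖p‖ = 1) (hK : IsSolidCone K) (hpK : p ∈ frontier K) :
    IsSolidCone (blowUpSection K p) where
  isClosed := (isSolidCone_blowUp hK hpK).isClosed.preimage continuous_subtype_val
  convex := (isSolidCone_blowUp hK hpK).convex.linear_preimage (ℝ ∙ p)ᗮ.subtype
  smul_mem c hc x hx := (isSolidCone_blowUp hK hpK).smul_mem c hc x hx
  nonempty_interior := by
    obtain ⟨x, hx⟩ := (isSolidCone_blowUp hK hpK).nonempty_interior
    rw [blowUp_eq_preimage hp, ← (isOpenMap_fst_orthogonalSplit_symm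
      hp).preimage_interior_eq_interior_preimage (continuous_fst_orthogonalSplit_symm hp)] at hx
    exact ⟨_, hx⟩
  ne_univ h := (isSolidCone_blowUp hK hpK).ne_univ (by
    rw [blowUp_eq_preimage hp, h, preimage_univ])

theorem add_smul_mem_frontier_blowUp_iff (hK : IsSolidCone K) (hpK : p ∈ frontier K) (t : ℝ)
    {x : E} : x + t • p ∈ frontier (blowUp K p) ↔ x ∈ frontier (blowUp K p) := by
  have hH := isSolidCone_blowUp hK hpK
  rw [hH.mem_frontier_iff, hH.mem_frontier_iff, add_smul_mem_blowUp_iff, hK.interior_blowUp]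
  refine and_congr_right fun _ => not_congr ⟨?_, ?_⟩
  · rintro ⟨s, hs⟩
    refine ⟨t + s, ?_⟩
    rwa [add_smul, ← add_assoc]
  · rintro ⟨s, hs⟩
    refine ⟨s - t, ?_⟩
    rwa [add_assoc, ← add_smul, add_sub_cancel]

theorem mem_frontier_blowUpSection_iff (hp : ‖p‖ = 1) {u : (ℝ ∙ p)ᗮ} :
    u ∈ frontier (blowUpSection K p) ↔ (u : E) ∈ frontier (blowUp K p) := by
  have hu : ((orthogonalSplit hp).symm (u : E)).1 = u := by
    have : (u : E) = orthogonalSplit hp (u, 0) := by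
      rw [orthogonalSplit_apply, zero_smul, add_zero]
    rw [this, LinearEquiv.symm_apply_apply]
  rw [blowUp_eq_preimage hp, ← (isOpenMap_fst_orthogonalSplit_symm
      hp).preimage_frontier_eq_frontier_preimage (continuous_fst_orthogonalSplit_symm hp),
    mem_preimage, hu]

theorem meetingProb_blowUp [MeasurableSpace E] [BorelSpace E] (hp : ‖p‖ = 1) :
    meetingProb (blowUp K p) = meetingProb (blowUpSection K p) := by
  conv_lhs => rw [blowUp_eq_preimage hp]
  exact meetingProb_prod (orthogonalSplit hp) (norm_orthogonalSplit_sq hp) _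

variable {Γ : Set E}

theorem mem_tangentLink_iff (hK : IsSolidCone K) (hpK : p ∈ frontier K)
    (hΓ : coneOver Γ = frontier K) {x : E} :
    x ∈ tangentLink Γ p ↔ x - p ∈ frontier (blowUp K p) ∧ ⟪x - p, p⟫ = 0 ∧ ‖x - p‖ = 1 := by
  rw [← posTangentConeAt_frontier hK hpK, ← hΓ]
  constructor
  · rintro ⟨⟨h1, -⟩, h2, h3⟩
    exact ⟨h1, h2, h3⟩
  · rintro ⟨h1, h2, h3⟩
    exact ⟨⟨h1, h2⟩, h2, h3⟩

theorem tangentLink_eq_image (hp : ‖p‖ = 1) (hK : IsSolidCone K) (hpK : p ∈ frontier K)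
    (hΓ : coneOver Γ = frontier K) :
    tangentLink Γ p =
      (fun u : (ℝ ∙ p)ᗮ => p + (u : E)) '' (frontier (blowUpSection K p) ∩ Metric.sphere 0 1) := by
  ext x
  rw [mem_tangentLink_iff hK hpK hΓ]
  constructor
  · rintro ⟨h1, h2, h3⟩
    exact ⟨⟨x - p, Submodule.mem_orthogonal_singleton_iff_inner_left.2 h2⟩,
      ⟨(mem_frontier_blowUpSection_iff hp).2 h1, mem_sphere_zero_iff_norm.2 h3⟩,
      add_sub_cancel _ _⟩
  · rintro ⟨u, ⟨h1, h2⟩, rfl⟩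
    simp only [add_sub_cancel_left]
    exact ⟨(mem_frontier_blowUpSection_iff hp).1 h1, inner_coe_orthogonal_singleton u,
      mem_sphere_zero_iff_norm.1 h2⟩

theorem areaRatio_tangentLink [MeasurableSpace E] [BorelSpace E] {m : ℕ}
    (hd : finrank ℝ E = m + 3) (hp : ‖p‖ = 1) (hK : IsSolidCone K) (hpK : p ∈ frontier K)
    (hΓ : coneOver Γ = frontier K) :
    areaRatio m (tangentLink Γ p) = meetingProb (blowUp K p) := by
  have hiso : Isometry fun u : (ℝ ∙ p)ᗮ => p + (u : E) :=
    (IsometryEquiv.addLeft p).isometry.comp isometry_subtype_coe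
  have hfin : finrank ℝ (ℝ ∙ p)ᗮ = m + 2 := by
    have := finrank_orthogonal_singleton_prod hp
    rw [finrank_prod, finrank_self] at this
    omega
  rw [tangentLink_eq_image hp hK hpK hΓ, areaRatio_image_of_isometry _ hiso,
    areaRatio_frontier hfin (isSolidCone_blowUpSection hp hK hpK), meetingProb_blowUp hp]

theorem tangentLinkCone_eq [MeasurableSpace E] [BorelSpace E] {m : ℕ}
    (hd : finrank ℝ E = m + 3) (hp : ‖p‖ = 1) (hK : IsSolidCone K) (hpK : p ∈ frontier K)
    (hΓ : coneOver Γ = frontier K) :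
    tangentLinkCone p (tangentLink Γ p) = frontier (blowUp K p) ∩ {v | ⟪v, p⟫ = 0} := by
  have hH := isSolidCone_blowUp hK hpK
  ext v
  constructor
  · rintro ⟨r, hr, _, ⟨x, hx, rfl⟩, rfl⟩
    obtain ⟨h1, h2, -⟩ := (mem_tangentLink_iff hK hpK hΓ).1 hx
    refine ⟨?_, by rw [mem_ofPred_eq, inner_smul_left, h2, mul_zero]⟩
    rcases hr.eq_or_lt with rfl | hr
    · rw [zero_smul]
      exact hH.zero_mem_frontier
    · exact (hH.smul_mem_frontier_iff hr).2 h1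
  · rintro ⟨h1, h2⟩
    by_cases hv : v = 0
    · obtain ⟨x, hx⟩ : (tangentLink Γ p).Nonempty := by
        by_contra! h
        have h3 := areaRatio_tangentLink hd hp hK hpK hΓ
        rw [h, areaRatio, measure_empty, ENNReal.zero_div] at h3
        exact meetingProb_ne_zero hH h3.symm
      exact ⟨0, le_rfl, _, mem_image_of_mem _ hx, by rw [hv, zero_smul]⟩
    · have hv0 : 0 < ‖v‖ := norm_pos_iff.2 hv
      refine ⟨‖v‖, hv0.le, _, ⟨p + ‖v‖⁻¹ • v, ?_, rfl⟩, ?_⟩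
      · rw [mem_tangentLink_iff hK hpK hΓ, add_sub_cancel_left]
        refine ⟨(hH.smul_mem_frontier_iff (inv_pos.2 hv0)).2 h1, ?_, ?_⟩
        · rw [inner_smul_left, h2, mul_zero]
        · rw [norm_smul, norm_inv, norm_norm, inv_mul_cancel₀ hv0.ne']
      · simp only [add_sub_cancel_left]
        rw [smul_smul, mul_inv_cancel₀ hv0.ne', one_smul]

theorem lineProd_frontier_blowUp (hp : ‖p‖ = 1) (hK : IsSolidCone K) (hpK : p ∈ frontier K) :
    lineProd p (frontier (blowUp K p) ∩ {v | ⟪v, p⟫ = 0}) = frontier (blowUp K p) := by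
  ext x
  constructor
  · rintro ⟨t, v, ⟨hv, -⟩, rfl⟩
    rwa [add_comm, add_smul_mem_frontier_blowUp_iff hK hpK]
  · intro hx
    obtain ⟨u, t, rfl⟩ := exists_eq_coe_add_smul hp x
    exact ⟨t, u, ⟨(add_smul_mem_frontier_blowUp_iff hK hpK t).1 hx,
      inner_coe_orthogonal_singleton u⟩, add_comm _ _⟩

theorem mem_lineality_blowUp (hK : IsSolidCone K) (hpK : p ∈ frontier K) :
    p ∈ (isSolidCone_blowUp hK hpK).lineality := by
  refine ⟨hK.subset_blowUp p (hK.mem_frontier_iff.1 hpK).1, ?_⟩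
  simpa using add_smul_mem_blowUp (p := p) (-1) (isSolidCone_blowUp hK hpK).zero_mem

theorem exists_submodule_of_finrank_le {m : ℕ} (hd : finrank ℝ E = m + 2) (hp : ‖p‖ = 1)
    (hK : IsSolidCone K) (hpK : p ∈ frontier K)
    (h : finrank ℝ E ≤ finrank ℝ (isSolidCone_blowUp hK hpK).lineality + 1) :
    ∃ W : Submodule ℝ E, finrank ℝ W = m ∧
      frontier (blowUp K p) ∩ {v | ⟪v, p⟫ = 0} = W := by
  have hH := isSolidCone_blowUp hK hpK
  have hpM := mem_lineality_blowUp hK hpK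
  have hfr := hH.frontier_eq_lineality h
  set M := hH.lineality with hM
  have hle : ℝ ∙ p ≤ M := (Submodule.span_singleton_le_iff_mem _ _).2 hpM
  have hlt : finrank ℝ M < finrank ℝ E := by
    refine Submodule.finrank_lt fun htop => ?_
    obtain ⟨x, hx⟩ := hH.nonempty_interior
    have hx' : x ∈ M := htop ▸ Submodule.mem_top
    exact hH.neg_notMem hx hx'.2
  have h0 : p ≠ 0 := by
    rintro rfl
    simp at hp
  have h1 := Submodule.finrank_add_inf_finrank_orthogonal hle
  rw [finrank_span_singleton h0] at h1
  refine ⟨(ℝ ∙ p)ᗮ ⊓ M, by omega, ?_⟩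
  rw [hfr]
  ext v
  simp only [mem_inter_iff, SetLike.mem_coe, mem_ofPred_eq, Submodule.mem_inf,
    Submodule.mem_orthogonal_singleton_iff_inner_left]
  exact and_comm

end TangentLink

theorem smul_mem_coneOver {E : Type*} [NormedAddCommGroup E] [NormedSpace ℝ E] {A : Set E} {c : ℝ}
    (hc : 0 ≤ c) {x : E} (hx : x ∈ coneOver A) : c • x ∈ coneOver A := by
  obtain ⟨r, hr, y, hy, rfl⟩ := hx
  exact ⟨c * r, mul_nonneg hc hr, y, hy, smul_smul c r y⟩

theorem coneOver_inter_sphere {E : Type*} [NormedAddCommGroup E] [NormedSpace ℝ E] {A : Set E}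
    (hA : A ⊆ Metric.sphere 0 1) : coneOver A ∩ Metric.sphere 0 1 = A := by
  ext x
  constructor
  · rintro ⟨⟨r, hr, y, hy, rfl⟩, hx⟩
    rw [mem_sphere_zero_iff_norm, norm_smul, mem_sphere_zero_iff_norm.1 (hA hy), mul_one,
      Real.norm_of_nonneg hr] at hx
    rwa [hx, one_smul]
  · intro hx
    exact ⟨⟨1, zero_le_one, x, hx, (one_smul ℝ x).symm⟩, hA hx⟩

theorem lemma3p6 (n : ℕ) (hn : 1 ≤ n) (Γ : Set (EuclideanSpace ℝ (Fin (n + 2))))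
    (hΓ : IsSphericalConvexHypersurface Γ) (p : EuclideanSpace ℝ (Fin (n + 2))) (hp : p ∈ Γ) :
    areaRatio n Γ ≤ areaRatio (n - 1) (tangentLink Γ p) ∧
    ((¬ ∃ W : Submodule ℝ (EuclideanSpace ℝ (Fin (n + 2))),
        Module.finrank ℝ W = n ∧ tangentLinkCone p (tangentLink Γ p) = W) →
      (areaRatio n Γ = areaRatio (n - 1) (tangentLink Γ p) ↔
        AreCongruent (coneOver Γ) (lineProd p (tangentLinkCone p (tangentLink Γ p)))) ∧
      (areaRatio n Γ = areaRatio (n - 1) (tangentLink Γ p) ↔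
        coneOver Γ = lineProd p (tangentLinkCone p (tangentLink Γ p)))) := by
  obtain ⟨m, rfl⟩ : ∃ m, n = m + 1 := ⟨n - 1, by omega⟩
  obtain ⟨K, hKc, hKconv, hKint, hKne, hfr⟩ := hΓ.convex_cone
  have hK : IsSolidCone K := isSolidCone_of_smul_mem_frontier hKc hKconv hKint hKne
    fun c hc x hx => hfr ▸ smul_mem_coneOver hc.le (hfr ▸ hx)
  have hp1 : ‖p‖ = 1 := mem_sphere_zero_iff_norm.1 (hΓ.subset_sphere hp)
  have hpK : p ∈ frontier K := hfr ▸ ⟨1, zero_le_one, p, hp, (one_smul ℝ p).symm⟩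
  have hd : Module.finrank ℝ (EuclideanSpace ℝ (Fin (m + 1 + 2))) = m + 3 := by
    rw [finrank_euclideanSpace_fin]
  have hH := isSolidCone_blowUp hK hpK
  have hΓK : areaRatio (m + 1) Γ = meetingProb K := by
    rw [← areaRatio_frontier (k := m + 1) hd hK, ← hfr, coneOver_inter_sphere hΓ.subset_sphere]
  rw [Nat.add_sub_cancel, tangentLinkCone_eq hd hp1 hK hpK hfr,
    lineProd_frontier_blowUp hp1 hK hpK, areaRatio_tangentLink hd hp1 hK hpK hfr, hΓK, hfr]
  have hKH := hK.subset_blowUp p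
  refine ⟨meetingProb_mono hKH, fun hW => ?_⟩
  have hset : meetingProb K = meetingProb (blowUp K p) → frontier K = frontier (blowUp K p) := by
    intro heq
    by_cases hp' : -p ∈ K
    · exact congrArg frontier
        (hKH.antisymm (hK.subset_of_neg_mem (hK.mem_frontier_iff.1 hpK).1 hp'))
    · refine absurd heq (meetingProb_lt_blowUp hK hpK hp' ?_).ne
      by_contra! hlt
      exact hW (exists_submodule_of_finrank_le hd hp1 hK hpK (by omega))
  have hcongr : frontier K = frontier (blowUp K p) →
      AreCongruent (frontier K) (frontier (blowUp K p)) := fun h =>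
    ⟨IsometryEquiv.refl _, by
      rw [h]
      exact Set.image_id _⟩
  have hprob : AreCongruent (frontier K) (frontier (blowUp K p)) →
      meetingProb K = meetingProb (blowUp K p) := by
    rintro ⟨φ, hφ⟩
    obtain ⟨A, hA⟩ := exists_linearIsometryEquiv_image_eq
      (fun c hc x hx => (hK.smul_mem_frontier_iff hc).2 hx)
      (fun c hc x hx => (hH.smul_mem_frontier_iff hc).2 hx) φ hφ
    have hAS : A '' Metric.sphere 0 1 = Metric.sphere 0 1 := by
      rw [A.image_sphere, map_zero]
    rw [← areaRatio_frontier (k := m + 1) hd hK, ← areaRatio_frontier (k := m + 1) hd hH, ← hA]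
    nth_rewrite 2 [← hAS]
    rw [← Set.image_inter A.injective, areaRatio_image_of_isometry _ A.isometry]
  exact ⟨⟨fun h => hcongr (hset h), hprob⟩, ⟨hset, fun h => hprob (hcongr h)⟩⟩
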